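/- **Conventions.** Let $K$ be a field of characteristic $0$. All differentials have degree $+1$. For a (graded, $K$-linear) prop $P$ write $P(p,q)$ for the space of operations with $p$ outputs and $q$ inputs; signs follow the Koszul rule. For an $\mathbb S$-bimodule $E$ let $\Gamma\langle E\rangle$ be the free graded prop generated by $E$; it is spanned by directed graphs without directed cycles, with vertices decorated by elements of $E$. Completions are taken in each arity $(p,q)$ and each cohomological degree separately. **The prop $\mathsf{DefQ}^+$.** Let $\mathsf D^+$ be the $\mathbb S$-bimodule for which $\mathsf D^+(p,q)$ has as a basis all corollas $$\Big(I_1|\cdots|I_m\ ;\ J_1|\cdots|J_n\Big),\qquad m,n\ge 1,\quad [p]=I_1\sqcup\dots\sqcup I_m,\quad [q]=J_1\sqcup\dots\sqcup J_n,$$ indexed by pairs of ordered partitions of the set of outputs and of the set of inputs into nonempty bunches, in cohomological degree $3-m-n$, with the symmetric groups acting by relabelling of the legs (without signs). $\mathsf{DefQ}^+$ is the free graded prop $\Gamma\langle\mathsf D^+\rangle$, completed with respect to the genus filtration, and $\mathsf d_1$ is the continuous derivation of $\mathsf{DefQ}^+$ given on generators by $$\mathsf d_1(I_1|\cdots|I_m;J_1|\cdots|J_n)=\sum_{i=1}^{m-1}(-1)^i(I_1|\cdots|I_i\sqcup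 I_{i+1}|\cdots|I_m;J_1|\cdots|J_n)+(-1)^m\sum_{j=1}^{n-1}(-1)^j(I_1|\cdots|I_m;J_1|\cdots|J_j\sqcup J_{j+1}|\cdots|J_n).$$ It satisfies $\mathsf d_1^2=0$. (It is the part of the full differential of $\mathsf{DefQ}^+$ that is linear in the number of vertices, the graph incarnation of the Gerstenhaber–Schack differential.) **The prop $\widehat{\mathsf{LieB}}{}^+_\infty$.** Let $\mathsf L^+$ be the $\mathbb S$-bimodule with $\mathsf L^+(p,q)=\mathrm{sgn}_p\otimes \mathrm{sgn}_q$, concentrated in degree $3-p-q$, for all $p,q\ge1$ (including $p=q=1$), and $\mathsf L^+(p,q)=0$ otherwise. $\widehat{\mathsf{LieB}}{}^+_\infty$ is the free graded prop $\Gamma\langle\mathsf L^+\rangle$, completed with respect to the number of vertices. **Theorem.** The cohomology $H^\bullet(\mathsf{DefQ}^+,\mathsf d_1)$, with the prop structure induced from $\mathsf{DefQ}^+$, is isomorphic as a graded prop to $\widehat{\mathsf{LieB}}{}^+_\infty$. -/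

import Mathlib

universe u

noncomputable section

namespace DefQuant

open Finset

/-- The sign `(-1)^n`, as a scalar. -/
def sg (K : Type u) [Field K] (n : ℤ) : K := ((n.negOnePow : ℤˣ) : ℤ)

section Signs
variable (K : Type u) [Field K]

theorem sg_add (m n : ℤ) : sg K (m + n) = sg K m * sg K n := by
  simp [sg, Int.negOnePow_add]

@[simp] theorem sg_zero : sg K 0 = 1 := by simp [sg]

@[simp] theorem sg_one : sg K 1 = -1 := by simp [sg]

theorem sg_mul_self (n : ℤ) : sg K n * sg K n = 1 := by
  rw [← sg_add, sg, Int.negOnePow_even _ ⟨n, rfl⟩]; simp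

theorem sg_congr {m n : ℤ} (h : Even (m - n)) : sg K m = sg K n := by
  rw [← sub_add_cancel m n, sg_add, sg, Int.negOnePow_even _ h]; simp

theorem sg_succ (n : ℤ) : sg K (n + 1) = - sg K n := by
  rw [sg_add, sg_one, mul_neg_one]

end Signs

/-- The block sum of two bijections. -/
def blockSum {p q p' q' : ℕ} (σ : Fin q ≃ Fin p) (τ : Fin q' ≃ Fin p') :
    Fin (q + q') ≃ Fin (p + p') :=
  finSumFinEquiv.symm.trans ((Equiv.sumCongr σ τ).trans finSumFinEquiv)

/-- A `K`-linear prop graded by a commutative monoid `A`, with Koszul signs governed by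
`deg : A → ℤ`.  `Hom p q a` is the space of operations with `p` outputs and `q` inputs of
degree `a`; `comp h f g` is the vertical composition `f ∘ g`, `tensor h f g` the horizontal
composition `f ⊗ g`, and `perm σ` is the operation that carries input `i` to output `σ i`
(in particular the identity and the permutations).  Each degree `c = a + b` of a composite comes
with a proof of that equation, so that no casts are needed. -/
structure GradedProp (K : Type u) [Field K] {A : Type} [AddCommMonoid A] (deg : A →+ ℤ) where
  Hom : ℕ → ℕ → A → Type u
  [addCommGroup : ∀ p q a, AddCommGroup (Hom p q a)]
  [module : ∀ p q a, Module K (Hom p q a)]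
  comp : ∀ {p r q : ℕ} {a b c : A}, a + b = c →
    Hom p r a →ₗ[K] Hom r q b →ₗ[K] Hom p q c
  tensor : ∀ {p q p' q' : ℕ} {a b c : A}, a + b = c →
    Hom p q a →ₗ[K] Hom p' q' b →ₗ[K] Hom (p + p') (q + q') c
  perm : ∀ {p q : ℕ}, (Fin q ≃ Fin p) → Hom p q 0
  perm_comp_perm : ∀ {p r q : ℕ} (σ : Fin r ≃ Fin p) (τ : Fin q ≃ Fin r),
    comp (add_zero 0) (perm σ) (perm τ) = perm (τ.trans σ)
  id_comp : ∀ {p q : ℕ} {a : A} (f : Hom p q a),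
    comp (zero_add a) (perm (Equiv.refl (Fin p))) f = f
  comp_id : ∀ {p q : ℕ} {a : A} (f : Hom p q a),
    comp (add_zero a) f (perm (Equiv.refl (Fin q))) = f
  comp_assoc : ∀ {p r s q : ℕ} {a b c ab bc abc : A} (h₁ : a + b = ab) (h₂ : ab + c = abc)
    (h₃ : b + c = bc) (h₄ : a + bc = abc) (f : Hom p r a) (g : Hom r s b) (h : Hom s q c),
    comp h₂ (comp h₁ f g) h = comp h₄ f (comp h₃ g h)
  perm_tensor_perm : ∀ {p q p' q' : ℕ} (σ : Fin q ≃ Fin p) (τ : Fin q' ≃ Fin p'),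
    tensor (add_zero 0) (perm σ) (perm τ) = perm (blockSum σ τ)
  tensor_assoc : ∀ {p q p' q' p'' q'' : ℕ} {a b c ab bc abc : A} (h₁ : a + b = ab)
    (h₂ : ab + c = abc) (h₃ : b + c = bc) (h₄ : a + bc = abc)
    (f : Hom p q a) (g : Hom p' q' b) (h : Hom p'' q'' c),
    comp (zero_add abc) (perm (finCongr (add_assoc p p' p''))) (tensor h₂ (tensor h₁ f g) h) =
      comp (add_zero abc) (tensor h₄ f (tensor h₃ g h)) (perm (finCongr (add_assoc q q' q'')))
  unit_tensor : ∀ {p q : ℕ} {a : A} (f : Hom p q a),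
    comp (zero_add a) (perm (finCongr (zero_add p)))
        (tensor (zero_add a) (perm (Equiv.refl (Fin 0))) f) =
      comp (add_zero a) f (perm (finCongr (zero_add q)))
  tensor_unit : ∀ {p q : ℕ} {a : A} (f : Hom p q a),
    comp (zero_add a) (perm (finCongr (add_zero p)))
        (tensor (add_zero a) f (perm (Equiv.refl (Fin 0)))) =
      comp (add_zero a) f (perm (finCongr (add_zero q)))
  interchange : ∀ {p r q p' r' q' : ℕ} {a a' b b' aa bb ab ab' c : A}
    (h₁ : a + a' = aa) (h₂ : b + b' = bb) (h₃ : aa + bb = c)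
    (h₄ : a + b = ab) (h₅ : a' + b' = ab') (h₆ : ab + ab' = c)
    (f : Hom p r a) (f' : Hom p' r' a') (g : Hom r q b) (g' : Hom r' q' b'),
    comp h₃ (tensor h₁ f f') (tensor h₂ g g') =
      sg K (deg a' * deg b) • tensor h₆ (comp h₄ f g) (comp h₅ f' g')
  symmetry : ∀ {p q p' q' : ℕ} {a b c : A} (h₁ : a + b = c) (h₂ : b + a = c)
    (f : Hom p q a) (g : Hom p' q' b),
    comp (zero_add c) (perm (finAddFlip : Fin (p + p') ≃ Fin (p' + p))) (tensor h₁ f g) =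
      sg K (deg a * deg b) •
        comp (add_zero c) (tensor h₂ g f) (perm (finAddFlip : Fin (q + q') ≃ Fin (q' + q)))

attribute [instance] GradedProp.addCommGroup GradedProp.module

/-- An isomorphism of graded props. -/
structure GradedProp.Iso {K : Type u} [Field K] {A : Type} [AddCommMonoid A] {deg : A →+ ℤ}
    (P Q : GradedProp K deg) where
  equiv : ∀ (p q : ℕ) (a : A), P.Hom p q a ≃ₗ[K] Q.Hom p q a
  map_perm : ∀ {p q : ℕ} (σ : Fin q ≃ Fin p), equiv p q 0 (P.perm σ) = Q.perm σ
  map_comp : ∀ {p r q : ℕ} {a b c : A} (h : a + b = c) (f : P.Hom p r a) (g : P.Hom r q b),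
    equiv p q c (P.comp h f g) = Q.comp h (equiv p r a f) (equiv r q b g)
  map_tensor : ∀ {p q p' q' : ℕ} {a b c : A} (h : a + b = c)
    (f : P.Hom p q a) (g : P.Hom p' q' b),
    equiv (p + p') (q + q') c (P.tensor h f g) =
      Q.tensor h (equiv p q a f) (equiv p' q' b g)

/-- A differential on a graded prop: a square-zero derivation that raises the grading by `s`,
where `s` has degree one. -/
structure GradedProp.Differential {K : Type u} [Field K] {A : Type} [AddCommMonoid A]
    {deg : A →+ ℤ} (P : GradedProp K deg) (s : A) where
  deg_shift : deg s = 1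
  d : ∀ {p q : ℕ} {a b : A}, a + s = b → P.Hom p q a →ₗ[K] P.Hom p q b
  d_d : ∀ {p q : ℕ} {a b c : A} (h : a + s = b) (h' : b + s = c) (f : P.Hom p q a),
    d h' (d h f) = 0
  d_perm : ∀ {p q : ℕ} {b : A} (h : 0 + s = b) (σ : Fin q ≃ Fin p), d h (P.perm σ) = 0
  d_comp : ∀ {p r q : ℕ} {a b c a' b' c' : A} (h : a + b = c) (ha : a + s = a')
    (hb : b + s = b') (hc : c + s = c') (h₁ : a' + b = c') (h₂ : a + b' = c')
    (f : P.Hom p r a) (g : P.Hom r q b),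
    d hc (P.comp h f g) = P.comp h₁ (d ha f) g + sg K (deg a) • P.comp h₂ f (d hb g)
  d_tensor : ∀ {p q p' q' : ℕ} {a b c a' b' c' : A} (h : a + b = c) (ha : a + s = a')
    (hb : b + s = b') (hc : c + s = c') (h₁ : a' + b = c') (h₂ : a + b' = c')
    (f : P.Hom p q a) (g : P.Hom p' q' b),
    d hc (P.tensor h f g) = P.tensor h₁ (d ha f) g + sg K (deg a) • P.tensor h₂ f (d hb g)

/-- A bilinear map descends to quotients. -/
def quotBil {K M₁ M₂ M₃ : Type u} [Field K] [AddCommGroup M₁] [AddCommGroup M₂]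
    [AddCommGroup M₃] [Module K M₁] [Module K M₂] [Module K M₃]
    (N₁ : Submodule K M₁) (N₂ : Submodule K M₂) (N₃ : Submodule K M₃)
    (f : M₁ →ₗ[K] M₂ →ₗ[K] M₃) (h₁ : ∀ x ∈ N₁, ∀ y, f x y ∈ N₃)
    (h₂ : ∀ x, ∀ y ∈ N₂, f x y ∈ N₃) : (M₁ ⧸ N₁) →ₗ[K] (M₂ ⧸ N₂) →ₗ[K] (M₃ ⧸ N₃) :=
  N₁.liftQ
    (LinearMap.mk₂ K (fun x y => N₂.liftQ (N₃.mkQ ∘ₗ f x)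
        (fun z hz => by simpa using h₂ x z hz) y)
      (fun x x' y => by
        induction y using Submodule.Quotient.induction_on; simp)
      (fun c x y => by
        induction y using Submodule.Quotient.induction_on; simp)
      (fun x y y' => by simp)
      (fun c x y => by simp))
    (fun x hx => by
      rw [LinearMap.mem_ker]
      ext y
      simpa using h₁ x hx y)

@[simp] theorem quotBil_mk {K M₁ M₂ M₃ : Type u} [Field K] [AddCommGroup M₁] [AddCommGroup M₂]
    [AddCommGroup M₃] [Module K M₁] [Module K M₂] [Module K M₃]
    (N₁ : Submodule K M₁) (N₂ : Submodule K M₂) (N₃ : Submodule K M₃)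
    (f : M₁ →ₗ[K] M₂ →ₗ[K] M₃) (h₁ : ∀ x ∈ N₁, ∀ y, f x y ∈ N₃)
    (h₂ : ∀ x, ∀ y ∈ N₂, f x y ∈ N₃) (x : M₁) (y : M₂) :
    quotBil N₁ N₂ N₃ f h₁ h₂ (Submodule.Quotient.mk x) (Submodule.Quotient.mk y) =
      Submodule.Quotient.mk (f x y) := rfl

/-! ### Cohomology of a dg prop -/

section Cohomology

variable {K : Type u} [Field K] {P : GradedProp K (AddMonoidHom.id ℤ)}

/-- The cocycles of degree `k`. -/
def cocycles (D : P.Differential 1) (p q : ℕ) (k : ℤ) : Submodule K (P.Hom p q k) :=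
  LinearMap.ker (D.d (p := p) (q := q) (rfl : k + 1 = k + 1))

/-- The coboundaries of degree `k`, as a subspace of the cocycles. -/
def coboundaries (D : P.Differential 1) (p q : ℕ) (k : ℤ) :
    Submodule K (cocycles D p q k) :=
  (LinearMap.range (D.d (p := p) (q := q) (sub_add_cancel k 1))).comap (cocycles D p q k).subtype

variable (D : P.Differential 1)

theorem mem_cocycles {p q : ℕ} {k l : ℤ} (h : k + 1 = l) (f : P.Hom p q k) :
    f ∈ cocycles D p q k ↔ D.d h f = 0 := by
  subst h; rfl

theorem mem_coboundaries {p q : ℕ} {k l : ℤ} (h : l + 1 = k) (f : cocycles D p q k) :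
    f ∈ coboundaries D p q k ↔ ∃ g : P.Hom p q l, D.d h g = f := by
  obtain rfl : l = k - 1 := by omega
  rfl

theorem cocycle_d (p q : ℕ) {k l : ℤ} (h : k + 1 = l) (f : cocycles D p q k) :
    D.d h (f : P.Hom p q k) = 0 := (mem_cocycles D h _).1 f.2

/-- Vertical composition of cocycles. -/
def cocycleComp {p r q : ℕ} {a b c : ℤ} (h : a + b = c) :
    cocycles D p r a →ₗ[K] cocycles D r q b →ₗ[K] cocycles D p q c :=
  LinearMap.mk₂ K (fun f g => ⟨P.comp h (f : P.Hom p r a) (g : P.Hom r q b), by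
      rw [mem_cocycles D rfl, D.d_comp h rfl rfl rfl (by omega) (by omega)]
      simp [cocycle_d D _ _ rfl f, cocycle_d D _ _ rfl g]⟩)
    (fun _ _ _ => by ext; simp) (fun _ _ _ => by ext; simp)
    (fun _ _ _ => by ext; simp) (fun _ _ _ => by ext; simp)

/-- Horizontal composition of cocycles. -/
def cocycleTensor {p q p' q' : ℕ} {a b c : ℤ} (h : a + b = c) :
    cocycles D p q a →ₗ[K] cocycles D p' q' b →ₗ[K] cocycles D (p + p') (q + q') c :=
  LinearMap.mk₂ K (fun f g => ⟨P.tensor h (f : P.Hom p q a) (g : P.Hom p' q' b), by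
      rw [mem_cocycles D rfl, D.d_tensor h rfl rfl rfl (by omega) (by omega)]
      simp [cocycle_d D _ _ rfl f, cocycle_d D _ _ rfl g]⟩)
    (fun _ _ _ => by ext; simp) (fun _ _ _ => by ext; simp)
    (fun _ _ _ => by ext; simp) (fun _ _ _ => by ext; simp)

@[simp] theorem cocycleComp_val {p r q : ℕ} {a b c : ℤ} (h : a + b = c)
    (f : cocycles D p r a) (g : cocycles D r q b) :
    (cocycleComp D h f g : P.Hom p q c) = P.comp h (f : P.Hom p r a) (g : P.Hom r q b) := rfl

@[simp] theorem cocycleTensor_val {p q p' q' : ℕ} {a b c : ℤ} (h : a + b = c)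
    (f : cocycles D p q a) (g : cocycles D p' q' b) :
    (cocycleTensor D h f g : P.Hom (p + p') (q + q') c) =
      P.tensor h (f : P.Hom p q a) (g : P.Hom p' q' b) := rfl

/-- The class of a permutation. -/
def cocyclePerm {p q : ℕ} (σ : Fin q ≃ Fin p) : cocycles D p q 0 :=
  ⟨P.perm σ, (mem_cocycles D rfl _).2 (D.d_perm _ σ)⟩

@[simp] theorem cocyclePerm_val {p q : ℕ} (σ : Fin q ≃ Fin p) :
    (cocyclePerm D σ : P.Hom p q 0) = P.perm σ := rfl

/-- The cohomology prop `H(P, d)`, with the operations induced from `P`. -/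
def cohomology : GradedProp K (AddMonoidHom.id ℤ) where
  Hom p q k := cocycles D p q k ⧸ coboundaries D p q k
  comp {p r q a b c} h := quotBil _ _ _ (cocycleComp D h)
    (fun x hx y => by
      obtain ⟨z, hz⟩ := (mem_coboundaries D (sub_add_cancel a 1) x).1 hx
      refine (mem_coboundaries D (l := a - 1 + b) (by omega) _).2 ⟨P.comp rfl z y, ?_⟩
      rw [D.d_comp rfl (sub_add_cancel a 1) rfl (by omega) h (by omega), hz]
      simp [cocycle_d D _ _ rfl y])
    (fun x y hy => by
      obtain ⟨z, hz⟩ := (mem_coboundaries D (sub_add_cancel b 1) y).1 hy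
      refine (mem_coboundaries D (l := a + (b - 1)) (by omega) _).2
        ⟨sg K a • P.comp rfl x z, ?_⟩
      rw [map_smul, D.d_comp rfl rfl (sub_add_cancel b 1) (by omega) (by omega) h, hz]
      simp [cocycle_d D _ _ rfl x, smul_smul, sg_mul_self])
  tensor {p q p' q' a b c} h := quotBil _ _ _ (cocycleTensor D h)
    (fun x hx y => by
      obtain ⟨z, hz⟩ := (mem_coboundaries D (sub_add_cancel a 1) x).1 hx
      refine (mem_coboundaries D (l := a - 1 + b) (by omega) _).2 ⟨P.tensor rfl z y, ?_⟩
      rw [D.d_tensor rfl (sub_add_cancel a 1) rfl (by omega) h (by omega), hz]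
      simp [cocycle_d D _ _ rfl y])
    (fun x y hy => by
      obtain ⟨z, hz⟩ := (mem_coboundaries D (sub_add_cancel b 1) y).1 hy
      refine (mem_coboundaries D (l := a + (b - 1)) (by omega) _).2
        ⟨sg K a • P.tensor rfl x z, ?_⟩
      rw [map_smul, D.d_tensor rfl rfl (sub_add_cancel b 1) (by omega) (by omega) h, hz]
      simp [cocycle_d D _ _ rfl x, smul_smul, sg_mul_self])
  perm σ := Submodule.Quotient.mk (cocyclePerm D σ)
  perm_comp_perm σ τ := by
    rw [quotBil_mk]; congr 1; ext; exact P.perm_comp_perm σ τ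
  id_comp f := by
    induction f using Submodule.Quotient.induction_on with | _ f
    rw [quotBil_mk]; congr 1; ext; exact P.id_comp _
  comp_id f := by
    induction f using Submodule.Quotient.induction_on with | _ f
    rw [quotBil_mk]; congr 1; ext; exact P.comp_id _
  comp_assoc h₁ h₂ h₃ h₄ f g h := by
    induction f using Submodule.Quotient.induction_on with | _ f
    induction g using Submodule.Quotient.induction_on with | _ g
    induction h using Submodule.Quotient.induction_on with | _ h
    simp only [quotBil_mk]; congr 1; ext; exact P.comp_assoc h₁ h₂ h₃ h₄ _ _ _
  perm_tensor_perm σ τ := by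
    rw [quotBil_mk]; congr 1; ext; exact P.perm_tensor_perm σ τ
  tensor_assoc h₁ h₂ h₃ h₄ f g h := by
    induction f using Submodule.Quotient.induction_on with | _ f
    induction g using Submodule.Quotient.induction_on with | _ g
    induction h using Submodule.Quotient.induction_on with | _ h
    simp only [quotBil_mk]; congr 1; ext; exact P.tensor_assoc h₁ h₂ h₃ h₄ _ _ _
  unit_tensor f := by
    induction f using Submodule.Quotient.induction_on with | _ f
    simp only [quotBil_mk]; congr 1; ext; exact P.unit_tensor _
  tensor_unit f := by
    induction f using Submodule.Quotient.induction_on with | _ f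
    simp only [quotBil_mk]; congr 1; ext; exact P.tensor_unit _
  interchange h₁ h₂ h₃ h₄ h₅ h₆ f f' g g' := by
    induction f using Submodule.Quotient.induction_on with | _ f
    induction g using Submodule.Quotient.induction_on with | _ g
    induction f' using Submodule.Quotient.induction_on with | _ f'
    induction g' using Submodule.Quotient.induction_on with | _ g'
    simp only [quotBil_mk, ← Submodule.Quotient.mk_smul]; congr 1; ext
    exact P.interchange h₁ h₂ h₃ h₄ h₅ h₆ _ _ _ _
  symmetry h₁ h₂ f g := by
    induction f using Submodule.Quotient.induction_on with | _ f
    induction g using Submodule.Quotient.induction_on with | _ g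
    simp only [quotBil_mk, ← Submodule.Quotient.mk_smul]; congr 1; ext
    exact P.symmetry h₁ h₂ _ _

end Cohomology

/-! ### Free props -/

/-- A graded `S`-bimodule: spaces `V p q k` of degree `k` with commuting actions of the
permutations of the `p` outputs (from the left) and of the `q` inputs (from the right);
`act σ τ e` is `σ · e · τ`. -/
structure SBimodule (K : Type u) [Field K] where
  V : ℕ → ℕ → ℤ → Type u
  [addCommGroup : ∀ p q k, AddCommGroup (V p q k)]
  [module : ∀ p q k, Module K (V p q k)]
  act : ∀ {p q : ℕ} {k : ℤ}, Equiv.Perm (Fin p) → Equiv.Perm (Fin q) → V p q k →ₗ[K] V p q k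
  act_one : ∀ {p q : ℕ} {k : ℤ} (e : V p q k), act 1 1 e = e
  act_act : ∀ {p q : ℕ} {k : ℤ} (σ σ' : Equiv.Perm (Fin p)) (τ τ' : Equiv.Perm (Fin q))
    (e : V p q k), act σ τ (act σ' τ' e) = act (σ * σ') (τ' * τ) e

attribute [instance] SBimodule.addCommGroup SBimodule.module

/-- A differential on an `S`-bimodule. -/
structure SBimodule.Differential {K : Type u} [Field K] (E : SBimodule K) where
  d : ∀ {p q : ℕ} {k l : ℤ}, k + 1 = l → E.V p q k →ₗ[K] E.V p q l
  d_d : ∀ {p q : ℕ} {k l m : ℤ} (h : k + 1 = l) (h' : l + 1 = m) (e : E.V p q k),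
    d h' (d h e) = 0
  d_act : ∀ {p q : ℕ} {k l : ℤ} (h : k + 1 = l) (σ : Equiv.Perm (Fin p))
    (τ : Equiv.Perm (Fin q)) (e : E.V p q k), d h (E.act σ τ e) = E.act σ τ (d h e)

section Free

variable {K : Type u} [Field K] (E : SBimodule K) (wt : ℕ → ℕ → ℕ)

/-- Formal composites of elements of `E` and permutations.  They are graded by the cohomological
degree and by a weight: an element of `E` with `p` outputs and `q` inputs has weight `wt p q`. -/
inductive Term : ℕ → ℕ → ℤ × ℕ → Type u
  | gen {p q : ℕ} {k : ℤ} (e : E.V p q k) : Term p q (k, wt p q)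
  | perm {p q : ℕ} (σ : Fin q ≃ Fin p) : Term p q 0
  | comp {p r q : ℕ} {a b c : ℤ × ℕ} (h : a + b = c) (s : Term p r a) (t : Term r q b) :
      Term p q c
  | tensor {p q p' q' : ℕ} {a b c : ℤ × ℕ} (h : a + b = c) (s : Term p q a)
      (t : Term p' q' b) : Term (p + p') (q + q') c

variable {E wt}

/-- Linear combinations of formal composites. -/
abbrev Pre (E : SBimodule K) (wt : ℕ → ℕ → ℕ) (p q : ℕ) (a : ℤ × ℕ) : Type u :=
  Term E wt p q a →₀ K

namespace Pre

/-- A generator. -/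
def gen {p q : ℕ} {k : ℤ} (e : E.V p q k) : Pre E wt p q (k, wt p q) :=
  Finsupp.single (.gen e) 1

/-- A permutation. -/
def perm {p q : ℕ} (σ : Fin q ≃ Fin p) : Pre E wt p q 0 := Finsupp.single (.perm σ) 1

/-- Formal vertical composition. -/
def comp {p r q : ℕ} {a b c : ℤ × ℕ} (h : a + b = c) :
    Pre E wt p r a →ₗ[K] Pre E wt r q b →ₗ[K] Pre E wt p q c :=
  Finsupp.linearCombination K fun s => Finsupp.linearCombination K fun t =>
    Finsupp.single (Term.comp h s t) (1 : K)

/-- Formal horizontal composition. -/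
def tensor {p q p' q' : ℕ} {a b c : ℤ × ℕ} (h : a + b = c) :
    Pre E wt p q a →ₗ[K] Pre E wt p' q' b →ₗ[K] Pre E wt (p + p') (q + q') c :=
  Finsupp.linearCombination K fun s => Finsupp.linearCombination K fun t =>
    Finsupp.single (Term.tensor h s t) (1 : K)

@[simp] theorem comp_single {p r q : ℕ} {a b c : ℤ × ℕ} (h : a + b = c) (s : Term E wt p r a)
    (t : Term E wt r q b) : comp h (Finsupp.single s (1 : K)) (Finsupp.single t (1 : K)) =
      Finsupp.single (Term.comp h s t) (1 : K) := by
  simp [comp]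

@[simp] theorem tensor_single {p q p' q' : ℕ} {a b c : ℤ × ℕ} (h : a + b = c)
    (s : Term E wt p q a) (t : Term E wt p' q' b) :
    tensor h (Finsupp.single s (1 : K)) (Finsupp.single t (1 : K)) =
      Finsupp.single (Term.tensor h s t) (1 : K) := by
  simp [tensor]

end Pre

/-- The ideal generated by the axioms of a graded prop, together with the relations which say that
the generators depend linearly and equivariantly on `E`. -/
inductive Rel : ∀ {p q : ℕ} {a : ℤ × ℕ}, Pre E wt p q a → Prop
  | zero {p q : ℕ} {a : ℤ × ℕ} : Rel (0 : Pre E wt p q a)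
  | add {p q : ℕ} {a : ℤ × ℕ} {x y : Pre E wt p q a} : Rel x → Rel y → Rel (x + y)
  | smul {p q : ℕ} {a : ℤ × ℕ} (c : K) {x : Pre E wt p q a} : Rel x → Rel (c • x)
  | comp_left {p r q : ℕ} {a b c : ℤ × ℕ} (h : a + b = c) {x : Pre E wt p r a}
      (y : Pre E wt r q b) : Rel x → Rel (Pre.comp h x y)
  | comp_right {p r q : ℕ} {a b c : ℤ × ℕ} (h : a + b = c) (x : Pre E wt p r a)
      {y : Pre E wt r q b} : Rel y → Rel (Pre.comp h x y)
  | tensor_left {p q p' q' : ℕ} {a b c : ℤ × ℕ} (h : a + b = c) {x : Pre E wt p q a}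
      (y : Pre E wt p' q' b) : Rel x → Rel (Pre.tensor h x y)
  | tensor_right {p q p' q' : ℕ} {a b c : ℤ × ℕ} (h : a + b = c) (x : Pre E wt p q a)
      {y : Pre E wt p' q' b} : Rel y → Rel (Pre.tensor h x y)
  | gen_add {p q : ℕ} {k : ℤ} (e e' : E.V p q k) :
      Rel (Pre.gen (e + e') - (Pre.gen e + Pre.gen e'))
  | gen_smul {p q : ℕ} {k : ℤ} (c : K) (e : E.V p q k) :
      Rel (Pre.gen (c • e) - c • Pre.gen e)
  | gen_act {p q : ℕ} {k : ℤ} (σ : Equiv.Perm (Fin p)) (τ : Equiv.Perm (Fin q))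
      (e : E.V p q k) :
      Rel (Pre.gen (E.act σ τ e) -
        Pre.comp (zero_add _) (Pre.perm σ) (Pre.comp (add_zero _) (Pre.gen e) (Pre.perm τ)))
  | perm_comp_perm {p r q : ℕ} (σ : Fin r ≃ Fin p) (τ : Fin q ≃ Fin r) :
      Rel (Pre.comp (add_zero 0) (Pre.perm σ) (Pre.perm τ) - Pre.perm (τ.trans σ))
  | id_comp {p q : ℕ} {a : ℤ × ℕ} (x : Pre E wt p q a) :
      Rel (Pre.comp (zero_add a) (Pre.perm (Equiv.refl (Fin p))) x - x)
  | comp_id {p q : ℕ} {a : ℤ × ℕ} (x : Pre E wt p q a) :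
      Rel (Pre.comp (add_zero a) x (Pre.perm (Equiv.refl (Fin q))) - x)
  | comp_assoc {p r s q : ℕ} {a b c ab bc abc : ℤ × ℕ} (h₁ : a + b = ab) (h₂ : ab + c = abc)
      (h₃ : b + c = bc) (h₄ : a + bc = abc) (x : Pre E wt p r a) (y : Pre E wt r s b)
      (z : Pre E wt s q c) :
      Rel (Pre.comp h₂ (Pre.comp h₁ x y) z - Pre.comp h₄ x (Pre.comp h₃ y z))
  | perm_tensor_perm {p q p' q' : ℕ} (σ : Fin q ≃ Fin p) (τ : Fin q' ≃ Fin p') :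
      Rel (Pre.tensor (add_zero 0) (Pre.perm σ) (Pre.perm τ) - Pre.perm (blockSum σ τ))
  | tensor_assoc {p q p' q' p'' q'' : ℕ} {a b c ab bc abc : ℤ × ℕ} (h₁ : a + b = ab)
      (h₂ : ab + c = abc) (h₃ : b + c = bc) (h₄ : a + bc = abc)
      (x : Pre E wt p q a) (y : Pre E wt p' q' b) (z : Pre E wt p'' q'' c) :
      Rel (Pre.comp (zero_add abc) (Pre.perm (finCongr (add_assoc p p' p'')))
          (Pre.tensor h₂ (Pre.tensor h₁ x y) z) -
        Pre.comp (add_zero abc) (Pre.tensor h₄ x (Pre.tensor h₃ y z))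
          (Pre.perm (finCongr (add_assoc q q' q''))))
  | unit_tensor {p q : ℕ} {a : ℤ × ℕ} (x : Pre E wt p q a) :
      Rel (Pre.comp (zero_add a) (Pre.perm (finCongr (zero_add p)))
          (Pre.tensor (zero_add a) (Pre.perm (Equiv.refl (Fin 0))) x) -
        Pre.comp (add_zero a) x (Pre.perm (finCongr (zero_add q))))
  | tensor_unit {p q : ℕ} {a : ℤ × ℕ} (x : Pre E wt p q a) :
      Rel (Pre.comp (zero_add a) (Pre.perm (finCongr (add_zero p)))
          (Pre.tensor (add_zero a) x (Pre.perm (Equiv.refl (Fin 0)))) -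
        Pre.comp (add_zero a) x (Pre.perm (finCongr (add_zero q))))
  | interchange {p r q p' r' q' : ℕ} {a a' b b' aa bb ab ab' c : ℤ × ℕ}
      (h₁ : a + a' = aa) (h₂ : b + b' = bb) (h₃ : aa + bb = c)
      (h₄ : a + b = ab) (h₅ : a' + b' = ab') (h₆ : ab + ab' = c)
      (x : Pre E wt p r a) (x' : Pre E wt p' r' a') (y : Pre E wt r q b)
      (y' : Pre E wt r' q' b') :
      Rel (Pre.comp h₃ (Pre.tensor h₁ x x') (Pre.tensor h₂ y y') -
        sg K (a'.1 * b.1) • Pre.tensor h₆ (Pre.comp h₄ x y) (Pre.comp h₅ x' y'))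
  | symmetry {p q p' q' : ℕ} {a b c : ℤ × ℕ} (h₁ : a + b = c) (h₂ : b + a = c)
      (x : Pre E wt p q a) (y : Pre E wt p' q' b) :
      Rel (Pre.comp (zero_add c) (Pre.perm (finAddFlip : Fin (p + p') ≃ Fin (p' + p)))
          (Pre.tensor h₁ x y) -
        sg K (a.1 * b.1) • Pre.comp (add_zero c) (Pre.tensor h₂ y x)
          (Pre.perm (finAddFlip : Fin (q + q') ≃ Fin (q' + q))))

/-- The ideal of relations. -/
def relations (E : SBimodule K) (wt : ℕ → ℕ → ℕ) (p q : ℕ) (a : ℤ × ℕ) :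
    Submodule K (Pre E wt p q a) where
  carrier := {x | Rel x}
  add_mem' := Rel.add
  zero_mem' := Rel.zero
  smul_mem' c _ := Rel.smul c

variable (E wt) in
/-- The free graded prop `Γ⟨E⟩`, with the additional grading by weight. -/
def freeProp : GradedProp K (AddMonoidHom.fst ℤ ℕ) where
  Hom p q a := Pre E wt p q a ⧸ relations E wt p q a
  comp h := quotBil _ _ _ (Pre.comp h) (fun _ hx y => Rel.comp_left h y hx)
    (fun x _ hy => Rel.comp_right h x hy)
  tensor h := quotBil _ _ _ (Pre.tensor h) (fun _ hx y => Rel.tensor_left h y hx)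
    (fun x _ hy => Rel.tensor_right h x hy)
  perm σ := Submodule.Quotient.mk (Pre.perm σ)
  perm_comp_perm σ τ := (Submodule.Quotient.eq _).2 (Rel.perm_comp_perm σ τ)
  id_comp f := by
    induction f using Submodule.Quotient.induction_on with | _ f
    exact (Submodule.Quotient.eq _).2 (Rel.id_comp f)
  comp_id f := by
    induction f using Submodule.Quotient.induction_on with | _ f
    exact (Submodule.Quotient.eq _).2 (Rel.comp_id f)
  comp_assoc h₁ h₂ h₃ h₄ f g h := by
    induction f using Submodule.Quotient.induction_on with | _ f
    induction g using Submodule.Quotient.induction_on with | _ g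
    induction h using Submodule.Quotient.induction_on with | _ h
    exact (Submodule.Quotient.eq _).2 (Rel.comp_assoc h₁ h₂ h₃ h₄ f g h)
  perm_tensor_perm σ τ := (Submodule.Quotient.eq _).2 (Rel.perm_tensor_perm σ τ)
  tensor_assoc h₁ h₂ h₃ h₄ f g h := by
    induction f using Submodule.Quotient.induction_on with | _ f
    induction g using Submodule.Quotient.induction_on with | _ g
    induction h using Submodule.Quotient.induction_on with | _ h
    exact (Submodule.Quotient.eq _).2 (Rel.tensor_assoc h₁ h₂ h₃ h₄ f g h)
  unit_tensor f := by
    induction f using Submodule.Quotient.induction_on with | _ f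
    exact (Submodule.Quotient.eq _).2 (Rel.unit_tensor f)
  tensor_unit f := by
    induction f using Submodule.Quotient.induction_on with | _ f
    exact (Submodule.Quotient.eq _).2 (Rel.tensor_unit f)
  interchange h₁ h₂ h₃ h₄ h₅ h₆ f f' g g' := by
    induction f using Submodule.Quotient.induction_on with | _ f
    induction g using Submodule.Quotient.induction_on with | _ g
    induction f' using Submodule.Quotient.induction_on with | _ f'
    induction g' using Submodule.Quotient.induction_on with | _ g'
    exact (Submodule.Quotient.eq _).2 (Rel.interchange h₁ h₂ h₃ h₄ h₅ h₆ f f' g g')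
  symmetry h₁ h₂ f g := by
    induction f using Submodule.Quotient.induction_on with | _ f
    induction g using Submodule.Quotient.induction_on with | _ g
    exact (Submodule.Quotient.eq _).2 (Rel.symmetry h₁ h₂ f g)

/-- The class of a linear combination of formal composites. -/
def freeMk {p q : ℕ} {a : ℤ × ℕ} : Pre E wt p q a →ₗ[K] (freeProp E wt).Hom p q a :=
  (relations E wt p q a).mkQ

theorem freeMk_surjective {p q : ℕ} {a : ℤ × ℕ} :
    Function.Surjective (freeMk : Pre E wt p q a →ₗ[K] (freeProp E wt).Hom p q a) :=
  Submodule.mkQ_surjective _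

theorem freeMk_eq_zero {p q : ℕ} {a : ℤ × ℕ} {x : Pre E wt p q a} (h : Rel x) :
    freeMk x = 0 :=
  (Submodule.Quotient.mk_eq_zero _).2 h

theorem freeMk_comp {p r q : ℕ} {a b c : ℤ × ℕ} (h : a + b = c) (x : Pre E wt p r a)
    (y : Pre E wt r q b) :
    freeMk (Pre.comp h x y) = (freeProp E wt).comp h (freeMk x) (freeMk y) := rfl

theorem freeMk_tensor {p q p' q' : ℕ} {a b c : ℤ × ℕ} (h : a + b = c) (x : Pre E wt p q a)
    (y : Pre E wt p' q' b) :
    freeMk (Pre.tensor h x y) = (freeProp E wt).tensor h (freeMk x) (freeMk y) := rfl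

theorem freeMk_perm {p q : ℕ} (σ : Fin q ≃ Fin p) :
    freeMk (Pre.perm σ) = (freeProp E wt).perm σ := rfl

variable (wt) in
/-- The generator of the free prop given by an element of `E`. -/
def freeGen {p q : ℕ} {k : ℤ} : E.V p q k →ₗ[K] (freeProp E wt).Hom p q (k, wt p q) where
  toFun e := freeMk (Pre.gen e)
  map_add' e e' := (Submodule.Quotient.eq _).2 (Rel.gen_add e e')
  map_smul' c e := (Submodule.Quotient.eq _).2 (Rel.gen_smul c e)

theorem freeGen_act {p q : ℕ} {k : ℤ} (σ : Equiv.Perm (Fin p)) (τ : Equiv.Perm (Fin q))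
    (e : E.V p q k) :
    freeGen wt (E.act σ τ e) =
      (freeProp E wt).comp (zero_add _) ((freeProp E wt).perm σ)
        ((freeProp E wt).comp (add_zero _) (freeGen wt e) ((freeProp E wt).perm τ)) :=
  (Submodule.Quotient.eq _).2 (Rel.gen_act σ τ e)

/-! The derivation of the free prop that extends a differential of `E`. -/

variable (D : E.Differential)

/-- The value of the derivation on a formal composite, by the Leibniz rule. -/
def termD : ∀ {p q : ℕ} {a b : ℤ × ℕ}, a + (1, 0) = b → Term E wt p q a →
    (freeProp E wt).Hom p q b
  | _, _, _, _, h, .gen e => h ▸ freeGen wt (D.d rfl e)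
  | _, _, _, _, _, .perm _ => 0
  | _, _, _, _, hc, @Term.comp _ _ _ _ _ _ _ a b _ h s t =>
      (freeProp E wt).comp (by rw [add_right_comm, h, hc]) (termD (a := a) rfl s)
          (freeMk (Finsupp.single t 1)) +
        sg K a.1 • (freeProp E wt).comp (by rw [← add_assoc, h, hc])
          (freeMk (Finsupp.single s 1)) (termD (a := b) rfl t)
  | _, _, _, _, hc, @Term.tensor _ _ _ _ _ _ _ _ a b _ h s t =>
      (freeProp E wt).tensor (by rw [add_right_comm, h, hc]) (termD (a := a) rfl s)
          (freeMk (Finsupp.single t 1)) +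
        sg K a.1 • (freeProp E wt).tensor (by rw [← add_assoc, h, hc])
          (freeMk (Finsupp.single s 1)) (termD (a := b) rfl t)

/-- The derivation on linear combinations of formal composites. -/
def preD {p q : ℕ} {a b : ℤ × ℕ} (h : a + (1, 0) = b) :
    Pre E wt p q a →ₗ[K] (freeProp E wt).Hom p q b :=
  Finsupp.linearCombination K (termD D h)

theorem preD_gen {p q : ℕ} {k l : ℤ} (h : k + 1 = l)
    (h' : (k, wt p q) + (1, 0) = (l, wt p q)) (e : E.V p q k) :
    preD D h' (Pre.gen e) = freeGen wt (D.d h e) := by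
  subst h
  simp [preD, Pre.gen, termD]

theorem preD_perm {p q : ℕ} {b : ℤ × ℕ} (h : 0 + (1, 0) = b) (σ : Fin q ≃ Fin p) :
    preD D (wt := wt) h (Pre.perm σ) = 0 := by
  simp [preD, Pre.perm, termD]

theorem preD_comp {p r q : ℕ} {a b c a' b' c' : ℤ × ℕ} (h : a + b = c) (ha : a + (1, 0) = a')
    (hb : b + (1, 0) = b') (hc : c + (1, 0) = c') (h₁ : a' + b = c') (h₂ : a + b' = c')
    (x : Pre E wt p r a) (y : Pre E wt r q b) :
    preD D hc (Pre.comp h x y) =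
      (freeProp E wt).comp h₁ (preD D ha x) (freeMk y) +
        sg K a.1 • (freeProp E wt).comp h₂ (freeMk x) (preD D hb y) := by
  subst ha hb
  induction x using Finsupp.induction_linear with
  | zero => simp
  | add x x' hx hx' =>
    simp only [map_add, LinearMap.add_apply, hx, hx', smul_add]
    abel
  | single s u =>
    induction y using Finsupp.induction_linear with
    | zero => simp
    | add y y' hy hy' =>
      simp only [map_add, hy, hy', smul_add]
      abel
    | single t v =>
      rw [← mul_one u, ← mul_one v, ← smul_eq_mul u, ← smul_eq_mul v, ← Finsupp.smul_single,
        ← Finsupp.smul_single]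
      simp only [map_smul, LinearMap.smul_apply, Pre.comp_single]
      rw [preD, Finsupp.linearCombination_single, preD, Finsupp.linearCombination_single, preD,
        Finsupp.linearCombination_single, termD]
      simp only [one_smul, smul_add]
      rw [smul_comm (sg K a.1) v, smul_comm (sg K a.1) u]

theorem preD_tensor {p q p' q' : ℕ} {a b c a' b' c' : ℤ × ℕ} (h : a + b = c)
    (ha : a + (1, 0) = a') (hb : b + (1, 0) = b') (hc : c + (1, 0) = c') (h₁ : a' + b = c')
    (h₂ : a + b' = c') (x : Pre E wt p q a) (y : Pre E wt p' q' b) :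
    preD D hc (Pre.tensor h x y) =
      (freeProp E wt).tensor h₁ (preD D ha x) (freeMk y) +
        sg K a.1 • (freeProp E wt).tensor h₂ (freeMk x) (preD D hb y) := by
  subst ha hb
  induction x using Finsupp.induction_linear with
  | zero => simp
  | add x x' hx hx' =>
    simp only [map_add, LinearMap.add_apply, hx, hx', smul_add]
    abel
  | single s u =>
    induction y using Finsupp.induction_linear with
    | zero => simp
    | add y y' hy hy' =>
      simp only [map_add, hy, hy', smul_add]
      abel
    | single t v =>
      rw [← mul_one u, ← mul_one v, ← smul_eq_mul u, ← smul_eq_mul v, ← Finsupp.smul_single,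
        ← Finsupp.smul_single]
      simp only [map_smul, LinearMap.smul_apply, Pre.tensor_single]
      rw [preD, Finsupp.linearCombination_single, preD, Finsupp.linearCombination_single, preD,
        Finsupp.linearCombination_single, termD]
      simp only [one_smul, smul_add]
      rw [smul_comm (sg K a.1) v, smul_comm (sg K a.1) u]

theorem preD_perm_comp {p r q : ℕ} {a c a' c' : ℤ × ℕ} (h : 0 + a = c) (ha : a + (1, 0) = a')
    (hc : c + (1, 0) = c') (h₁ : 0 + a' = c') (σ : Fin r ≃ Fin p) (x : Pre E wt r q a) :
    preD D hc (Pre.comp h (Pre.perm σ) x) =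
      (freeProp E wt).comp h₁ ((freeProp E wt).perm σ) (preD D ha x) := by
  rw [preD_comp D h rfl ha hc (by rw [← hc, ← h]; abel) h₁, preD_perm]
  simp [freeMk_perm]

theorem preD_comp_perm {p r q : ℕ} {a c a' c' : ℤ × ℕ} (h : a + 0 = c) (ha : a + (1, 0) = a')
    (hc : c + (1, 0) = c') (h₁ : a' + 0 = c') (x : Pre E wt p r a) (σ : Fin q ≃ Fin r) :
    preD D hc (Pre.comp h x (Pre.perm σ)) =
      (freeProp E wt).comp h₁ (preD D ha x) ((freeProp E wt).perm σ) := by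
  rw [preD_comp D h ha rfl hc h₁ (by rw [← hc, ← h]; abel), preD_perm]
  simp [freeMk_perm]

theorem preD_rel {p q : ℕ} {a b : ℤ × ℕ} (h : a + (1, 0) = b) {x : Pre E wt p q a}
    (hx : Rel x) : preD D h x = 0 := by
  induction hx generalizing b with
  | zero => simp
  | add _ _ ih ih' => simp [ih, ih']
  | smul c _ ih => simp [ih]
  | comp_left h' y hx ih =>
    rw [preD_comp D h' rfl rfl h (by rw [← h, ← h']; abel) (by rw [← h, ← h']; abel), ih,
      freeMk_eq_zero hx]
    simp
  | comp_right h' y hx ih =>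
    rw [preD_comp D h' rfl rfl h (by rw [← h, ← h']; abel) (by rw [← h, ← h']; abel), ih,
      freeMk_eq_zero hx]
    simp
  | tensor_left h' y hx ih =>
    rw [preD_tensor D h' rfl rfl h (by rw [← h, ← h']; abel) (by rw [← h, ← h']; abel), ih,
      freeMk_eq_zero hx]
    simp
  | tensor_right h' y hx ih =>
    rw [preD_tensor D h' rfl rfl h (by rw [← h, ← h']; abel) (by rw [← h, ← h']; abel), ih,
      freeMk_eq_zero hx]
    simp
  | gen_add e e' =>
    subst h
    rw [map_sub, map_add, preD_gen D rfl, preD_gen D rfl, preD_gen D rfl]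
    simp
  | gen_smul c e =>
    subst h
    rw [map_sub, map_smul, preD_gen D rfl, preD_gen D rfl]
    simp
  | @gen_act p q k σ τ e =>
    subst h
    rw [map_sub, preD_perm_comp D _ rfl _ (zero_add _), preD_comp_perm D _ rfl _ (add_zero _)]
    rw [preD_gen D rfl, preD_gen D rfl, D.d_act, freeGen_act, sub_self]
  | perm_comp_perm σ τ =>
    subst h
    rw [map_sub, preD_perm, preD_perm_comp D _ rfl _ (zero_add _), preD_perm]
    simp
  | id_comp x =>
    subst h
    rw [map_sub, preD_perm_comp D _ rfl _ (zero_add _), GradedProp.id_comp, sub_self]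
  | comp_id x =>
    subst h
    rw [map_sub, preD_comp_perm D _ rfl _ (add_zero _), GradedProp.comp_id, sub_self]
  | @comp_assoc p r s q a b c ab bc abc h₁ h₂ h₃ h₄ x y z =>
    subst h h₁ h₂ h₃
    rw [map_sub, sub_eq_zero, preD_comp D _ rfl rfl _ (by abel) (by abel),
      preD_comp D _ rfl rfl _ (by abel) (by abel),
      preD_comp D _ rfl rfl _ (by abel) (by abel),
      preD_comp D _ rfl rfl _ (by abel) (by abel)]
    simp only [map_add, map_smul, LinearMap.add_apply, LinearMap.smul_apply, freeMk_comp, smul_add,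
      smul_smul, Prod.fst_add, sg_add]
    rw [GradedProp.comp_assoc _ _ _ rfl (by abel),
      GradedProp.comp_assoc (bc := b + c + (1, 0)) _ _ _ (by abel) (by abel),
      GradedProp.comp_assoc (bc := b + c + (1, 0)) _ _ _ (by abel) (by abel)]
    abel
  | perm_tensor_perm σ τ =>
    subst h
    rw [map_sub, preD_perm, preD_tensor D _ rfl rfl _ (by abel) (by abel), preD_perm, preD_perm]
    simp
  | @tensor_assoc p q p' q' p'' q'' a b c ab bc abc h₁ h₂ h₃ h₄ x y z =>
    subst h h₁ h₂ h₃
    rw [map_sub, sub_eq_zero, preD_perm_comp D _ rfl _ (zero_add _),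
      preD_comp_perm D _ rfl _ (add_zero _), preD_tensor D _ rfl rfl _ (by abel) (by abel),
      preD_tensor D _ rfl rfl _ (by abel) (by abel),
      preD_tensor D _ rfl rfl _ (by abel) (by abel),
      preD_tensor D _ rfl rfl _ (by abel) (by abel)]
    simp only [map_add, map_smul, LinearMap.add_apply, LinearMap.smul_apply, freeMk_tensor,
      smul_add, smul_smul, Prod.fst_add, sg_add]
    rw [GradedProp.tensor_assoc _ _ _ rfl (by abel),
      GradedProp.tensor_assoc (bc := b + c + (1, 0)) _ _ _ (by abel) (by abel),
      GradedProp.tensor_assoc (bc := b + c + (1, 0)) _ _ _ (by abel) (by abel)]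
    abel
  | unit_tensor x =>
    subst h
    rw [map_sub, preD_perm_comp D _ rfl _ (zero_add _), preD_comp_perm D _ rfl _ (add_zero _),
      preD_tensor D _ rfl rfl _ (by abel) (by abel), preD_perm]
    simp only [map_zero, LinearMap.zero_apply, zero_add, Prod.fst_zero, sg_zero, one_smul]
    exact sub_eq_zero.2 (GradedProp.unit_tensor _ _)
  | tensor_unit x =>
    subst h
    rw [map_sub, preD_perm_comp D _ rfl _ (zero_add _), preD_comp_perm D _ rfl _ (add_zero _),
      preD_tensor D _ rfl rfl _ (by abel) (by abel), preD_perm]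
    simp only [map_zero, smul_zero, add_zero]
    exact sub_eq_zero.2 (GradedProp.tensor_unit _ _)
  | @interchange p r q p' r' q' a a' b b' aa bb ab ab' c h₁ h₂ h₃ h₄ h₅ h₆ x x' y y' =>
    subst h h₁ h₂ h₃ h₄ h₅
    rw [map_sub, sub_eq_zero, map_smul, preD_comp D _ rfl rfl _ (by abel) (by abel),
      preD_tensor D _ rfl rfl _ (by abel) (by abel),
      preD_tensor D _ rfl rfl _ (by abel) (by abel),
      preD_tensor D _ rfl rfl _ (by abel) (by abel),
      preD_comp D _ rfl rfl _ (by abel) (by abel),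
      preD_comp D _ rfl rfl _ (by abel) (by abel)]
    simp only [map_add, map_smul, LinearMap.add_apply, LinearMap.smul_apply, freeMk_tensor,
      freeMk_comp, smul_add, smul_smul, Prod.fst_add]
    rw [GradedProp.interchange (ab := a + b + (1, 0)) (ab' := a' + b') _ _ _ (by abel) (by abel)
        ?_,
      GradedProp.interchange (ab := a + b) (ab' := a' + b' + (1, 0)) _ _ _ (by abel) (by abel)
        ?_,
      GradedProp.interchange (ab := a + b + (1, 0)) (ab' := a' + b') _ _ _ (by abel) (by abel)
        ?_,
      GradedProp.interchange (ab := a + b) (ab' := a' + b' + (1, 0)) _ _ _ (by abel) (by abel)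
        ?_]
    · simp only [smul_smul, AddMonoidHom.coe_fst, Prod.fst_add, ← sg_add, mul_add, add_mul, mul_one,
        one_mul]
      rw [sg_congr K (m := a.1 + (a'.1 * b.1 + b.1)) (n := a'.1 * b.1 + (a.1 + b.1)) ⟨0, by ring⟩,
        sg_congr K (m := a.1 + a'.1 + (a'.1 * b.1 + a'.1)) (n := a'.1 * b.1 + a.1)
          ⟨a'.1, by ring⟩,
        sg_congr K (m := a.1 + a'.1 + b.1 + a'.1 * b.1) (n := a'.1 * b.1 + (a.1 + b.1 + a'.1))
          ⟨0, by ring⟩]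
      exact add_add_add_comm _ _ _ _
  | @symmetry p q p' q' a b c h₁ h₂ x y =>
    subst h h₁
    rw [map_sub, sub_eq_zero, map_smul, preD_perm_comp D _ rfl _ (zero_add _),
      preD_comp_perm D _ rfl _ (add_zero _), preD_tensor D _ rfl rfl _ (by abel) (by abel),
      preD_tensor D _ rfl rfl _ (by rw [← h₂]; abel) (by rw [← h₂]; abel)]
    simp only [map_add, map_smul, LinearMap.add_apply, LinearMap.smul_apply,
      smul_add, smul_smul]
    rw [GradedProp.symmetry _ _ (by rw [← h₂]; abel), GradedProp.symmetry _ _ (by rw [← h₂]; abel)]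
    simp only [smul_smul, AddMonoidHom.coe_fst, Prod.fst_add, ← sg_add, mul_add, add_mul, mul_one, one_mul]
    rw [sg_congr K (m := a.1 + (a.1 * b.1 + a.1)) (n := a.1 * b.1) ⟨a.1, by ring⟩]
    abel

variable (wt) in
/-- The differential of the free prop induced by a differential on the generators. -/
def freeDiff {p q : ℕ} {a b : ℤ × ℕ} (h : a + (1, 0) = b) :
    (freeProp E wt).Hom p q a →ₗ[K] (freeProp E wt).Hom p q b :=
  (relations E wt p q a).liftQ (preD D h) fun _ hx => preD_rel D h hx

theorem freeDiff_mk {p q : ℕ} {a b : ℤ × ℕ} (h : a + (1, 0) = b) (x : Pre E wt p q a) :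
    freeDiff wt D h (freeMk x) = preD D h x := rfl

theorem freeDiff_comp {p r q : ℕ} {a b c a' b' c' : ℤ × ℕ} (h : a + b = c)
    (ha : a + (1, 0) = a') (hb : b + (1, 0) = b') (hc : c + (1, 0) = c') (h₁ : a' + b = c')
    (h₂ : a + b' = c') (f : (freeProp E wt).Hom p r a) (g : (freeProp E wt).Hom r q b) :
    freeDiff wt D hc ((freeProp E wt).comp h f g) =
      (freeProp E wt).comp h₁ (freeDiff wt D ha f) g +
        sg K a.1 • (freeProp E wt).comp h₂ f (freeDiff wt D hb g) := by
  obtain ⟨x, rfl⟩ := freeMk_surjective f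
  obtain ⟨y, rfl⟩ := freeMk_surjective g
  rw [← freeMk_comp]
  exact preD_comp D h ha hb hc h₁ h₂ x y

theorem freeDiff_tensor {p q p' q' : ℕ} {a b c a' b' c' : ℤ × ℕ} (h : a + b = c)
    (ha : a + (1, 0) = a') (hb : b + (1, 0) = b') (hc : c + (1, 0) = c') (h₁ : a' + b = c')
    (h₂ : a + b' = c') (f : (freeProp E wt).Hom p q a) (g : (freeProp E wt).Hom p' q' b) :
    freeDiff wt D hc ((freeProp E wt).tensor h f g) =
      (freeProp E wt).tensor h₁ (freeDiff wt D ha f) g +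
        sg K a.1 • (freeProp E wt).tensor h₂ f (freeDiff wt D hb g) := by
  obtain ⟨x, rfl⟩ := freeMk_surjective f
  obtain ⟨y, rfl⟩ := freeMk_surjective g
  rw [← freeMk_tensor]
  exact preD_tensor D h ha hb hc h₁ h₂ x y

theorem freeDiff_term {p q : ℕ} {a b c : ℤ × ℕ} (h : a + (1, 0) = b) (h' : b + (1, 0) = c)
    (t : Term E wt p q a) : freeDiff wt D h' (freeDiff wt D h (freeMk (Finsupp.single t 1))) = 0 := by
  induction t generalizing b c with
  | gen e =>
    subst h
    have := preD_gen D (wt := wt) rfl rfl e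
    rw [freeDiff_mk]
    change freeDiff wt D h' (preD D _ (Pre.gen e)) = 0
    rw [this]
    subst h'
    change preD D _ (Pre.gen _) = 0
    rw [preD_gen D rfl, D.d_d, map_zero]
  | perm σ =>
    change freeDiff wt D h' (preD D h (Pre.perm σ)) = 0
    rw [preD_perm, map_zero]
  | @comp p r q a₁ a₂ a hh s t ihs iht =>
    subst h h' hh
    rw [← Pre.comp_single, freeMk_comp, freeDiff_comp D rfl rfl rfl rfl (by abel) (by abel),
      map_add, map_smul,
      freeDiff_comp D (a' := a₁ + (1, 0) + (1, 0)) (b' := a₂ + (1, 0)) _ rfl rfl rfl (by abel)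
        (by abel),
      freeDiff_comp D (a' := a₁ + (1, 0)) (b' := a₂ + (1, 0) + (1, 0)) _ rfl rfl rfl (by abel)
        (by abel), ihs rfl rfl, iht rfl rfl]
    simp [sg_add]
  | @tensor p q p' q' a₁ a₂ a hh s t ihs iht =>
    subst h h' hh
    rw [← Pre.tensor_single, freeMk_tensor, freeDiff_tensor D rfl rfl rfl rfl (by abel) (by abel),
      map_add, map_smul,
      freeDiff_tensor D (a' := a₁ + (1, 0) + (1, 0)) (b' := a₂ + (1, 0)) _ rfl rfl rfl (by abel)
        (by abel),
      freeDiff_tensor D (a' := a₁ + (1, 0)) (b' := a₂ + (1, 0) + (1, 0)) _ rfl rfl rfl (by abel)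
        (by abel), ihs rfl rfl, iht rfl rfl]
    simp [sg_add]

variable (wt) in
/-- The free dg prop on a dg `S`-bimodule; the differential preserves the weight. -/
def freeDifferential : (freeProp E wt).Differential (1, 0) where
  deg_shift := rfl
  d := freeDiff wt D
  d_d {p q a b c} h h' f := by
    obtain ⟨x, rfl⟩ := freeMk_surjective f
    induction x using Finsupp.induction_linear with
    | zero => simp
    | add x y hx hy => simp [hx, hy]
    | single t u =>
      rw [← mul_one u, ← smul_eq_mul, ← Finsupp.smul_single, map_smul, map_smul, map_smul,
        freeDiff_term, smul_zero]
  d_perm h σ := preD_perm D h σ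
  d_comp := freeDiff_comp D
  d_tensor := freeDiff_tensor D


end Free

/-! ### Completion with respect to the weight -/

section Completion

theorem antidiagonal_triple {M : Type u} [AddCommMonoid M] (w : ℕ)
    (F : ∀ i j k : ℕ, i + j + k = w → M) :
    (∑ x : antidiagonal w, ∑ y : antidiagonal x.1.1, F y.1.1 y.1.2 x.1.2
        (by rw [HasAntidiagonal.mem_antidiagonal.1 y.2, HasAntidiagonal.mem_antidiagonal.1 x.2])) =
      ∑ x : antidiagonal w, ∑ y : antidiagonal x.1.2, F x.1.1 y.1.1 y.1.2
        (by rw [add_assoc, HasAntidiagonal.mem_antidiagonal.1 y.2, HasAntidiagonal.mem_antidiagonal.1 x.2]) := by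
  rw [Finset.sum_sigma', Finset.sum_sigma']
  refine Finset.sum_bij'
    (fun x _ => ⟨⟨(x.2.1.1, x.2.1.2 + x.1.1.2), ?_⟩, ⟨(x.2.1.2, x.1.1.2), ?_⟩⟩)
    (fun x _ => ⟨⟨(x.1.1.1 + x.2.1.1, x.2.1.2), ?_⟩, ⟨(x.1.1.1, x.2.1.1), ?_⟩⟩) ?_ ?_ ?_ ?_ ?_
  · have h₁ := HasAntidiagonal.mem_antidiagonal.1 x.1.2
    have h₂ := HasAntidiagonal.mem_antidiagonal.1 x.2.2
    simp only [HasAntidiagonal.mem_antidiagonal]; omega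
  · simp
  · have h₁ := HasAntidiagonal.mem_antidiagonal.1 x.1.2
    have h₂ := HasAntidiagonal.mem_antidiagonal.1 x.2.2
    simp only [HasAntidiagonal.mem_antidiagonal]; omega
  · simp
  · simp
  · simp
  · rintro ⟨⟨⟨n, k⟩, h₁⟩, ⟨⟨i, j⟩, h₂⟩⟩ _
    obtain rfl : i + j = n := HasAntidiagonal.mem_antidiagonal.1 h₂
    rfl
  · rintro ⟨⟨⟨n, k⟩, h₁⟩, ⟨⟨i, j⟩, h₂⟩⟩ _
    obtain rfl : i + j = k := HasAntidiagonal.mem_antidiagonal.1 h₂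
    rfl
  · intros; rfl

/-- Exchange of the two middle summands. -/
def quadSwap (w : ℕ) (x : Σ x : antidiagonal w, antidiagonal x.1.1 × antidiagonal x.1.2) :
    Σ x : antidiagonal w, antidiagonal x.1.1 × antidiagonal x.1.2 :=
  ⟨⟨(x.2.1.1.1 + x.2.2.1.1, x.2.1.1.2 + x.2.2.1.2), by
      have h₁ := HasAntidiagonal.mem_antidiagonal.1 x.1.2
      have h₂ := HasAntidiagonal.mem_antidiagonal.1 x.2.1.2
      have h₃ := HasAntidiagonal.mem_antidiagonal.1 x.2.2.2
      simp only [HasAntidiagonal.mem_antidiagonal]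
      omega⟩,
    ⟨(x.2.1.1.1, x.2.2.1.1), by simp⟩, ⟨(x.2.1.1.2, x.2.2.1.2), by simp⟩⟩

theorem quadSwap_quadSwap (w : ℕ)
    (x : Σ x : antidiagonal w, antidiagonal x.1.1 × antidiagonal x.1.2) :
    quadSwap w (quadSwap w x) = x := by
  obtain ⟨⟨⟨m, n⟩, h₁⟩, ⟨⟨i, j⟩, h₂⟩, ⟨⟨k, l⟩, h₃⟩⟩ := x
  obtain rfl : i + j = m := HasAntidiagonal.mem_antidiagonal.1 h₂
  obtain rfl : k + l = n := HasAntidiagonal.mem_antidiagonal.1 h₃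
  rfl

theorem antidiagonal_quadruple {M : Type u} [AddCommMonoid M] (w : ℕ)
    (F : ∀ i j k l : ℕ, i + j + (k + l) = w → M) :
    (∑ x : antidiagonal w, ∑ y : antidiagonal x.1.1, ∑ z : antidiagonal x.1.2,
        F y.1.1 y.1.2 z.1.1 z.1.2
        (by rw [HasAntidiagonal.mem_antidiagonal.1 y.2, HasAntidiagonal.mem_antidiagonal.1 z.2,
          HasAntidiagonal.mem_antidiagonal.1 x.2])) =
      ∑ x : antidiagonal w, ∑ y : antidiagonal x.1.1, ∑ z : antidiagonal x.1.2,
        F y.1.1 z.1.1 y.1.2 z.1.2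
        (by rw [add_add_add_comm, HasAntidiagonal.mem_antidiagonal.1 y.2,
          HasAntidiagonal.mem_antidiagonal.1 z.2, HasAntidiagonal.mem_antidiagonal.1 x.2]) := by
  simp only [← Fintype.sum_prod_type', ← Fintype.sum_sigma']
  exact Fintype.sum_equiv ⟨quadSwap w, quadSwap w, quadSwap_quadSwap w, quadSwap_quadSwap w⟩ _ _
    fun _ => rfl

variable {K : Type u} [Field K] (P : GradedProp K (AddMonoidHom.fst ℤ ℕ))

/-- The elements of degree `k` of the completion are the families of elements of degree `k`, one
of each weight, i.e. infinite sums. -/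
abbrev ComplHom (p q : ℕ) (k : ℤ) : Type u := ∀ w : ℕ, P.Hom p q (k, w)

theorem weight_add {a b c : ℤ} (h : a + b = c) {w : ℕ} (x : antidiagonal w) :
    (a, x.1.1) + (b, x.1.2) = (c, w) :=
  Prod.ext h (HasAntidiagonal.mem_antidiagonal.1 x.2)

/-- Vertical composition of infinite sums. -/
def complComp {p r q : ℕ} {a b c : ℤ} (h : a + b = c) :
    ComplHom P p r a →ₗ[K] ComplHom P r q b →ₗ[K] ComplHom P p q c :=
  LinearMap.mk₂ K
    (fun f g w => ∑ x : antidiagonal w, P.comp (weight_add h x) (f x.1.1) (g x.1.2))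
    (fun _ _ _ => by ext; simp [sum_add_distrib]) (fun _ _ _ => by ext; simp [smul_sum])
    (fun _ _ _ => by ext; simp [sum_add_distrib]) (fun _ _ _ => by ext; simp [smul_sum])

/-- Horizontal composition of infinite sums. -/
def complTensor {p q p' q' : ℕ} {a b c : ℤ} (h : a + b = c) :
    ComplHom P p q a →ₗ[K] ComplHom P p' q' b →ₗ[K] ComplHom P (p + p') (q + q') c :=
  LinearMap.mk₂ K
    (fun f g w => ∑ x : antidiagonal w, P.tensor (weight_add h x) (f x.1.1) (g x.1.2))
    (fun _ _ _ => by ext; simp [sum_add_distrib]) (fun _ _ _ => by ext; simp [smul_sum])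
    (fun _ _ _ => by ext; simp [sum_add_distrib]) (fun _ _ _ => by ext; simp [smul_sum])

/-- A permutation, in weight zero. -/
def complPerm {p q : ℕ} (σ : Fin q ≃ Fin p) : ComplHom P p q 0 :=
  Pi.single (M := fun w => P.Hom p q (0, w)) 0 (P.perm σ)

theorem complComp_apply {p r q : ℕ} {a b c : ℤ} (h : a + b = c) (f : ComplHom P p r a)
    (g : ComplHom P r q b) (w : ℕ) : complComp P h f g w =
      ∑ x : antidiagonal w, P.comp (weight_add h x) (f x.1.1) (g x.1.2) := rfl

theorem complTensor_apply {p q p' q' : ℕ} {a b c : ℤ} (h : a + b = c) (f : ComplHom P p q a)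
    (g : ComplHom P p' q' b) (w : ℕ) : complTensor P h f g w =
      ∑ x : antidiagonal w, P.tensor (weight_add h x) (f x.1.1) (g x.1.2) := rfl

theorem complPerm_zero {p q : ℕ} (σ : Fin q ≃ Fin p) : complPerm P σ 0 = P.perm σ :=
  Pi.single_eq_same _ _

theorem complPerm_of_ne {p q : ℕ} (σ : Fin q ≃ Fin p) {w : ℕ} (h : w ≠ 0) :
    complPerm P σ w = 0 :=
  Pi.single_eq_of_ne h _

theorem antidiagonal_left {M : Type u} [AddCommMonoid M] (w : ℕ) (F : antidiagonal w → M)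
    (h : ∀ x : antidiagonal w, x.1.1 ≠ 0 → F x = 0) :
    ∑ x, F x = F ⟨(0, w), by simp⟩ := by
  refine Fintype.sum_eq_single _ fun x hx => h x fun h0 => hx (Subtype.ext ?_)
  have := HasAntidiagonal.mem_antidiagonal.1 x.2
  refine Prod.ext h0 ?_
  change x.1.2 = w
  omega

theorem antidiagonal_right {M : Type u} [AddCommMonoid M] (w : ℕ) (F : antidiagonal w → M)
    (h : ∀ x : antidiagonal w, x.1.2 ≠ 0 → F x = 0) :
    ∑ x, F x = F ⟨(w, 0), by simp⟩ := by
  refine Fintype.sum_eq_single _ fun x hx => h x fun h0 => hx (Subtype.ext ?_)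
  have := HasAntidiagonal.mem_antidiagonal.1 x.2
  refine Prod.ext ?_ h0
  change x.1.1 = w
  omega

theorem complPerm_comp {p r q : ℕ} {a : ℤ} (h : 0 + a = a) (σ : Fin r ≃ Fin p)
    (f : ComplHom P r q a) (w : ℕ) :
    complComp P h (complPerm P σ) f w = P.comp (zero_add _) (P.perm σ) (f w) := by
  rw [complComp_apply, antidiagonal_left]
  · change P.comp _ (complPerm P σ 0) (f w) = _
    rw [complPerm_zero]
  · intro x hx; simp [complPerm_of_ne P σ hx]

theorem complComp_perm {p r q : ℕ} {a : ℤ} (h : a + 0 = a) (f : ComplHom P p r a)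
    (σ : Fin q ≃ Fin r) (w : ℕ) :
    complComp P h f (complPerm P σ) w = P.comp (add_zero _) (f w) (P.perm σ) := by
  rw [complComp_apply, antidiagonal_right]
  · change P.comp _ (f w) (complPerm P σ 0) = _
    rw [complPerm_zero]
  · intro x hx; simp [complPerm_of_ne P σ hx]

theorem complPerm_tensor {p q p' q' : ℕ} {a : ℤ} (h : 0 + a = a) (σ : Fin q ≃ Fin p)
    (f : ComplHom P p' q' a) (w : ℕ) :
    complTensor P h (complPerm P σ) f w = P.tensor (zero_add _) (P.perm σ) (f w) := by
  rw [complTensor_apply, antidiagonal_left]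
  · change P.tensor _ (complPerm P σ 0) (f w) = _
    rw [complPerm_zero]
  · intro x hx; simp [complPerm_of_ne P σ hx]

theorem complTensor_perm {p q p' q' : ℕ} {a : ℤ} (h : a + 0 = a) (f : ComplHom P p q a)
    (σ : Fin q' ≃ Fin p') (w : ℕ) :
    complTensor P h f (complPerm P σ) w = P.tensor (add_zero _) (f w) (P.perm σ) := by
  rw [complTensor_apply, antidiagonal_right]
  · change P.tensor _ (f w) (complPerm P σ 0) = _
    rw [complPerm_zero]
  · intro x hx; simp [complPerm_of_ne P σ hx]

/-- The completion of a prop with respect to the filtration by weight: in each degree it consists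
of all infinite sums of elements of that degree of pairwise different weights. -/
def completion : GradedProp K (AddMonoidHom.id ℤ) where
  Hom p q k := ComplHom P p q k
  comp := complComp P
  tensor := complTensor P
  perm := complPerm P
  perm_comp_perm σ τ := by
    funext w
    rw [complPerm_comp P]
    rcases eq_or_ne w 0 with rfl | hw
    · rw [complPerm_zero, complPerm_zero]; exact P.perm_comp_perm σ τ
    · rw [complPerm_of_ne P _ hw, complPerm_of_ne P _ hw, map_zero]
  id_comp f := by
    funext w
    rw [complPerm_comp P, P.id_comp]
  comp_id f := by
    funext w
    rw [complComp_perm P, P.comp_id]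
  comp_assoc {p r s q a b c ab bc abc} h₁ h₂ h₃ h₄ f g h := by
    funext w
    simp only [complComp_apply, map_sum, LinearMap.sum_apply]
    refine Eq.trans ?_ ((antidiagonal_triple w fun i j k hw ↦
      P.comp (a := (a, i)) (b := (bc, j + k)) (c := (abc, w)) (Prod.ext h₄ ((add_assoc i j k).symm.trans hw)) (f i) (P.comp (c := (bc, j + k)) (Prod.ext h₃ rfl) (g j) (h k))).trans ?_)
    · refine Fintype.sum_congr _ _ fun x => Fintype.sum_congr _ _ fun y => ?_
      exact P.comp_assoc _ _ _ _ _ _ _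
    · refine Fintype.sum_congr _ _ fun x => Fintype.sum_congr _ _ fun y => ?_
      obtain ⟨⟨i, n⟩, hx⟩ := x
      obtain ⟨⟨j, k⟩, hy⟩ := y
      obtain rfl : j + k = n := HasAntidiagonal.mem_antidiagonal.1 hy
      rfl
  perm_tensor_perm σ τ := by
    funext w
    rw [complPerm_tensor P]
    rcases eq_or_ne w 0 with rfl | hw
    · rw [complPerm_zero, complPerm_zero]; exact P.perm_tensor_perm σ τ
    · rw [complPerm_of_ne P _ hw, complPerm_of_ne P _ hw, map_zero]
  tensor_assoc {p q p' q' p'' q'' a b c ab bc abc} h₁ h₂ h₃ h₄ f g h := by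
    funext w
    rw [complPerm_comp P, complComp_perm P]
    simp only [complTensor_apply, map_sum, LinearMap.sum_apply]
    refine Eq.trans ?_ ((antidiagonal_triple w fun i j k hw ↦
      P.comp (add_zero _) (P.tensor (a := (a, i)) (b := (bc, j + k)) (c := (abc, w))
      (Prod.ext h₄ ((add_assoc i j k).symm.trans hw)) (f i) (P.tensor (c := (bc, j + k)) (Prod.ext h₃ rfl) (g j) (h k)))
      (P.perm (finCongr (add_assoc q q' q'')))).trans ?_)
    · refine Fintype.sum_congr _ _ fun x => Fintype.sum_congr _ _ fun y => ?_
      exact P.tensor_assoc _ _ _ _ _ _ _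
    · refine Fintype.sum_congr _ _ fun x => Fintype.sum_congr _ _ fun y => ?_
      obtain ⟨⟨i, n⟩, hx⟩ := x
      obtain ⟨⟨j, k⟩, hy⟩ := y
      obtain rfl : j + k = n := HasAntidiagonal.mem_antidiagonal.1 hy
      rfl
  unit_tensor f := by
    funext w
    rw [complPerm_comp P, complPerm_tensor P, complComp_perm P, P.unit_tensor]
  tensor_unit f := by
    funext w
    rw [complPerm_comp P, complTensor_perm P, complComp_perm P, P.tensor_unit]
  interchange {p r q p' r' q' a a' b b' aa bb ab ab' c} h₁ h₂ h₃ h₄ h₅ h₆ f f' g g' := by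
    funext w
    rw [Pi.smul_apply]
    simp only [complComp_apply, complTensor_apply, map_sum, LinearMap.sum_apply, smul_sum]
    refine Eq.trans ?_ ((antidiagonal_quadruple w fun i i' j j' hw ↦
      sg K (a' * b) • P.tensor (a := (ab, i + j)) (b := (ab', i' + j')) (c := (c, w))
        (Prod.ext h₆ (by change i + j + (i' + j') = w; omega))
        (P.comp (c := (ab, i + j)) (Prod.ext h₄ rfl) (f i) (g j))
        (P.comp (c := (ab', i' + j')) (Prod.ext h₅ rfl) (f' i') (g' j'))).trans ?_)
    · refine Fintype.sum_congr _ _ fun x => ?_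
      refine Finset.sum_comm.trans ?_
      refine Fintype.sum_congr _ _ fun y => Fintype.sum_congr _ _ fun z => ?_
      exact P.interchange _ _ _ _ _ _ _ _ _ _
    · refine Fintype.sum_congr _ _ fun x => ?_
      refine Eq.trans ?_ Finset.sum_comm
      refine Fintype.sum_congr _ _ fun y => Fintype.sum_congr _ _ fun z => ?_
      obtain ⟨⟨m, n⟩, hx⟩ := x
      obtain ⟨⟨i, j⟩, hy⟩ := y
      obtain ⟨⟨k, l⟩, hz⟩ := z
      obtain rfl : i + j = m := HasAntidiagonal.mem_antidiagonal.1 hy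
      obtain rfl : k + l = n := HasAntidiagonal.mem_antidiagonal.1 hz
      rfl
  symmetry {p q p' q' a b c} h₁ h₂ f g := by
    funext w
    rw [Pi.smul_apply, complPerm_comp P, complComp_perm P]
    simp only [complTensor_apply, map_sum, LinearMap.sum_apply, smul_sum]
    refine Fintype.sum_equiv
      ⟨fun x => ⟨x.1.swap, HasAntidiagonal.swap_mem_antidiagonal.2 x.2⟩,
        fun x => ⟨x.1.swap, HasAntidiagonal.swap_mem_antidiagonal.2 x.2⟩, fun _ => rfl,
        fun _ => rfl⟩ _ _ fun x => ?_
    exact P.symmetry _ _ _ _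

/-- The action of a weight-preserving differential on infinite sums. -/
def complD {P : GradedProp K (AddMonoidHom.fst ℤ ℕ)} (D : P.Differential (1, 0)) {p q : ℕ}
    {a b : ℤ} (h : a + 1 = b) : ComplHom P p q a →ₗ[K] ComplHom P p q b where
  toFun f w := D.d (Prod.ext h rfl : (a, w) + (1, 0) = (b, w)) (f w)
  map_add' f g := by funext w; exact map_add _ _ _
  map_smul' c f := by funext w; exact map_smul _ _ _

theorem complD_apply {P : GradedProp K (AddMonoidHom.fst ℤ ℕ)} (D : P.Differential (1, 0))
    {p q : ℕ} {a b : ℤ} (h : a + 1 = b) (f : ComplHom P p q a) (w : ℕ) :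
    complD D h f w = D.d (Prod.ext h rfl : (a, w) + (1, 0) = (b, w)) (f w) := rfl

theorem complD_comp {P : GradedProp K (AddMonoidHom.fst ℤ ℕ)} (D : P.Differential (1, 0))
    {p r q : ℕ} {a b c a' b' c' : ℤ} (h : a + b = c) (ha : a + 1 = a') (hb : b + 1 = b')
    (hc : c + 1 = c') (h₁ : a' + b = c') (h₂ : a + b' = c') (f : ComplHom P p r a)
    (g : ComplHom P r q b) :
    complD D hc (complComp P h f g) =
      complComp P h₁ (complD D ha f) g + sg K a • complComp P h₂ f (complD D hb g) := by
  funext w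
  rw [Pi.add_apply, Pi.smul_apply]
  simp only [complD_apply, complComp_apply, map_sum, smul_sum]
  rw [← Finset.sum_add_distrib]
  exact Fintype.sum_congr _ _ fun x => D.d_comp _ _ _ _ _ _ _ _

theorem complD_tensor {P : GradedProp K (AddMonoidHom.fst ℤ ℕ)} (D : P.Differential (1, 0))
    {p q p' q' : ℕ} {a b c a' b' c' : ℤ} (h : a + b = c) (ha : a + 1 = a') (hb : b + 1 = b')
    (hc : c + 1 = c') (h₁ : a' + b = c') (h₂ : a + b' = c') (f : ComplHom P p q a)
    (g : ComplHom P p' q' b) :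
    complD D hc (complTensor P h f g) =
      complTensor P h₁ (complD D ha f) g + sg K a • complTensor P h₂ f (complD D hb g) := by
  funext w
  rw [Pi.add_apply, Pi.smul_apply]
  simp only [complD_apply, complTensor_apply, map_sum, smul_sum]
  rw [← Finset.sum_add_distrib]
  exact Fintype.sum_congr _ _ fun x => D.d_tensor _ _ _ _ _ _ _ _

/-- A weight-preserving differential extends to the completion. -/
def completionDifferential {P : GradedProp K (AddMonoidHom.fst ℤ ℕ)}
    (D : P.Differential (1, 0)) : (completion P).Differential 1 where
  deg_shift := rfl
  d := complD D
  d_d h h' f := by funext w; exact D.d_d _ _ _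
  d_perm {p q b} h σ := by
    funext w
    change D.d _ (complPerm P σ w) = 0
    rcases eq_or_ne w 0 with rfl | hw
    · rw [complPerm_zero]; exact D.d_perm _ σ
    · rw [complPerm_of_ne P σ hw, map_zero]
  d_comp := complD_comp D
  d_tensor := complD_tensor D

end Completion

/-! ### The prop of quantizations -/

/-- An ordered partition of `p` labels into `m` (nonempty) bunches. -/
abbrev Bunching (p m : ℕ) : Type := {f : Fin p → Fin m // Function.Surjective f}

/-- The map that merges the neighbouring bunches `i` and `i + 1` (counted from zero). -/
def Bunching.merge {p m : ℕ} (i : Fin (m + 1)) (f : Bunching p (m + 2)) : Bunching p (m + 1) :=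
  ⟨i.predAbove ∘ f.1, (Fin.predAbove_surjective i).comp f.2⟩

/-- Relabelling. -/
def Bunching.relabel {p m : ℕ} (σ : Equiv.Perm (Fin p)) (f : Bunching p m) : Bunching p m :=
  ⟨f.1 ∘ σ, f.2.comp σ.surjective⟩

theorem Bunching.merge_relabel {p m : ℕ} (σ : Equiv.Perm (Fin p)) (i : Fin (m + 1))
    (f : Bunching p (m + 2)) : (f.relabel σ).merge i = (f.merge i).relabel σ := rfl

theorem predAbove_val {m : ℕ} (i : Fin (m + 1)) (x : Fin (m + 2)) :
    (i.predAbove x : ℕ) = if (i : ℕ) < x then (x : ℕ) - 1 else x := by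
  unfold Fin.predAbove
  split_ifs with h₁ h₂ h₂ <;> rw [Fin.lt_def, Fin.val_castSucc] at h₁ <;> simp <;> omega

theorem Bunching.merge_merge {p m : ℕ} (f : Bunching p (m + 3)) {i j : Fin (m + 1)}
    (h : i ≤ j) : (f.merge i.castSucc).merge j = (f.merge j.succ).merge i := by
  refine Subtype.ext (funext fun x => Fin.ext ?_)
  have := Fin.le_def.1 h
  simp only [merge, Function.comp_apply, predAbove_val, Fin.val_castSucc, Fin.val_succ]
  split_ifs <;> omega

theorem alternating_sum {M : Type u} [AddCommGroup M] (K : Type u) [Field K] [Module K M] (m : ℕ)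
    (F : Fin (m + 1) → Fin (m + 2) → M)
    (h : ∀ i j : Fin (m + 1), i ≤ j → F j i.castSucc = F i j.succ) :
    ∑ j : Fin (m + 2), ∑ i : Fin (m + 1), sg K ((j : ℤ) + (i : ℤ)) • F i j = 0 := by
  rw [← Fintype.sum_prod_type']
  refine Finset.sum_involution (fun x _ => if hx : x.1.1 ≤ x.2.1
    then (x.2.succ, ⟨x.1.1, by omega⟩)
    else (x.2.castSucc, ⟨x.1.1 - 1, by omega⟩)) ?_ ?_ ?_ ?_
  · rintro ⟨j, i⟩ _
    dsimp only
    split_ifs with hx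
    · have := h ⟨j, by omega⟩ i hx
      rw [← this, sg_congr K (m := (i.succ.val : ℤ) + j.val) (n := ((j.val : ℤ) + i.val) + 1)
        ⟨0, by simp; ring⟩, sg_succ, neg_smul]
      exact add_neg_cancel _
    · obtain ⟨j', rfl⟩ : ∃ j' : Fin (m + 1), j'.succ = j :=
        ⟨j.pred (by rintro rfl; simp at hx), by simp⟩
      have hij : i ≤ j' := by
        rw [Fin.val_succ] at hx
        exact Fin.le_def.2 (by omega)
      have e : (⟨(j'.succ : ℕ) - 1, by omega⟩ : Fin (m + 1)) = j' := Fin.ext (by simp)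
      rw [e, h i j' hij, sg_congr K (m := (j'.succ.val : ℤ) + i.val)
        (n := (i.castSucc.val : ℤ) + j'.val + 1) ⟨0, by simp; ring⟩, sg_succ, neg_smul]
      exact neg_add_cancel _
  · rintro ⟨j, i⟩ _ _
    dsimp only
    split_ifs with hx
    · simp [Fin.ext_iff]; omega
    · simp [Fin.ext_iff]; omega
  · simp
  · rintro ⟨j, i⟩ _
    by_cases hx : (j : ℕ) ≤ i
    · simp [hx]
    · have : ¬ (j : ℕ) ≤ i := hx
      have h2 : (i : ℕ) ≤ j - 1 := by omega
      simp [hx, h2, Fin.ext_iff]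
      omega

/-- A corolla with `p` outputs, distributed over `m + 1` ordered bunches, and `q` inputs,
distributed over `n + 1` ordered bunches.  A corolla with `a` output and `b` input bunches has
degree `3 - a - b`. -/
structure Corolla (p q : ℕ) (k : ℤ) where
  m : ℕ
  n : ℕ
  out : Bunching p (m + 1)
  inp : Bunching q (n + 1)
  deg : k = 3 - ((m + 1 : ℕ) : ℤ) - ((n + 1 : ℕ) : ℤ)

section DefQ

variable (K : Type u) [Field K]

/-- The linear combination, with alternating signs, of the corollas obtained by merging two
neighbouring output bunches. -/
def mergeOut {p q : ℕ} {k l : ℤ} (h : k + 1 = l) : Corolla p q k → (Corolla p q l →₀ K)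
  | ⟨0, _, _, _, _⟩ => 0
  | ⟨m + 1, n, out, inp, hk⟩ => ∑ i : Fin (m + 1), Finsupp.single
      ⟨m, n, out.merge i, inp, by push_cast at hk ⊢; omega⟩ (sg K ((i : ℤ) + 1))

/-- The linear combination, with alternating signs, of the corollas obtained by merging two
neighbouring input bunches. -/
def mergeInp {p q : ℕ} {k l : ℤ} (h : k + 1 = l) : Corolla p q k → (Corolla p q l →₀ K)
  | ⟨_, 0, _, _, _⟩ => 0
  | ⟨m, n + 1, out, inp, hk⟩ => ∑ j : Fin (n + 1), Finsupp.single
      ⟨m, n, out, inp.merge j, by push_cast at hk ⊢; omega⟩ (sg K ((j : ℤ) + 1))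

/-- Relabelling of the legs of a corolla. -/
def Corolla.relabel {p q : ℕ} {k : ℤ} (σ : Equiv.Perm (Fin p)) (τ : Equiv.Perm (Fin q))
    (c : Corolla p q k) : Corolla p q k :=
  ⟨c.m, c.n, c.out.relabel σ⁻¹, c.inp.relabel τ, c.deg⟩

theorem Corolla.relabel_one {p q : ℕ} {k : ℤ} (c : Corolla p q k) : c.relabel 1 1 = c := rfl

theorem Corolla.relabel_relabel {p q : ℕ} {k : ℤ} (σ σ' : Equiv.Perm (Fin p))
    (τ τ' : Equiv.Perm (Fin q)) (c : Corolla p q k) :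
    (c.relabel σ' τ').relabel σ τ = c.relabel (σ * σ') (τ' * τ) := by
  simp only [relabel, mul_inv_rev]
  rfl

/-- The `S`-bimodule of corollas with bunched legs. -/
def corollas : SBimodule K where
  V p q k := Corolla p q k →₀ K
  act σ τ := Finsupp.lmapDomain K K (Corolla.relabel σ τ)
  act_one e := Finsupp.mapDomain_id
  act_act σ σ' τ τ' e := by
    rw [Finsupp.lmapDomain_apply, Finsupp.lmapDomain_apply, ← Finsupp.mapDomain_comp]
    congr 1

/-- The differential of a corolla with `a` output bunches: the alternating sum over all ways to
merge two neighbouring output bunches, plus `(-1)^a` times the alternating sum over all ways to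
merge two neighbouring input bunches (the total differential of a bicomplex). -/
def corollaD {p q : ℕ} {k l : ℤ} (h : k + 1 = l) (c : Corolla p q k) : Corolla p q l →₀ K :=
  mergeOut K h c + sg K ((c.m : ℤ) + 1) • mergeInp K h c

theorem linearCombination_mergeOut {p q : ℕ} {k l m : ℤ} (h : k + 1 = l) (h' : l + 1 = m)
    (c : Corolla p q k) : Finsupp.linearCombination K (mergeOut K h') (mergeOut K h c) = 0 := by
  obtain ⟨_ | _ | m, n, out, inp, hk⟩ := c
  · simp [mergeOut]
  · simp [mergeOut]
  · simp only [mergeOut, map_sum, Finsupp.linearCombination_single, Finset.smul_sum,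
      Finsupp.smul_single, smul_eq_mul]
    refine Eq.trans ?_ (alternating_sum (M := Corolla p q _ →₀ K) K m (fun i j => Finsupp.single
      ⟨m, n, (out.merge j).merge i, inp, by push_cast at hk ⊢; omega⟩ 1) fun i j hij => by
        simp only [out.merge_merge hij])
    refine Fintype.sum_congr _ _ fun j => Fintype.sum_congr _ _ fun i => ?_
    rw [Finsupp.smul_single, smul_eq_mul, mul_one, ← sg_add]
    congr 1
    exact sg_congr K ⟨1, by ring⟩

theorem linearCombination_mergeInp {p q : ℕ} {k l m : ℤ} (h : k + 1 = l) (h' : l + 1 = m)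
    (c : Corolla p q k) : Finsupp.linearCombination K
      (fun c' => sg K ((c'.m : ℤ) + 1) • mergeInp K h' c') (mergeInp K h c) = 0 := by
  obtain ⟨m, _ | _ | n, out, inp, hk⟩ := c
  · simp [mergeInp]
  · simp [mergeInp]
  · simp only [mergeInp, map_sum, Finsupp.linearCombination_single, Finset.smul_sum,
      Finsupp.smul_single, smul_eq_mul]
    refine Eq.trans ?_ (alternating_sum (M := Corolla p q _ →₀ K) K n (fun i j => Finsupp.single
      ⟨m, n, out, (inp.merge j).merge i, by push_cast at hk ⊢; omega⟩ (sg K ((m : ℤ) + 1)))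
      fun i j hij => by simp only [inp.merge_merge hij])
    refine Fintype.sum_congr _ _ fun j => Fintype.sum_congr _ _ fun i => ?_
    rw [Finsupp.smul_single, smul_eq_mul, ← sg_add, ← sg_add, ← sg_add]
    congr 1
    exact sg_congr K ⟨1, by ring⟩

theorem linearCombination_merge {p q : ℕ} {k l m : ℤ} (h : k + 1 = l) (h' : l + 1 = m)
    (c : Corolla p q k) :
    sg K ((c.m : ℤ) + 1) • Finsupp.linearCombination K (mergeOut K h') (mergeInp K h c) +
      Finsupp.linearCombination K (fun c' => sg K ((c'.m : ℤ) + 1) • mergeInp K h' c')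
        (mergeOut K h c) = 0 := by
  obtain ⟨_ | m, _ | n, out, inp, hk⟩ := c
  · simp [mergeOut, mergeInp]
  · simp [mergeOut, mergeInp]
  · simp [mergeOut, mergeInp]
  · simp only [mergeOut, mergeInp, map_sum, Finsupp.linearCombination_single, Finset.smul_sum,
      Finsupp.smul_single, smul_eq_mul]
    rw [Finset.sum_comm, ← Finset.sum_add_distrib]
    refine Finset.sum_eq_zero fun i _ => ?_
    rw [← Finset.sum_add_distrib]
    refine Finset.sum_eq_zero fun j _ => ?_
    rw [← Finsupp.single_add, Finsupp.single_eq_zero]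
    push_cast
    rw [sg_succ K ((m : ℤ) + 1)]
    ring

theorem corollaD_corollaD {p q : ℕ} {k l m : ℤ} (h : k + 1 = l) (h' : l + 1 = m)
    (c : Corolla p q k) : Finsupp.linearCombination K (corollaD K h') (corollaD K h c) = 0 := by
  have key : ∀ x : Corolla p q l →₀ K, Finsupp.linearCombination K (corollaD K h') x =
      Finsupp.linearCombination K (mergeOut K h') x +
      Finsupp.linearCombination K (fun c' => sg K ((c'.m : ℤ) + 1) • mergeInp K h' c') x := by
    intro x
    simp only [Finsupp.linearCombination_apply, Finsupp.sum, ← Finset.sum_add_distrib, ← smul_add]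
    rfl
  rw [key, corollaD, map_add, map_add, map_smul, map_smul, linearCombination_mergeOut,
    linearCombination_mergeInp, smul_zero, zero_add, add_zero]
  exact linearCombination_merge K h h' c

theorem corollaD_relabel {p q : ℕ} {k l : ℤ} (h : k + 1 = l) (σ : Equiv.Perm (Fin p))
    (τ : Equiv.Perm (Fin q)) (c : Corolla p q k) :
    corollaD K h (c.relabel σ τ) =
      Finsupp.lmapDomain K K (Corolla.relabel σ τ) (corollaD K h c) := by
  rw [corollaD, corollaD, map_add, map_smul]
  congr 1
  · obtain ⟨_ | m, n, out, inp, hk⟩ := c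
    · simp [mergeOut, Corolla.relabel]
    · simp only [mergeOut, Corolla.relabel, map_sum, Finsupp.lmapDomain_apply,
        Finsupp.mapDomain_single, Bunching.merge_relabel]
  · congr 1
    obtain ⟨m, _ | n, out, inp, hk⟩ := c
    · simp [mergeInp, Corolla.relabel]
    · simp only [mergeInp, Corolla.relabel, map_sum, Finsupp.lmapDomain_apply,
        Finsupp.mapDomain_single, Bunching.merge_relabel]

/-- The differential `d₁` on corollas. -/
def corollasD : (corollas K).Differential where
  d h := Finsupp.linearCombination K (corollaD K h)
  d_d h h' e := by
    change Finsupp.linearCombination K (corollaD K h')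
      (Finsupp.linearCombination K (corollaD K h) e) = 0
    induction e using Finsupp.induction_linear with
    | zero => simp
    | add x y hx hy => rw [map_add, map_add, hx, hy, add_zero]
    | single c a => rw [Finsupp.linearCombination_single, map_smul, corollaD_corollaD, smul_zero]
  d_act {p q k l} h σ τ e := by
    change Finsupp.linearCombination K (corollaD K h)
      (Finsupp.lmapDomain K K (Corolla.relabel σ τ) e) =
        Finsupp.lmapDomain K K (Corolla.relabel σ τ) (Finsupp.linearCombination K (corollaD K h) e)
    induction e using Finsupp.induction_linear with
    | zero => simp
    | add x y hx hy => simp only [map_add, hx, hy]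
    | single c a =>
      rw [Finsupp.lmapDomain_apply, Finsupp.mapDomain_single, Finsupp.linearCombination_single,
        Finsupp.linearCombination_single, map_smul, corollaD_relabel]

end DefQ

/-! ### The two props -/

section Props

variable (K : Type u) [Field K]

/-- The `S`-bimodule `L⁺` of (strongly) homotopy Lie bialgebras: one generator of degree
`3 - p - q` for all `p, q ≥ 1`, skew symmetric in the outputs and in the inputs. -/
def lieBGenerators : SBimodule K where
  V p q k := PLift (1 ≤ p ∧ 1 ≤ q ∧ k = 3 - (p : ℤ) - (q : ℤ)) →₀ K
  act σ τ := (((Equiv.Perm.sign σ * Equiv.Perm.sign τ : ℤˣ) : ℤ) : K) • LinearMap.id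
  act_one e := by simp
  act_act σ σ' τ τ' e := by
    simp only [LinearMap.smul_apply, LinearMap.id_apply, smul_smul, map_mul]
    push_cast
    congr 1
    ring

/-- The completed prop `LieB_∞⁺`, without its differential: the free graded prop on `L⁺`,
completed with respect to the number of vertices. -/
def LieBInfPlusHat : GradedProp K (AddMonoidHom.id ℤ) :=
  completion (freeProp (lieBGenerators K) fun _ _ => 1)

/-- The graded prop `DefQ⁺`: the free prop on the corollas with bunched legs, completed with
respect to the genus filtration.  A corolla with `p` outputs and `q` inputs has weight `p + q - 2`;
in a graph with `P` outputs, `Q` inputs, `c` connected components and first Betti number `g` the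
weights of the vertices add up to `2 (g - c) + P + Q`.  Every component of a nonempty graph has an
output and an input, so that `1 ≤ c ≤ min P Q`, and for fixed `P` and `Q` the filtration by weight
and the filtration by `g` give the same completion. -/
def DefQPlus : GradedProp K (AddMonoidHom.id ℤ) :=
  completion (freeProp (corollas K) fun p q => p + q - 2)

/-- The differential `d₁` of `DefQ⁺`, the part of the differential that preserves the number of
vertices. -/
def d1 : (DefQPlus K).Differential 1 :=
  completionDifferential (freeDifferential (fun p q => p + q - 2) (corollasD K))

end Props

end DefQuant

end

noncomputable section

namespace DefQuant

open Finset

/-! ### The universal property of the free prop -/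

section Lift

variable {K : Type u} [Field K] {E : SBimodule K} {wt : ℕ → ℕ → ℕ}

/-! Both props are completed free props, and `d1` is the derivation that extends the differential of
the bimodule of corollas. The theorem therefore splits into a computation of the cohomology of the
generators and a Künneth statement: in characteristic zero, forming the free prop commutes with
taking cohomology.

Generators. The corollas with given legs form the tensor product of two complexes of ordered
partitions, one for the outputs and one for the inputs, in which the differential merges
neighbouring bunches. The cohomology of such a complex is a line, spanned by the alternating sum of
the partitions into singletons. To see that it is a line, single out one label. Over a fixed ordered
partition of the other labels its possible places form a subdivided interval: the gaps between the
bunches are the vertices, the bunches are the edges. The interval contracts to its last vertex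
(`partD_partH`), and induction gives a contraction onto a line (`exists_part_contraction`). In
characteristic zero this is corrected to a contraction onto the skew-symmetric class
(`exists_sign_contraction`). Tensoring the two contractions and averaging the homotopy over the
permutations of the legs contracts the corollas equivariantly onto L⁺
(`exists_corollas_contraction`).

Künneth. No normal form of elements as decorated graphs is needed. Given a contraction of the
generators E onto L, with inclusion i, projection r and homotopy T, extend T to a derivation of
degree -1 of the free prop. Its graded commutator with the differential, `euler`, is a derivation of
degree zero which acts on generators as the projector 1 - ir, so it counts the vertices decorated by
the complement of L. The free prop is the sum of the parts with eigenvalues 0, 1, 2, …, where the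
zero part may be taken to be the span of the elements induced from L (`mem_iSup_eulerPart`).
Directness of this sum is not needed. On cocycles `euler` takes exact values, so, positive integers
being invertible, every cocycle is an induced element plus a coboundary (`exists_inducedPart`).
Conversely, the map of free props given by r is a left inverse of the one given by i and kills
coboundaries (`freeMap_r_i`, `freeMap_freeDiff`), so an exact element cannot come from a nonzero
element over L.

Completions. DefQ⁺ is completed by the weight p + q - 2 of the vertices, the other prop by the
number of vertices. On a generator of L⁺ one has 1 = (p + q - 2) + (3 - p - q): the number of
vertices is the weight plus the degree. In a fixed degree the two completions are thus products over
the same index up to a shift, and `complMap` carries the argument over to infinite sums, compatibly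
with both compositions. -/

/-- An equivariant map from an `S`-bimodule to a graded prop. -/
structure SBimodule.ToProp (E : SBimodule K) (Q : GradedProp K (AddMonoidHom.id ℤ)) where
  map : ∀ {p q : ℕ} {k : ℤ}, E.V p q k →ₗ[K] Q.Hom p q k
  map_act : ∀ {p q : ℕ} {k : ℤ} (σ : Equiv.Perm (Fin p)) (τ : Equiv.Perm (Fin q))
    (e : E.V p q k), map (E.act σ τ e) =
      Q.comp (zero_add _) (Q.perm σ) (Q.comp (add_zero _) (map e) (Q.perm τ))

variable {Q : GradedProp K (AddMonoidHom.id ℤ)} (φ : E.ToProp Q)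

/-- Evaluation of a formal composite in a prop. -/
def termLift : ∀ {p q : ℕ} {a : ℤ × ℕ}, Term E wt p q a → Q.Hom p q a.1
  | _, _, _, .gen e => φ.map e
  | _, _, _, .perm σ => Q.perm σ
  | _, _, _, .comp h s t => Q.comp (congrArg Prod.fst h) (termLift s) (termLift t)
  | _, _, _, .tensor h s t => Q.tensor (congrArg Prod.fst h) (termLift s) (termLift t)

/-- Evaluation of a linear combination of formal composites in a prop. -/
def preLift {p q : ℕ} {a : ℤ × ℕ} : Pre E wt p q a →ₗ[K] Q.Hom p q a.1 :=
  Finsupp.linearCombination K (termLift φ)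

theorem preLift_gen {p q : ℕ} {k : ℤ} (e : E.V p q k) :
    preLift φ (wt := wt) (Pre.gen e) = φ.map e := by
  simp [preLift, Pre.gen, termLift]

theorem preLift_perm {p q : ℕ} (σ : Fin q ≃ Fin p) :
    preLift φ (wt := wt) (Pre.perm σ) = Q.perm σ := by
  simp [preLift, Pre.perm, termLift]

theorem preLift_comp {p r q : ℕ} {a b c : ℤ × ℕ} (h : a + b = c) (x : Pre E wt p r a)
    (y : Pre E wt r q b) :
    preLift φ (Pre.comp h x y) = Q.comp (congrArg Prod.fst h) (preLift φ x) (preLift φ y) := by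
  induction x using Finsupp.induction_linear with
  | zero => simp
  | add x x' hx hx' => simp only [map_add, LinearMap.add_apply, hx, hx']
  | single s u =>
    induction y using Finsupp.induction_linear with
    | zero => simp
    | add y y' hy hy' => simp only [map_add, hy, hy']
    | single t v =>
      rw [← mul_one u, ← mul_one v, ← smul_eq_mul u, ← smul_eq_mul v, ← Finsupp.smul_single,
        ← Finsupp.smul_single]
      simp only [map_smul, LinearMap.smul_apply, Pre.comp_single]
      simp [preLift, termLift]

theorem preLift_tensor {p q p' q' : ℕ} {a b c : ℤ × ℕ} (h : a + b = c) (x : Pre E wt p q a)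
    (y : Pre E wt p' q' b) :
    preLift φ (Pre.tensor h x y) =
      Q.tensor (congrArg Prod.fst h) (preLift φ x) (preLift φ y) := by
  induction x using Finsupp.induction_linear with
  | zero => simp
  | add x x' hx hx' => simp only [map_add, LinearMap.add_apply, hx, hx']
  | single s u =>
    induction y using Finsupp.induction_linear with
    | zero => simp
    | add y y' hy hy' => simp only [map_add, hy, hy']
    | single t v =>
      rw [← mul_one u, ← mul_one v, ← smul_eq_mul u, ← smul_eq_mul v, ← Finsupp.smul_single,
        ← Finsupp.smul_single]
      simp only [map_smul, LinearMap.smul_apply, Pre.tensor_single]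
      simp [preLift, termLift]

/-- Every generating relation is either an axiom of graded props, hence valid in the target, or says
that generators are linear and equivariant, which `φ` respects. -/
theorem preLift_rel {p q : ℕ} {a : ℤ × ℕ} {x : Pre E wt p q a} (hx : Rel x) :
    preLift φ x = 0 := by
  induction hx with
  | zero => simp
  | add _ _ ih ih' => simp [ih, ih']
  | smul c _ ih => simp [ih]
  | comp_left h y _ ih => simp [preLift_comp, ih]
  | comp_right h x _ ih => simp [preLift_comp, ih]
  | tensor_left h y _ ih => simp [preLift_tensor, ih]
  | tensor_right h x _ ih => simp [preLift_tensor, ih]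
  | gen_add e e' =>
    rw [map_sub, sub_eq_zero, map_add, preLift_gen, preLift_gen, preLift_gen]
    exact map_add _ _ _
  | gen_smul c e =>
    rw [map_sub, sub_eq_zero, map_smul, preLift_gen, preLift_gen]
    exact map_smul _ _ _
  | gen_act σ τ e =>
    rw [map_sub, sub_eq_zero, preLift_gen, preLift_comp, preLift_comp, preLift_gen, preLift_perm,
      preLift_perm]
    exact φ.map_act σ τ e
  | perm_comp_perm σ τ =>
    rw [map_sub, sub_eq_zero, preLift_comp, preLift_perm, preLift_perm, preLift_perm]
    exact Q.perm_comp_perm σ τ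
  | id_comp x =>
    rw [map_sub, sub_eq_zero, preLift_comp, preLift_perm]
    exact Q.id_comp _
  | comp_id x =>
    rw [map_sub, sub_eq_zero, preLift_comp, preLift_perm]
    exact Q.comp_id _
  | comp_assoc h₁ h₂ h₃ h₄ x y z =>
    rw [map_sub, sub_eq_zero, preLift_comp, preLift_comp, preLift_comp, preLift_comp]
    exact Q.comp_assoc _ _ _ _ _ _ _
  | perm_tensor_perm σ τ =>
    rw [map_sub, sub_eq_zero, preLift_tensor, preLift_perm, preLift_perm, preLift_perm]
    exact Q.perm_tensor_perm σ τ
  | tensor_assoc h₁ h₂ h₃ h₄ x y z =>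
    rw [map_sub, sub_eq_zero, preLift_comp, preLift_comp, preLift_perm, preLift_perm,
      preLift_tensor, preLift_tensor, preLift_tensor, preLift_tensor]
    exact Q.tensor_assoc _ _ _ _ _ _ _
  | unit_tensor x =>
    rw [map_sub, sub_eq_zero, preLift_comp, preLift_comp, preLift_perm, preLift_perm,
      preLift_tensor, preLift_perm]
    exact Q.unit_tensor _
  | tensor_unit x =>
    rw [map_sub, sub_eq_zero, preLift_comp, preLift_comp, preLift_perm, preLift_perm,
      preLift_tensor, preLift_perm]
    exact Q.tensor_unit _
  | interchange h₁ h₂ h₃ h₄ h₅ h₆ x x' y y' =>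
    rw [map_sub, sub_eq_zero, map_smul, preLift_comp, preLift_tensor, preLift_tensor,
      preLift_tensor, preLift_comp, preLift_comp]
    exact Q.interchange _ _ _ _ _ _ _ _ _ _
  | symmetry h₁ h₂ x y =>
    rw [map_sub, sub_eq_zero, map_smul, preLift_comp, preLift_comp, preLift_tensor,
      preLift_tensor, preLift_perm, preLift_perm]
    exact Q.symmetry _ _ _ _

variable (wt) in
/-- The extension of an equivariant map to the free prop. -/
def freeLift {p q : ℕ} {a : ℤ × ℕ} : (freeProp E wt).Hom p q a →ₗ[K] Q.Hom p q a.1 :=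
  (relations E wt p q a).liftQ (preLift φ) fun _ hx => preLift_rel φ hx

theorem freeLift_gen {p q : ℕ} {k : ℤ} (e : E.V p q k) :
    freeLift wt φ (freeGen wt e) = φ.map e :=
  preLift_gen φ e

theorem freeLift_perm {p q : ℕ} (σ : Fin q ≃ Fin p) :
    freeLift wt φ ((freeProp E wt).perm σ) = Q.perm σ :=
  preLift_perm φ σ

theorem freeLift_comp {p r q : ℕ} {a b c : ℤ × ℕ} (h : a + b = c) (f : (freeProp E wt).Hom p r a)
    (g : (freeProp E wt).Hom r q b) :
    freeLift wt φ ((freeProp E wt).comp h f g) =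
      Q.comp (congrArg Prod.fst h) (freeLift wt φ f) (freeLift wt φ g) := by
  obtain ⟨x, rfl⟩ := freeMk_surjective f
  obtain ⟨y, rfl⟩ := freeMk_surjective g
  exact preLift_comp φ h x y

theorem freeLift_tensor {p q p' q' : ℕ} {a b c : ℤ × ℕ} (h : a + b = c)
    (f : (freeProp E wt).Hom p q a) (g : (freeProp E wt).Hom p' q' b) :
    freeLift wt φ ((freeProp E wt).tensor h f g) =
      Q.tensor (congrArg Prod.fst h) (freeLift wt φ f) (freeLift wt φ g) := by
  obtain ⟨x, rfl⟩ := freeMk_surjective f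
  obtain ⟨y, rfl⟩ := freeMk_surjective g
  exact preLift_tensor φ h x y

/-- Induction on elements of the free prop. -/
theorem freeProp_induction
    {motive : ∀ {p q : ℕ} {a : ℤ × ℕ}, (freeProp E wt).Hom p q a → Prop}
    (zero : ∀ {p q : ℕ} {a : ℤ × ℕ}, motive (0 : (freeProp E wt).Hom p q a))
    (add : ∀ {p q : ℕ} {a : ℤ × ℕ} (f g : (freeProp E wt).Hom p q a),
      motive f → motive g → motive (f + g))
    (smul : ∀ {p q : ℕ} {a : ℤ × ℕ} (c : K) (f : (freeProp E wt).Hom p q a),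
      motive f → motive (c • f))
    (gen : ∀ {p q : ℕ} {k : ℤ} (e : E.V p q k), motive (freeGen wt e))
    (perm : ∀ {p q : ℕ} (σ : Fin q ≃ Fin p), motive ((freeProp E wt).perm σ))
    (comp : ∀ {p r q : ℕ} {a b c : ℤ × ℕ} (h : a + b = c) (f : (freeProp E wt).Hom p r a)
      (g : (freeProp E wt).Hom r q b), motive f → motive g → motive ((freeProp E wt).comp h f g))
    (tensor : ∀ {p q p' q' : ℕ} {a b c : ℤ × ℕ} (h : a + b = c) (f : (freeProp E wt).Hom p q a)
      (g : (freeProp E wt).Hom p' q' b), motive f → motive g →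
        motive ((freeProp E wt).tensor h f g))
    {p q : ℕ} {a : ℤ × ℕ} (f : (freeProp E wt).Hom p q a) : motive f := by
  have term : ∀ {p q : ℕ} {a : ℤ × ℕ} (t : Term E wt p q a),
      motive (freeMk (Finsupp.single t (1 : K))) := by
    intro p q a t
    induction t with
    | gen e => exact gen e
    | perm σ => exact perm σ
    | comp h s t ihs iht =>
      rw [← Pre.comp_single, freeMk_comp]
      exact comp h _ _ ihs iht
    | tensor h s t ihs iht =>
      rw [← Pre.tensor_single, freeMk_tensor]
      exact tensor h _ _ ihs iht
  obtain ⟨x, rfl⟩ := freeMk_surjective f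
  induction x using Finsupp.induction with
  | zero =>
    rw [map_zero]
    exact zero
  | single_add t u y _ _ ih =>
    rw [map_add, ← mul_one u, ← smul_eq_mul, ← Finsupp.smul_single, map_smul]
    exact add _ _ (smul _ _ (term t)) ih

end Lift

/-! ### Derivations of degree minus one -/

section Lowering

variable {K : Type u} [Field K] {E : SBimodule K} {wt : ℕ → ℕ → ℕ}

/-- An equivariant map of degree `-1` from an `S`-bimodule to itself. -/
structure SBimodule.LoweringMap (E : SBimodule K) where
  h : ∀ {p q : ℕ} {k l : ℤ}, k + -1 = l → E.V p q k →ₗ[K] E.V p q l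
  h_act : ∀ {p q : ℕ} {k l : ℤ} (hk : k + -1 = l) (σ : Equiv.Perm (Fin p))
    (τ : Equiv.Perm (Fin q)) (e : E.V p q k), h hk (E.act σ τ e) = E.act σ τ (h hk e)

variable (T : E.LoweringMap)

/-- The value of the derivation of degree `-1` on a formal composite, by the Leibniz rule. -/
def termH : ∀ {p q : ℕ} {a b : ℤ × ℕ}, a + (-1, 0) = b → Term E wt p q a →
    (freeProp E wt).Hom p q b
  | _, _, _, _, h, .gen e => h ▸ freeGen wt (T.h rfl e)
  | _, _, _, _, _, .perm _ => 0
  | _, _, _, _, hc, @Term.comp _ _ _ _ _ _ _ a b _ h s t =>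
      (freeProp E wt).comp (by rw [add_right_comm, h, hc]) (termH (a := a) rfl s)
          (freeMk (Finsupp.single t 1)) +
        sg K a.1 • (freeProp E wt).comp (by rw [← add_assoc, h, hc])
          (freeMk (Finsupp.single s 1)) (termH (a := b) rfl t)
  | _, _, _, _, hc, @Term.tensor _ _ _ _ _ _ _ _ a b _ h s t =>
      (freeProp E wt).tensor (by rw [add_right_comm, h, hc]) (termH (a := a) rfl s)
          (freeMk (Finsupp.single t 1)) +
        sg K a.1 • (freeProp E wt).tensor (by rw [← add_assoc, h, hc])
          (freeMk (Finsupp.single s 1)) (termH (a := b) rfl t)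

/-- The derivation of degree `-1` on linear combinations of formal composites. -/
def preH {p q : ℕ} {a b : ℤ × ℕ} (h : a + (-1, 0) = b) :
    Pre E wt p q a →ₗ[K] (freeProp E wt).Hom p q b :=
  Finsupp.linearCombination K (termH T h)

theorem preH_gen {p q : ℕ} {k l : ℤ} (h : k + -1 = l)
    (h' : (k, wt p q) + (-1, 0) = (l, wt p q)) (e : E.V p q k) :
    preH T h' (Pre.gen e) = freeGen wt (T.h h e) := by
  subst h
  simp [preH, Pre.gen, termH]

theorem preH_perm {p q : ℕ} {b : ℤ × ℕ} (h : 0 + (-1, 0) = b) (σ : Fin q ≃ Fin p) :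
    preH T (wt := wt) h (Pre.perm σ) = 0 := by
  simp [preH, Pre.perm, termH]

theorem preH_comp {p r q : ℕ} {a b c a' b' c' : ℤ × ℕ} (h : a + b = c) (ha : a + (-1, 0) = a')
    (hb : b + (-1, 0) = b') (hc : c + (-1, 0) = c') (h₁ : a' + b = c') (h₂ : a + b' = c')
    (x : Pre E wt p r a) (y : Pre E wt r q b) :
    preH T hc (Pre.comp h x y) =
      (freeProp E wt).comp h₁ (preH T ha x) (freeMk y) +
        sg K a.1 • (freeProp E wt).comp h₂ (freeMk x) (preH T hb y) := by
  subst ha hb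
  induction x using Finsupp.induction_linear with
  | zero => simp
  | add x x' hx hx' =>
    simp only [map_add, LinearMap.add_apply, hx, hx', smul_add]
    abel
  | single s u =>
    induction y using Finsupp.induction_linear with
    | zero => simp
    | add y y' hy hy' =>
      simp only [map_add, hy, hy', smul_add]
      abel
    | single t v =>
      rw [← mul_one u, ← mul_one v, ← smul_eq_mul u, ← smul_eq_mul v, ← Finsupp.smul_single,
        ← Finsupp.smul_single]
      simp only [map_smul, LinearMap.smul_apply, Pre.comp_single]
      rw [preH, Finsupp.linearCombination_single, preH, Finsupp.linearCombination_single, preH,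
        Finsupp.linearCombination_single, termH]
      simp only [one_smul, smul_add]
      rw [smul_comm (sg K a.1) v, smul_comm (sg K a.1) u]

theorem preH_tensor {p q p' q' : ℕ} {a b c a' b' c' : ℤ × ℕ} (h : a + b = c)
    (ha : a + (-1, 0) = a') (hb : b + (-1, 0) = b') (hc : c + (-1, 0) = c') (h₁ : a' + b = c')
    (h₂ : a + b' = c') (x : Pre E wt p q a) (y : Pre E wt p' q' b) :
    preH T hc (Pre.tensor h x y) =
      (freeProp E wt).tensor h₁ (preH T ha x) (freeMk y) +
        sg K a.1 • (freeProp E wt).tensor h₂ (freeMk x) (preH T hb y) := by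
  subst ha hb
  induction x using Finsupp.induction_linear with
  | zero => simp
  | add x x' hx hx' =>
    simp only [map_add, LinearMap.add_apply, hx, hx', smul_add]
    abel
  | single s u =>
    induction y using Finsupp.induction_linear with
    | zero => simp
    | add y y' hy hy' =>
      simp only [map_add, hy, hy', smul_add]
      abel
    | single t v =>
      rw [← mul_one u, ← mul_one v, ← smul_eq_mul u, ← smul_eq_mul v, ← Finsupp.smul_single,
        ← Finsupp.smul_single]
      simp only [map_smul, LinearMap.smul_apply, Pre.tensor_single]
      rw [preH, Finsupp.linearCombination_single, preH, Finsupp.linearCombination_single, preH,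
        Finsupp.linearCombination_single, termH]
      simp only [one_smul, smul_add]
      rw [smul_comm (sg K a.1) v, smul_comm (sg K a.1) u]

theorem preH_perm_comp {p r q : ℕ} {a c a' c' : ℤ × ℕ} (h : 0 + a = c) (ha : a + (-1, 0) = a')
    (hc : c + (-1, 0) = c') (h₁ : 0 + a' = c') (σ : Fin r ≃ Fin p) (x : Pre E wt r q a) :
    preH T hc (Pre.comp h (Pre.perm σ) x) =
      (freeProp E wt).comp h₁ ((freeProp E wt).perm σ) (preH T ha x) := by
  rw [preH_comp T h rfl ha hc (by rw [← hc, ← h]; abel) h₁, preH_perm]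
  simp [freeMk_perm]

theorem preH_comp_perm {p r q : ℕ} {a c a' c' : ℤ × ℕ} (h : a + 0 = c) (ha : a + (-1, 0) = a')
    (hc : c + (-1, 0) = c') (h₁ : a' + 0 = c') (x : Pre E wt p r a) (σ : Fin q ≃ Fin r) :
    preH T hc (Pre.comp h x (Pre.perm σ)) =
      (freeProp E wt).comp h₁ (preH T ha x) ((freeProp E wt).perm σ) := by
  rw [preH_comp T h ha rfl hc h₁ (by rw [← hc, ← h]; abel), preH_perm]
  simp [freeMk_perm]

/-- Koszul signs depend only on the parity of degrees, so an odd derivation of degree -1 respects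
the axioms just as the differential does. Signs have to be compared only for associativity,
interchange and symmetry. -/
theorem preH_rel {p q : ℕ} {a b : ℤ × ℕ} (h : a + (-1, 0) = b) {x : Pre E wt p q a}
    (hx : Rel x) : preH T h x = 0 := by
  induction hx generalizing b with
  | zero => simp
  | add _ _ ih ih' => simp [ih, ih']
  | smul c _ ih => simp [ih]
  | comp_left h' y hx ih =>
    rw [preH_comp T h' rfl rfl h (by rw [← h, ← h']; abel) (by rw [← h, ← h']; abel), ih,
      freeMk_eq_zero hx]
    simp
  | comp_right h' y hx ih =>
    rw [preH_comp T h' rfl rfl h (by rw [← h, ← h']; abel) (by rw [← h, ← h']; abel), ih,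
      freeMk_eq_zero hx]
    simp
  | tensor_left h' y hx ih =>
    rw [preH_tensor T h' rfl rfl h (by rw [← h, ← h']; abel) (by rw [← h, ← h']; abel), ih,
      freeMk_eq_zero hx]
    simp
  | tensor_right h' y hx ih =>
    rw [preH_tensor T h' rfl rfl h (by rw [← h, ← h']; abel) (by rw [← h, ← h']; abel), ih,
      freeMk_eq_zero hx]
    simp
  | gen_add e e' =>
    subst h
    rw [map_sub, map_add, preH_gen T rfl, preH_gen T rfl, preH_gen T rfl]
    simp
  | gen_smul c e =>
    subst h
    rw [map_sub, map_smul, preH_gen T rfl, preH_gen T rfl]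
    simp
  | @gen_act p q k σ τ e =>
    subst h
    rw [map_sub, preH_perm_comp T _ rfl _ (zero_add _), preH_comp_perm T _ rfl _ (add_zero _)]
    rw [preH_gen T rfl, preH_gen T rfl, T.h_act, freeGen_act, sub_self]
  | perm_comp_perm σ τ =>
    subst h
    rw [map_sub, preH_perm, preH_perm_comp T _ rfl _ (zero_add _), preH_perm]
    simp
  | id_comp x =>
    subst h
    rw [map_sub, preH_perm_comp T _ rfl _ (zero_add _), GradedProp.id_comp, sub_self]
  | comp_id x =>
    subst h
    rw [map_sub, preH_comp_perm T _ rfl _ (add_zero _), GradedProp.comp_id, sub_self]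
  | @comp_assoc p r s q a b c ab bc abc h₁ h₂ h₃ h₄ x y z =>
    subst h h₁ h₂ h₃
    rw [map_sub, sub_eq_zero, preH_comp T _ rfl rfl _ (by abel) (by abel),
      preH_comp T _ rfl rfl _ (by abel) (by abel),
      preH_comp T _ rfl rfl _ (by abel) (by abel),
      preH_comp T _ rfl rfl _ (by abel) (by abel)]
    simp only [map_add, map_smul, LinearMap.add_apply, LinearMap.smul_apply, freeMk_comp, smul_add,
      smul_smul, Prod.fst_add, sg_add]
    rw [GradedProp.comp_assoc _ _ _ rfl (by abel),
      GradedProp.comp_assoc (bc := b + c + (-1, 0)) _ _ _ (by abel) (by abel),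
      GradedProp.comp_assoc (bc := b + c + (-1, 0)) _ _ _ (by abel) (by abel)]
    abel
  | perm_tensor_perm σ τ =>
    subst h
    rw [map_sub, preH_perm, preH_tensor T _ rfl rfl _ (by abel) (by abel), preH_perm, preH_perm]
    simp
  | @tensor_assoc p q p' q' p'' q'' a b c ab bc abc h₁ h₂ h₃ h₄ x y z =>
    subst h h₁ h₂ h₃
    rw [map_sub, sub_eq_zero, preH_perm_comp T _ rfl _ (zero_add _),
      preH_comp_perm T _ rfl _ (add_zero _), preH_tensor T _ rfl rfl _ (by abel) (by abel),
      preH_tensor T _ rfl rfl _ (by abel) (by abel),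
      preH_tensor T _ rfl rfl _ (by abel) (by abel),
      preH_tensor T _ rfl rfl _ (by abel) (by abel)]
    simp only [map_add, map_smul, LinearMap.add_apply, LinearMap.smul_apply, freeMk_tensor,
      smul_add, smul_smul, Prod.fst_add, sg_add]
    rw [GradedProp.tensor_assoc _ _ _ rfl (by abel),
      GradedProp.tensor_assoc (bc := b + c + (-1, 0)) _ _ _ (by abel) (by abel),
      GradedProp.tensor_assoc (bc := b + c + (-1, 0)) _ _ _ (by abel) (by abel)]
    abel
  | unit_tensor x =>
    subst h
    rw [map_sub, preH_perm_comp T _ rfl _ (zero_add _), preH_comp_perm T _ rfl _ (add_zero _),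
      preH_tensor T _ rfl rfl _ (by abel) (by abel), preH_perm]
    simp only [map_zero, LinearMap.zero_apply, zero_add, Prod.fst_zero, sg_zero, one_smul]
    exact sub_eq_zero.2 (GradedProp.unit_tensor _ _)
  | tensor_unit x =>
    subst h
    rw [map_sub, preH_perm_comp T _ rfl _ (zero_add _), preH_comp_perm T _ rfl _ (add_zero _),
      preH_tensor T _ rfl rfl _ (by abel) (by abel), preH_perm]
    simp only [map_zero, smul_zero, add_zero]
    exact sub_eq_zero.2 (GradedProp.tensor_unit _ _)
  | @interchange p r q p' r' q' a a' b b' aa bb ab ab' c h₁ h₂ h₃ h₄ h₅ h₆ x x' y y' =>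
    subst h h₁ h₂ h₃ h₄ h₅
    rw [map_sub, sub_eq_zero, map_smul, preH_comp T _ rfl rfl _ (by abel) (by abel),
      preH_tensor T _ rfl rfl _ (by abel) (by abel),
      preH_tensor T _ rfl rfl _ (by abel) (by abel),
      preH_tensor T _ rfl rfl _ (by abel) (by abel),
      preH_comp T _ rfl rfl _ (by abel) (by abel),
      preH_comp T _ rfl rfl _ (by abel) (by abel)]
    simp only [map_add, map_smul, LinearMap.add_apply, LinearMap.smul_apply, freeMk_tensor,
      freeMk_comp, smul_add, smul_smul, Prod.fst_add]
    rw [GradedProp.interchange (ab := a + b + (-1, 0)) (ab' := a' + b') _ _ _ (by abel) (by abel)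
        ?_,
      GradedProp.interchange (ab := a + b) (ab' := a' + b' + (-1, 0)) _ _ _ (by abel) (by abel)
        ?_,
      GradedProp.interchange (ab := a + b + (-1, 0)) (ab' := a' + b') _ _ _ (by abel) (by abel)
        ?_,
      GradedProp.interchange (ab := a + b) (ab' := a' + b' + (-1, 0)) _ _ _ (by abel) (by abel)
        ?_]
    · simp only [smul_smul, AddMonoidHom.coe_fst, Prod.fst_add, ← sg_add, mul_add, add_mul]
      -- Applying the derivation to one factor changes the sign of the exchange of a' and b by the
      -- degree of the other; this makes up for the Leibniz sign, modulo 2.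
      rw [sg_congr K (m := a.1 + (a'.1 * b.1 + -1 * b.1))
          (n := a'.1 * b.1 + (a.1 + b.1)) ⟨-b.1, by ring⟩,
        sg_congr K (m := a.1 + a'.1 + (a'.1 * b.1 + a'.1 * -1)) (n := a'.1 * b.1 + a.1)
          ⟨0, by ring⟩,
        sg_congr K (m := a.1 + a'.1 + b.1 + a'.1 * b.1) (n := a'.1 * b.1 + (a.1 + b.1 + a'.1))
          ⟨0, by ring⟩]
      exact add_add_add_comm _ _ _ _
  | @symmetry p q p' q' a b c h₁ h₂ x y =>
    subst h h₁
    rw [map_sub, sub_eq_zero, map_smul, preH_perm_comp T _ rfl _ (zero_add _),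
      preH_comp_perm T _ rfl _ (add_zero _), preH_tensor T _ rfl rfl _ (by abel) (by abel),
      preH_tensor T _ rfl rfl _ (by rw [← h₂]; abel) (by rw [← h₂]; abel)]
    simp only [map_add, map_smul, LinearMap.add_apply, LinearMap.smul_apply,
      smul_add, smul_smul]
    rw [GradedProp.symmetry _ _ (by rw [← h₂]; abel), GradedProp.symmetry _ _ (by rw [← h₂]; abel)]
    simp only [smul_smul, AddMonoidHom.coe_fst, Prod.fst_add, ← sg_add, mul_add, add_mul]
    rw [sg_congr K (m := a.1 + (a.1 * b.1 + a.1 * -1)) (n := a.1 * b.1) ⟨0, by ring⟩,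
      sg_congr K (m := a.1 * b.1 + -1 * b.1) (n := a.1 * b.1 + b.1) ⟨-b.1, by ring⟩]
    abel

variable (wt) in
/-- The derivation of the free prop induced by a map of degree `-1` on the generators. -/
def freeHtpy {p q : ℕ} {a b : ℤ × ℕ} (h : a + (-1, 0) = b) :
    (freeProp E wt).Hom p q a →ₗ[K] (freeProp E wt).Hom p q b :=
  (relations E wt p q a).liftQ (preH T h) fun _ hx => preH_rel T h hx

theorem freeHtpy_gen {p q : ℕ} {k l : ℤ} (h : k + -1 = l)
    (h' : (k, wt p q) + (-1, 0) = (l, wt p q)) (e : E.V p q k) :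
    freeHtpy wt T h' (freeGen wt e) = freeGen wt (T.h h e) :=
  preH_gen T h h' e

theorem freeHtpy_perm {p q : ℕ} {b : ℤ × ℕ} (h : 0 + (-1, 0) = b) (σ : Fin q ≃ Fin p) :
    freeHtpy wt T h ((freeProp E wt).perm σ) = 0 :=
  preH_perm T h σ

theorem freeHtpy_comp {p r q : ℕ} {a b c a' b' c' : ℤ × ℕ} (h : a + b = c)
    (ha : a + (-1, 0) = a') (hb : b + (-1, 0) = b') (hc : c + (-1, 0) = c') (h₁ : a' + b = c')
    (h₂ : a + b' = c') (f : (freeProp E wt).Hom p r a) (g : (freeProp E wt).Hom r q b) :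
    freeHtpy wt T hc ((freeProp E wt).comp h f g) =
      (freeProp E wt).comp h₁ (freeHtpy wt T ha f) g +
        sg K a.1 • (freeProp E wt).comp h₂ f (freeHtpy wt T hb g) := by
  obtain ⟨x, rfl⟩ := freeMk_surjective f
  obtain ⟨y, rfl⟩ := freeMk_surjective g
  rw [← freeMk_comp]
  exact preH_comp T h ha hb hc h₁ h₂ x y

theorem freeHtpy_tensor {p q p' q' : ℕ} {a b c a' b' c' : ℤ × ℕ} (h : a + b = c)
    (ha : a + (-1, 0) = a') (hb : b + (-1, 0) = b') (hc : c + (-1, 0) = c') (h₁ : a' + b = c')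
    (h₂ : a + b' = c') (f : (freeProp E wt).Hom p q a) (g : (freeProp E wt).Hom p' q' b) :
    freeHtpy wt T hc ((freeProp E wt).tensor h f g) =
      (freeProp E wt).tensor h₁ (freeHtpy wt T ha f) g +
        sg K a.1 • (freeProp E wt).tensor h₂ f (freeHtpy wt T hb g) := by
  obtain ⟨x, rfl⟩ := freeMk_surjective f
  obtain ⟨y, rfl⟩ := freeMk_surjective g
  rw [← freeMk_tensor]
  exact preH_tensor T h ha hb hc h₁ h₂ x y

end Lowering

/-! ### The Euler operator of a contraction -/

section Euler

variable {K : Type u} [Field K] {E : SBimodule K} {wt : ℕ → ℕ → ℕ}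
  (D : E.Differential) (T : E.LoweringMap)

theorem lower_raise (a : ℤ × ℕ) : a + (-1, 0) + (1, 0) = a := by
  simp [add_assoc]

theorem raise_lower (a : ℤ × ℕ) : a + (1, 0) + (-1, 0) = a := by
  simp [add_assoc]

variable (wt) in
/-- The graded commutator of the derivations extending a differential and a map of degree `-1`. -/
def euler {p q : ℕ} {a : ℤ × ℕ} : (freeProp E wt).Hom p q a →ₗ[K] (freeProp E wt).Hom p q a :=
  freeDiff wt D (lower_raise a) ∘ₗ freeHtpy wt T rfl +
    freeHtpy wt T (raise_lower a) ∘ₗ freeDiff wt D rfl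

/-- This frees the intermediate degrees from the particular expressions chosen in the definition. -/
theorem euler_apply {p q : ℕ} {a b b' : ℤ × ℕ} (h : a + (-1, 0) = b) (h' : b + (1, 0) = a)
    (h'' : a + (1, 0) = b') (h''' : b' + (-1, 0) = a) (f : (freeProp E wt).Hom p q a) :
    euler wt D T f =
      freeDiff wt D h' (freeHtpy wt T h f) + freeHtpy wt T h''' (freeDiff wt D h'' f) := by
  subst h h''
  rfl

theorem euler_gen {p q : ℕ} {k l m : ℤ} (h : k + -1 = l) (h' : l + 1 = k) (h'' : k + 1 = m)
    (h''' : m + -1 = k) (e : E.V p q k) :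
    euler wt D T (freeGen wt e) = freeGen wt (D.d h' (T.h h e) + T.h h''' (D.d h'' e)) := by
  rw [euler_apply D T (a := (k, wt p q)) (b := (l, wt p q)) (b' := (m, wt p q)) (Prod.ext h rfl)
    (Prod.ext h' rfl)
    (Prod.ext h'' rfl) (Prod.ext h''' rfl), freeHtpy_gen T h, map_add]
  have key : ∀ {k l : ℤ} (h : k + 1 = l) (e : E.V p q k), freeDiff wt D
      (Prod.ext h rfl : (k, wt p q) + (1, 0) = (l, wt p q)) (freeGen wt e) =
        freeGen wt (D.d h e) := fun h e => preD_gen D h _ e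
  rw [key h', key h'', freeHtpy_gen T h''']

theorem euler_perm {p q : ℕ} (σ : Fin q ≃ Fin p) :
    euler wt D T ((freeProp E wt).perm σ) = 0 := by
  have : freeDiff wt D (rfl : (0 : ℤ × ℕ) + (1, 0) = _) ((freeProp E wt).perm σ) = 0 :=
    preD_perm D _ σ
  rw [euler_apply D T rfl (lower_raise 0) rfl (raise_lower 0), freeHtpy_perm, this, map_zero,
    map_zero, add_zero]

theorem sg_lower (n : ℤ) : sg K (n + -1) = -sg K n := by
  rw [← sg_succ]
  exact sg_congr K ⟨-1, by ring⟩

/-- The commutator of two odd derivations is an even derivation: the mixed terms, with the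
differential on one factor and the homotopy on the other, occur twice with opposite signs. -/
theorem euler_comp {p r q : ℕ} {a b c : ℤ × ℕ} (h : a + b = c) (f : (freeProp E wt).Hom p r a)
    (g : (freeProp E wt).Hom r q b) :
    euler wt D T ((freeProp E wt).comp h f g) =
      (freeProp E wt).comp h (euler wt D T f) g + (freeProp E wt).comp h f (euler wt D T g) := by
  subst h
  have e₁ : a + (-1, 0) + b = a + b + (-1, 0) := by abel
  have e₂ : a + (1, 0) + b = a + b + (1, 0) := by abel
  have e₃ : a + (b + (-1, 0)) = a + b + (-1, 0) := by abel
  have e₄ : a + (b + (1, 0)) = a + b + (1, 0) := by abel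
  have e₅ : a + (-1, 0) + (b + (1, 0)) = a + b := by
    rw [← lower_raise (a + b)]; abel
  have e₆ : a + (1, 0) + (b + (-1, 0)) = a + b := by
    rw [← lower_raise (a + b)]; abel
  rw [euler_apply D T rfl (lower_raise _) rfl (raise_lower _),
    euler_apply D T rfl (lower_raise a) rfl (raise_lower a),
    euler_apply D T rfl (lower_raise b) rfl (raise_lower b),
    freeHtpy_comp T rfl rfl rfl rfl e₁ e₃, freeDiff_comp D rfl rfl rfl rfl e₂ e₄]
  simp only [map_add, map_smul]
  rw [freeDiff_comp D e₁ (lower_raise a) rfl (lower_raise _) rfl e₅,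
    freeDiff_comp D e₃ rfl (lower_raise b) (lower_raise _) e₆ rfl,
    freeHtpy_comp T e₂ (raise_lower a) rfl (raise_lower _) rfl e₆,
    freeHtpy_comp T e₄ rfl (raise_lower b) (raise_lower _) e₅ rfl]
  simp only [Prod.fst_add, sg_lower, sg_succ, smul_add, smul_smul, sg_mul_self, one_smul, neg_smul,
    LinearMap.add_apply]
  abel

/-- The mixed terms cancel as in `euler_comp`. -/
theorem euler_tensor {p q p' q' : ℕ} {a b c : ℤ × ℕ} (h : a + b = c)
    (f : (freeProp E wt).Hom p q a) (g : (freeProp E wt).Hom p' q' b) :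
    euler wt D T ((freeProp E wt).tensor h f g) =
      (freeProp E wt).tensor h (euler wt D T f) g +
        (freeProp E wt).tensor h f (euler wt D T g) := by
  subst h
  have e₁ : a + (-1, 0) + b = a + b + (-1, 0) := by abel
  have e₂ : a + (1, 0) + b = a + b + (1, 0) := by abel
  have e₃ : a + (b + (-1, 0)) = a + b + (-1, 0) := by abel
  have e₄ : a + (b + (1, 0)) = a + b + (1, 0) := by abel
  have e₅ : a + (-1, 0) + (b + (1, 0)) = a + b := by
    rw [← lower_raise (a + b)]; abel
  have e₆ : a + (1, 0) + (b + (-1, 0)) = a + b := by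
    rw [← lower_raise (a + b)]; abel
  rw [euler_apply D T rfl (lower_raise _) rfl (raise_lower _),
    euler_apply D T rfl (lower_raise a) rfl (raise_lower a),
    euler_apply D T rfl (lower_raise b) rfl (raise_lower b),
    freeHtpy_tensor T rfl rfl rfl rfl e₁ e₃, freeDiff_tensor D rfl rfl rfl rfl e₂ e₄]
  simp only [map_add, map_smul]
  rw [freeDiff_tensor D e₁ (lower_raise a) rfl (lower_raise _) rfl e₅,
    freeDiff_tensor D e₃ rfl (lower_raise b) (lower_raise _) e₆ rfl,
    freeHtpy_tensor T e₂ (raise_lower a) rfl (raise_lower _) rfl e₆,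
    freeHtpy_tensor T e₄ rfl (raise_lower b) (raise_lower _) e₅ rfl]
  simp only [Prod.fst_add, sg_lower, sg_succ, smul_add, smul_smul, sg_mul_self, one_smul, neg_smul,
    LinearMap.add_apply]
  abel

end Euler

/-! ### Maps of free props that shift the weight -/

section Regrade

variable {K : Type u} [Field K] {E F : SBimodule K}

/-- A morphism of `S`-bimodules. -/
structure SBimodule.Morphism (E F : SBimodule K) where
  map : ∀ {p q : ℕ} {k : ℤ}, E.V p q k →ₗ[K] F.V p q k
  map_act : ∀ {p q : ℕ} {k : ℤ} (σ : Equiv.Perm (Fin p)) (τ : Equiv.Perm (Fin q))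
    (e : E.V p q k), map (E.act σ τ e) = F.act σ τ (map e)

/-- A morphism of `S`-bimodules, as a map into the completed free prop. -/
def SBimodule.Morphism.toCompletion (φ : E.Morphism F) (wt : ℕ → ℕ → ℕ) :
    E.ToProp (completion (freeProp F wt)) where
  map {p q k} := LinearMap.single K (fun w => (freeProp F wt).Hom p q (k, w)) (wt p q) ∘ₗ
    freeGen wt ∘ₗ φ.map
  map_act {p q k} σ τ e := by
    funext w
    change Pi.single (M := fun w => (freeProp F wt).Hom p q (k, w)) _ _ w =
      complComp _ (zero_add _) (complPerm _ σ) (complComp _ (add_zero _) (Pi.single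
        (M := fun w => (freeProp F wt).Hom p q (k, w)) _ _) (complPerm _ τ)) w
    rw [complPerm_comp, complComp_perm]
    rcases eq_or_ne w (wt p q) with rfl | hw
    · rw [Pi.single_eq_same, Pi.single_eq_same]
      exact (congrArg _ (φ.map_act σ τ e)).trans (freeGen_act σ τ (φ.map e))
    · rw [Pi.single_eq_of_ne hw, Pi.single_eq_of_ne hw]
      simp

/-- When the left factor lives in a single weight, the convolution over all splittings of the weight
has a single summand. -/
theorem complComp_of_support (P : GradedProp K (AddMonoidHom.fst ℤ ℕ)) {p r q : ℕ} {a b c : ℤ}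
    (h : a + b = c) {f : ComplHom P p r a} {g : ComplHom P r q b} {u v w : ℕ} (huv : u + v = w)
    (hf : ∀ u', u' ≠ u → f u' = 0) :
    complComp P h f g w = P.comp (Prod.ext h huv : (a, u) + (b, v) = (c, w)) (f u) (g v) := by
  subst huv
  rw [complComp_apply, Fintype.sum_eq_single ⟨(u, v), by simp⟩]
  rintro ⟨⟨u', v'⟩, h'⟩ hx
  have : u' ≠ u := by
    rintro rfl
    simp at h'
    simp [h'] at hx
  simp [hf u' this]

theorem complTensor_of_support (P : GradedProp K (AddMonoidHom.fst ℤ ℕ)) {p q p' q' : ℕ}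
    {a b c : ℤ} (h : a + b = c) {f : ComplHom P p q a} {g : ComplHom P p' q' b} {u v w : ℕ}
    (huv : u + v = w) (hf : ∀ u', u' ≠ u → f u' = 0) :
    complTensor P h f g w = P.tensor (Prod.ext h huv : (a, u) + (b, v) = (c, w)) (f u) (g v) := by
  subst huv
  rw [complTensor_apply, Fintype.sum_eq_single ⟨(u, v), by simp⟩]
  rintro ⟨⟨u', v'⟩, h'⟩ hx
  have : u' ≠ u := by
    rintro rfl
    simp at h'
    simp [h'] at hx
  simp [hf u' this]

variable (wt wt' : ℕ → ℕ → ℕ) (φ : E.Morphism F)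

/-- The map of free props induced by a morphism of `S`-bimodules. -/
def freeMap {p q : ℕ} {k : ℤ} {w : ℕ} :
    (freeProp E wt).Hom p q (k, w) →ₗ[K] ComplHom (freeProp F wt') p q k :=
  freeLift wt (φ.toCompletion wt')

variable {wt wt'}

theorem freeMap_gen {p q : ℕ} {k : ℤ} (e : E.V p q k) :
    freeMap wt wt' φ (freeGen wt e) = Pi.single (wt' p q) (freeGen wt' (φ.map e)) :=
  freeLift_gen _ e

theorem freeMap_comp {p r q : ℕ} {a b c : ℤ} {u v w : ℕ} (h : (a, u) + (b, v) = (c, w))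
    (f : (freeProp E wt).Hom p r (a, u)) (g : (freeProp E wt).Hom r q (b, v)) :
    freeMap wt wt' φ ((freeProp E wt).comp h f g) =
      complComp _ (congrArg Prod.fst h) (freeMap wt wt' φ f) (freeMap wt wt' φ g) :=
  freeLift_comp _ h f g

theorem freeMap_tensor {p q p' q' : ℕ} {a b c : ℤ} {u v w : ℕ} (h : (a, u) + (b, v) = (c, w))
    (f : (freeProp E wt).Hom p q (a, u)) (g : (freeProp E wt).Hom p' q' (b, v)) :
    freeMap wt wt' φ ((freeProp E wt).tensor h f g) =
      complTensor _ (congrArg Prod.fst h) (freeMap wt wt' φ f) (freeMap wt wt' φ g) :=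
  freeLift_tensor _ h f g

theorem freeMap_perm {p q : ℕ} (σ : Fin q ≃ Fin p) :
    freeMap wt wt' φ (k := 0) (w := 0) ((freeProp E wt).perm σ) = complPerm _ σ :=
  freeLift_perm _ σ

/-- The expected weights x and y are integers because they will be weights shifted by a degree. If
one of them is negative, the hypothesis says that the factor vanishes. -/
theorem complComp_support (P : GradedProp K (AddMonoidHom.fst ℤ ℕ)) {p r q : ℕ} {a b c : ℤ}
    (h : a + b = c) {f : ComplHom P p r a} {g : ComplHom P r q b} {x y : ℤ}
    (hf : ∀ u : ℕ, (u : ℤ) ≠ x → f u = 0) (hg : ∀ u : ℕ, (u : ℤ) ≠ y → g u = 0) (w : ℕ)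
    (hw : (w : ℤ) ≠ x + y) : complComp P h f g w = 0 := by
  rw [complComp_apply]
  refine Finset.sum_eq_zero ?_
  rintro ⟨⟨u, v⟩, h'⟩ -
  simp only [HasAntidiagonal.mem_antidiagonal] at h'
  by_cases hu : (u : ℤ) = x
  · rw [hg v (by omega), map_zero]
  · simp [hf u hu]

theorem complTensor_support (P : GradedProp K (AddMonoidHom.fst ℤ ℕ)) {p q p' q' : ℕ} {a b c : ℤ}
    (h : a + b = c) {f : ComplHom P p q a} {g : ComplHom P p' q' b} {x y : ℤ}
    (hf : ∀ u : ℕ, (u : ℤ) ≠ x → f u = 0) (hg : ∀ u : ℕ, (u : ℤ) ≠ y → g u = 0) (w : ℕ)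
    (hw : (w : ℤ) ≠ x + y) : complTensor P h f g w = 0 := by
  rw [complTensor_apply]
  refine Finset.sum_eq_zero ?_
  rintro ⟨⟨u, v⟩, h'⟩ -
  simp only [HasAntidiagonal.mem_antidiagonal] at h'
  by_cases hu : (u : ℤ) = x
  · rw [hg v (by omega), map_zero]
  · simp [hf u hu]

/-- If the weights of generators differ by a multiple of the degree, then so do the weights of
all elements. -/
theorem freeMap_support {ε : ℤ}
    (hε : ∀ {p q : ℕ} {k : ℤ} (e : E.V p q k), (wt' p q : ℤ) = wt p q + ε * k ∨ φ.map e = 0)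
    {p q : ℕ} {a : ℤ × ℕ} (f : (freeProp E wt).Hom p q a) :
    ∀ u : ℕ, (u : ℤ) ≠ a.2 + ε * a.1 → freeMap wt wt' φ (k := a.1) (w := a.2) f u = 0 := by
  refine freeProp_induction (motive := fun {p q a} f => ∀ u : ℕ, (u : ℤ) ≠ a.2 + ε * a.1 →
    freeMap wt wt' φ (k := a.1) (w := a.2) f u = 0) ?_ ?_ ?_ ?_ ?_ ?_ ?_ f
  · intros; simp
  · intro p q a f g hf hg u hu
    rw [map_add, Pi.add_apply, hf u hu, hg u hu, add_zero]
  · intro p q a c f hf u hu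
    rw [map_smul, Pi.smul_apply, hf u hu, smul_zero]
  · intro p q k e u hu
    rw [freeMap_gen]
    rcases hε e with h | h
    · rw [Pi.single_eq_of_ne]
      rintro rfl
      exact hu h
    · rw [h, map_zero, Pi.single_zero, Pi.zero_apply]
  · intro p q σ u hu
    rw [freeMap_perm, complPerm_of_ne]
    rintro rfl
    simp at hu
  · intro p r q a b c h f g hf hg u hu
    subst h
    rw [freeMap_comp]
    refine complComp_support _ _ hf hg u ?_
    simp only [Prod.fst_add, Prod.snd_add] at hu
    push_cast at hu
    convert hu using 1
    ring
  · intro p q p' q' a b c h f g hf hg u hu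
    subst h
    rw [freeMap_tensor]
    refine complTensor_support _ _ hf hg u ?_
    simp only [Prod.fst_add, Prod.snd_add] at hu
    push_cast at hu
    convert hu using 1
    ring

end Regrade

/-! ### The cohomology of a free prop -/

section Kunneth

variable {K : Type u} [Field K] {E L : SBimodule K}

/-- A contraction of a dg `S`-bimodule `E` onto an `S`-bimodule `L` without differential. -/
structure SBimodule.Contraction (D : E.Differential) (L : SBimodule K) where
  i : L.Morphism E
  r : E.Morphism L
  T : E.LoweringMap
  r_i : ∀ {p q : ℕ} {k : ℤ} (e : L.V p q k), r.map (i.map e) = e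
  d_i : ∀ {p q : ℕ} {k l : ℤ} (h : k + 1 = l) (e : L.V p q k), D.d h (i.map e) = 0
  r_d : ∀ {p q : ℕ} {k l : ℤ} (h : k + 1 = l) (e : E.V p q k), r.map (D.d h e) = 0
  htpy : ∀ {p q : ℕ} {k l m : ℤ} (h : k + -1 = l) (h' : l + 1 = k) (h'' : k + 1 = m)
    (h''' : m + -1 = k) (e : E.V p q k),
    D.d h' (T.h h e) + T.h h''' (D.d h'' e) = e - i.map (r.map e)

theorem compl_smul_zero (P : GradedProp K (AddMonoidHom.fst ℤ ℕ)) {p q : ℕ} {k : ℤ} (c : K) :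
    c • (0 : ComplHom P p q k) = 0 := by
  funext w
  simp

variable {D : E.Differential} (C : SBimodule.Contraction D L) (wt wt' : ℕ → ℕ → ℕ)

/-- Generators of L go to cocycles by `C.d_i`, and cocycles are closed under both compositions by
the Leibniz rule. -/
theorem complD_freeMap {p q : ℕ} {a : ℤ × ℕ} (f : (freeProp L wt).Hom p q a) :
    ∀ {b : ℤ} (h : a.1 + 1 = b), complD (freeDifferential wt' D) h
      (freeMap wt wt' C.i (k := a.1) (w := a.2) f) = 0 := by
  refine freeProp_induction (motive := fun {p q a} f => ∀ {b : ℤ} (h : a.1 + 1 = b),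
    complD (freeDifferential wt' D) h (freeMap wt wt' C.i (k := a.1) (w := a.2) f) = 0)
    ?_ ?_ ?_ ?_ ?_ ?_ ?_ f
  · intros; simp
  · intro p q a f g hf hg b h
    rw [map_add, map_add, hf, hg, add_zero]
  · intro p q a c f hf b h
    rw [map_smul, map_smul, hf]
    exact compl_smul_zero _ c
  · intro p q k e b h
    rw [freeMap_gen]
    funext w
    rw [complD_apply]
    rcases eq_or_ne w (wt' p q) with rfl | hw
    · rw [Pi.single_eq_same]
      refine (preD_gen D h _ _).trans ?_
      rw [C.d_i, map_zero, Pi.zero_apply]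
    · rw [Pi.single_eq_of_ne hw, map_zero, Pi.zero_apply]
  · intro p q σ b h
    rw [freeMap_perm]
    exact (completionDifferential (freeDifferential wt' D)).d_perm h σ
  · intro p r q a b c h f g hf hg m hm
    subst h hm
    rw [freeMap_comp, complD_comp _ _ rfl rfl _ (by simp; ring) (by simp; ring), hf, hg,
      map_zero, map_zero, LinearMap.zero_apply, zero_add]
    exact compl_smul_zero _ _
  · intro p q p' q' a b c h f g hf hg m hm
    subst h hm
    rw [freeMap_tensor, complD_tensor _ _ rfl rfl _ (by simp; ring) (by simp; ring), hf, hg,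
      map_zero, map_zero, LinearMap.zero_apply, zero_add]
    exact compl_smul_zero _ _

/-- The differential followed by the map induced by r is a derivation along that map. It vanishes on
generators by `C.r_d`, hence everywhere; this is what makes r kill coboundaries. -/
theorem freeMap_freeDiff {p q : ℕ} {a : ℤ × ℕ} (f : (freeProp E wt').Hom p q a) :
    ∀ {b : ℤ × ℕ} (h : a + (1, 0) = b),
      freeMap wt' wt C.r (k := b.1) (w := b.2) (freeDiff wt' D h f) = 0 := by
  refine freeProp_induction (motive := fun {p q a} f => ∀ {b : ℤ × ℕ} (h : a + (1, 0) = b),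
      freeMap wt' wt C.r (k := b.1) (w := b.2) (freeDiff wt' D h f) = 0) ?_ ?_ ?_ ?_ ?_ ?_ ?_ f
  · intros; simp
  · intro p q a f g hf hg b h
    rw [map_add, map_add, hf, hg, add_zero]
  · intro p q a c f hf b h
    rw [map_smul, map_smul, hf]
    exact compl_smul_zero _ c
  · intro p q k e b h
    subst h
    have : freeDiff wt' D (rfl : (k, wt' p q) + (1, 0) = _) (freeGen wt' e) =
        freeGen wt' (D.d rfl e) := preD_gen D rfl _ e
    rw [this]
    refine (freeMap_gen C.r _).trans ?_
    rw [C.r_d, map_zero, Pi.single_zero]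
  · intro p q σ b h
    have : freeDiff wt' D h ((freeProp E wt').perm σ) = 0 := preD_perm D _ σ
    rw [this, map_zero]
  · intro p r q a b c h f g hf hg m hm
    subst h hm
    rw [freeDiff_comp D rfl rfl rfl rfl (by abel) (by abel), map_add, map_smul]
    have h₁ := freeMap_comp (wt' := wt) C.r (add_right_comm a (1, 0) b)
      (freeDiff wt' D rfl f) g
    have h₂ := freeMap_comp (wt' := wt) C.r (add_assoc a b (1, 0)).symm
      f (freeDiff wt' D rfl g)
    erw [hf rfl, map_zero, LinearMap.zero_apply] at h₁
    erw [hg rfl, map_zero] at h₂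
    refine (congrArg₂ (· + sg K a.1 • ·) h₁ h₂).trans ?_
    rw [zero_add]
    exact compl_smul_zero _ _
  · intro p q p' q' a b c h f g hf hg m hm
    subst h hm
    rw [freeDiff_tensor D rfl rfl rfl rfl (by abel) (by abel), map_add, map_smul]
    have h₁ := freeMap_tensor (wt' := wt) C.r (add_right_comm a (1, 0) b)
      (freeDiff wt' D rfl f) g
    have h₂ := freeMap_tensor (wt' := wt) C.r (add_assoc a b (1, 0)).symm
      f (freeDiff wt' D rfl g)
    erw [hf rfl, map_zero, LinearMap.zero_apply] at h₁
    erw [hg rfl, map_zero] at h₂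
    refine (congrArg₂ (· + sg K a.1 • ·) h₁ h₂).trans ?_
    rw [zero_add]
    exact compl_smul_zero _ _

/-- The homotopy identity of the contraction, read in the free prop: a generator in the image of i
has eigenvalue 0, one in the kernel of r has eigenvalue 1. -/
theorem euler_freeGen {p q : ℕ} {k : ℤ} (e : E.V p q k) :
    euler wt D C.T (freeGen wt e) = freeGen wt (e - C.i.map (C.r.map e)) := by
  rw [euler_gen D C.T rfl (by ring) rfl (by ring), C.htpy]

/-- A derivation that kills the generators i(e) kills everything composed from them; here r i = 1
enters. -/
theorem euler_freeMap {p q : ℕ} {a : ℤ × ℕ} (f : (freeProp L wt).Hom p q a) :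
    ∀ w, euler wt' D C.T (freeMap wt wt' C.i (k := a.1) (w := a.2) f w) = 0 := by
  refine freeProp_induction (motive := fun {p q a} f => ∀ w,
    euler wt' D C.T (freeMap wt wt' C.i (k := a.1) (w := a.2) f w) = 0) ?_ ?_ ?_ ?_ ?_ ?_ ?_ f
  · intros; simp
  · intro p q a f g hf hg w
    rw [map_add, Pi.add_apply, map_add, hf, hg, add_zero]
  · intro p q a c f hf w
    rw [map_smul, Pi.smul_apply, map_smul, hf, smul_zero]
  · intro p q k e w
    rw [freeMap_gen]
    rcases eq_or_ne w (wt' p q) with rfl | hw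
    · rw [Pi.single_eq_same]
      refine (euler_freeGen C wt' _).trans ?_
      rw [C.r_i, sub_self, map_zero]
    · rw [Pi.single_eq_of_ne hw, map_zero]
  · intro p q σ w
    rw [freeMap_perm]
    rcases eq_or_ne w 0 with rfl | hw
    · rw [complPerm_zero]
      exact euler_perm D C.T σ
    · rw [complPerm_of_ne _ _ hw, map_zero]
  · intro p r q a b c h f g hf hg w
    subst h
    rw [freeMap_comp, complComp_apply, map_sum]
    refine Finset.sum_eq_zero fun x _ => ?_
    rw [euler_comp, hf, hg]
    simp
  · intro p q p' q' a b c h f g hf hg w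
    subst h
    rw [freeMap_tensor, complTensor_apply, map_sum]
    refine Finset.sum_eq_zero fun x _ => ?_
    rw [euler_tensor, hf, hg]
    simp

/-- The weights `wt` and `wt'` differ by the degree on the generators in `L`. -/
def WeightShift (L : SBimodule K) (wt wt' : ℕ → ℕ → ℕ) : Prop :=
  ∀ {p q : ℕ} {k : ℤ} (e : L.V p q k), (wt p q : ℤ) = wt' p q + k ∨ e = 0

variable {wt wt'}

/-- The shift relation between the weights of generators is additive, so an induced element has the
weight v - k and no other component. -/
theorem freeMap_i_support (hwt : WeightShift L wt wt')
    {p q : ℕ} {k : ℤ} {v : ℕ} (f : (freeProp L wt).Hom p q (k, v)) (w : ℕ)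
    (h : (w : ℤ) + k ≠ v) : freeMap wt wt' C.i f w = 0 := by
  refine freeMap_support (ε := -1) C.i ?_ f w ?_
  · intro p q k e
    rcases hwt e with h | h
    · left; rw [h]; ring
    · right; rw [h, map_zero]
  · intro h'
    apply h
    rw [h']
    ring

theorem freeMap_r_support (hwt : WeightShift L wt wt')
    {p q : ℕ} {k : ℤ} {w : ℕ} (f : (freeProp E wt').Hom p q (k, w)) (v : ℕ)
    (h : (w : ℤ) + k ≠ v) : freeMap wt' wt C.r f v = 0 := by
  refine freeMap_support (ε := 1) C.r ?_ f v ?_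
  · intro p q k e
    rw [one_mul]
    exact hwt _
  · rw [one_mul]
    exact h.symm

/-- The map is multiplicative and the identity on generators since r i = 1. The vanishing is proved
along with it: the shifted weight v - k is a sum of natural numbers, so nothing nonzero exists when
it is negative. -/
theorem freeMap_r_i (hwt : WeightShift L wt wt')
    {p q : ℕ} {a : ℤ × ℕ} (f : (freeProp L wt).Hom p q a) :
    ((a.2 : ℤ) < a.1 → f = 0) ∧ ∀ w : ℕ, (w : ℤ) + a.1 = a.2 →
      freeMap wt' wt C.r (freeMap wt wt' C.i (k := a.1) (w := a.2) f w) a.2 = f := by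
  refine freeProp_induction (motive := fun {p q a} f =>
    ((a.2 : ℤ) < a.1 → f = 0) ∧ ∀ w : ℕ, (w : ℤ) + a.1 = a.2 →
      freeMap wt' wt C.r (freeMap wt wt' C.i (k := a.1) (w := a.2) f w) a.2 = f)
    ?_ ?_ ?_ ?_ ?_ ?_ ?_ f
  · intros; simp
  · intro p q a f g hf hg
    refine ⟨fun h => by rw [hf.1 h, hg.1 h, add_zero], fun w h => ?_⟩
    rw [map_add, Pi.add_apply, map_add, Pi.add_apply, hf.2 w h, hg.2 w h]
  · intro p q a c f hf
    refine ⟨fun h => by rw [hf.1 h, smul_zero], fun w h => ?_⟩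
    rw [map_smul, Pi.smul_apply, map_smul, Pi.smul_apply, hf.2 w h]
  · intro p q k e
    rcases hwt e with h | rfl
    · refine ⟨fun h' => by simp only at h'; omega, fun w h' => ?_⟩
      simp only at h'
      obtain rfl : w = wt' p q := by omega
      rw [freeMap_gen, Pi.single_eq_same, freeMap_gen, Pi.single_eq_same, C.r_i]
    · refine ⟨fun _ => map_zero _, fun w _ => ?_⟩
      simp
  · intro p q σ
    refine ⟨fun h => by simp at h, fun w h => ?_⟩
    obtain rfl : w = 0 := by simpa using h
    rw [freeMap_perm, complPerm_zero]
    have := congrFun (freeMap_perm (wt := wt') (wt' := wt) C.r σ) 0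
    rw [complPerm_zero] at this
    exact this
  · intro p r q a b c h f g hf hg
    subst h
    -- A factor of negative shifted weight is zero. Once this is excluded for both factors, the
    -- intermediate weights u and v below are natural numbers.
    by_cases ha : (a.2 : ℤ) < a.1
    · obtain rfl := hf.1 ha
      simp
    by_cases hb : (b.2 : ℤ) < b.1
    · obtain rfl := hg.1 hb
      simp
    refine ⟨fun h => by simp at h; omega, fun w h => ?_⟩
    simp only [Prod.fst_add, Prod.snd_add] at h
    push_cast at h
    obtain ⟨u, hu⟩ := Int.eq_ofNat_of_zero_le (a := a.2 - a.1) (by omega)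
    obtain ⟨v, hv⟩ := Int.eq_ofNat_of_zero_le (a := b.2 - b.1) (by omega)
    rw [freeMap_comp, complComp_of_support _ _ (u := u) (v := v) (by omega)
      (fun u' hu' => freeMap_i_support C hwt _ _ (by omega)), freeMap_comp]
    refine (complComp_of_support _ _ (u := a.2) (v := b.2) rfl
      (fun u' hu' => freeMap_r_support C hwt (w := u) (k := a.1) _ _ (by omega))).trans ?_
    rw [hf.2 u (by omega), hg.2 v (by omega)]
  · intro p q p' q' a b c h f g hf hg
    subst h
    by_cases ha : (a.2 : ℤ) < a.1
    · obtain rfl := hf.1 ha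
      simp
    by_cases hb : (b.2 : ℤ) < b.1
    · obtain rfl := hg.1 hb
      simp
    refine ⟨fun h => by simp at h; omega, fun w h => ?_⟩
    simp only [Prod.fst_add, Prod.snd_add] at h
    push_cast at h
    obtain ⟨u, hu⟩ := Int.eq_ofNat_of_zero_le (a := a.2 - a.1) (by omega)
    obtain ⟨v, hv⟩ := Int.eq_ofNat_of_zero_le (a := b.2 - b.1) (by omega)
    rw [freeMap_tensor, complTensor_of_support _ _ (u := u) (v := v) (by omega)
      (fun u' hu' => freeMap_i_support C hwt _ _ (by omega)), freeMap_tensor]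
    refine (complTensor_of_support _ _ (u := a.2) (v := b.2) rfl
      (fun u' hu' => freeMap_r_support C hwt (w := u) (k := a.1) _ _ (by omega))).trans ?_
    rw [hf.2 u (by omega), hg.2 v (by omega)]

end Kunneth

/-! ### Eigenvalues of the Euler operator. -/

section Eigen

variable {K : Type u} [Field K] {E L : SBimodule K} {D : E.Differential}
  (C : SBimodule.Contraction D L) (wt wt' : ℕ → ℕ → ℕ)

/-- The elements induced from `L`. -/
def inducedPart (p q : ℕ) (a : ℤ × ℕ) : Submodule K ((freeProp E wt').Hom p q a) :=
  Submodule.span K {x | ∃ (v : ℕ) (y : (freeProp L wt).Hom p q (a.1, v)),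
    freeMap wt wt' C.i y a.2 = x}

/-- The eigenspaces of the Euler operator, with the elements induced from `L` in place of the
kernel. -/
def eulerPart (p q : ℕ) (a : ℤ × ℕ) : ℕ → Submodule K ((freeProp E wt').Hom p q a)
  | 0 => inducedPart C wt wt' p q a
  | n + 1 => LinearMap.ker (euler wt' D C.T - ((n : K) + 1) • LinearMap.id)

theorem euler_inducedPart {p q : ℕ} {a : ℤ × ℕ} {x : (freeProp E wt').Hom p q a}
    (hx : x ∈ inducedPart C wt wt' p q a) : euler wt' D C.T x = 0 := by
  have : inducedPart C wt wt' p q a ≤ LinearMap.ker (euler wt' D C.T) := by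
    refine Submodule.span_le.2 ?_
    rintro _ ⟨v, y, rfl⟩
    exact euler_freeMap C wt wt' y a.2
  exact this hx

theorem euler_eulerPart {p q : ℕ} {a : ℤ × ℕ} {n : ℕ} {x : (freeProp E wt').Hom p q a}
    (hx : x ∈ eulerPart C wt wt' p q a n) : euler wt' D C.T x = (n : K) • x := by
  cases n with
  | zero => rw [euler_inducedPart C wt wt' hx]; simp
  | succ n =>
    push_cast
    exact sub_eq_zero.1 hx

/-- The case n = 0 is excluded because the zero part is defined as the induced part, which is not
known at this point to be the whole kernel. -/
theorem mem_eulerPart {p q : ℕ} {a : ℤ × ℕ} {n : ℕ} (hn : n ≠ 0)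
    {x : (freeProp E wt').Hom p q a} (hx : euler wt' D C.T x = (n : K) • x) :
    x ∈ eulerPart C wt wt' p q a n := by
  cases n with
  | zero => exact absurd rfl hn
  | succ n =>
    push_cast at hx
    exact sub_eq_zero.2 hx

variable {wt wt'}

/-- If the weight of the first factor matches its number of vertices, the composite is the image of
the composite of the preimages; otherwise that factor is zero. -/
theorem comp_inducedPart (hwt : WeightShift L wt wt') {p r q : ℕ} {a b c : ℤ × ℕ} (h : a + b = c) :
    Submodule.map₂ ((freeProp E wt').comp h) (inducedPart C wt wt' p r a)
      (inducedPart C wt wt' r q b) ≤ inducedPart C wt wt' p q c := by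
  subst h
  rw [inducedPart, inducedPart, Submodule.map₂_span_span, Submodule.span_le]
  rintro _ ⟨_, ⟨v, y, rfl⟩, _, ⟨v', y', rfl⟩, rfl⟩
  by_cases hv : (a.2 : ℤ) + a.1 = v
  · refine Submodule.subset_span ⟨v + v', (freeProp L wt).comp rfl y y', ?_⟩
    refine (congrFun (freeMap_comp C.i rfl y y') _).trans ?_
    exact complComp_of_support _ rfl rfl
      fun u hu => freeMap_i_support C hwt _ _ (by omega)
  · rw [freeMap_i_support C hwt _ _ hv]
    simp

theorem tensor_inducedPart (hwt : WeightShift L wt wt')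
    {p q p' q' : ℕ} {a b c : ℤ × ℕ} (h : a + b = c) :
    Submodule.map₂ ((freeProp E wt').tensor h) (inducedPart C wt wt' p q a)
      (inducedPart C wt wt' p' q' b) ≤ inducedPart C wt wt' (p + p') (q + q') c := by
  subst h
  rw [inducedPart, inducedPart, Submodule.map₂_span_span, Submodule.span_le]
  rintro _ ⟨_, ⟨v, y, rfl⟩, _, ⟨v', y', rfl⟩, rfl⟩
  by_cases hv : (a.2 : ℤ) + a.1 = v
  · refine Submodule.subset_span ⟨v + v', (freeProp L wt).tensor rfl y y', ?_⟩
    refine (congrFun (freeMap_tensor C.i rfl y y') _).trans ?_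
    exact complTensor_of_support _ rfl rfl
      fun u hu => freeMap_i_support C hwt _ _ (by omega)
  · rw [freeMap_i_support C hwt _ _ hv]
    simp

/-- Eigenvalues of a derivation add under products. As they are natural numbers, a sum is zero only
if both are, and then the claim is the closure of the induced part under composition. -/
theorem comp_eulerPart (hwt : WeightShift L wt wt')
    {p r q : ℕ} {a b c : ℤ × ℕ} (h : a + b = c) (m n : ℕ) :
    Submodule.map₂ ((freeProp E wt').comp h) (eulerPart C wt wt' p r a m)
      (eulerPart C wt wt' r q b n) ≤ eulerPart C wt wt' p q c (m + n) := by
  by_cases hmn : m + n = 0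
  · obtain ⟨rfl, rfl⟩ : m = 0 ∧ n = 0 := by omega
    exact comp_inducedPart C hwt h
  · refine Submodule.map₂_le.2 fun x hx y hy => mem_eulerPart C wt wt' hmn ?_
    rw [euler_comp, euler_eulerPart C wt wt' hx, euler_eulerPart C wt wt' hy]
    simp [add_smul]

theorem tensor_eulerPart (hwt : WeightShift L wt wt')
    {p q p' q' : ℕ} {a b c : ℤ × ℕ} (h : a + b = c) (m n : ℕ) :
    Submodule.map₂ ((freeProp E wt').tensor h) (eulerPart C wt wt' p q a m)
      (eulerPart C wt wt' p' q' b n) ≤ eulerPart C wt wt' (p + p') (q + q') c (m + n) := by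
  by_cases hmn : m + n = 0
  · obtain ⟨rfl, rfl⟩ : m = 0 ∧ n = 0 := by omega
    exact tensor_inducedPart C hwt h
  · refine Submodule.map₂_le.2 fun x hx y hy => mem_eulerPart C wt wt' hmn ?_
    rw [euler_tensor, euler_eulerPart C wt wt' hx, euler_eulerPart C wt wt' hy]
    simp [add_smul]

/-- This replaces the expansion of a graph over decorations of its vertices by L and by its
complement: it suffices to split generators, because the parts multiply with addition of indices. -/
theorem mem_iSup_eulerPart (hwt : WeightShift L wt wt')
    {p q : ℕ} {a : ℤ × ℕ} (f : (freeProp E wt').Hom p q a) :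
    f ∈ ⨆ n, eulerPart C wt wt' p q a n := by
  refine freeProp_induction (motive := fun {p q a} f => f ∈ ⨆ n, eulerPart C wt wt' p q a n)
    ?_ ?_ ?_ ?_ ?_ ?_ ?_ f
  · exact zero_mem _
  · exact fun f g => add_mem
  · exact fun c f => Submodule.smul_mem _ c
  · intro p q k e
    -- The summand i r e is induced, and e - i r e has eigenvalue 1.
    rw [← add_sub_cancel (C.i.map (C.r.map e)) e, map_add]
    refine add_mem (Submodule.mem_iSup_of_mem 0 (Submodule.subset_span
      ⟨wt p q, freeGen wt (C.r.map e), ?_⟩))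
      (Submodule.mem_iSup_of_mem 1 (mem_eulerPart C wt wt' one_ne_zero ?_))
    · dsimp only
      rw [freeMap_gen, Pi.single_eq_same]
    · rw [euler_freeGen, map_sub C.r.map, C.r_i, sub_self, map_zero, sub_zero, Nat.cast_one,
        one_smul]
  · intro p q σ
    refine Submodule.mem_iSup_of_mem 0 (Submodule.subset_span
      ⟨0, (freeProp L wt).perm σ, ?_⟩)
    exact (congrFun (freeMap_perm C.i σ) 0).trans (complPerm_zero _ σ)
  · intro p r q a b c h f g hf hg
    have := Submodule.apply_mem_map₂ ((freeProp E wt').comp h) hf hg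
    rw [Submodule.map₂_iSup_left] at this
    refine SetLike.le_def.1 (iSup_le fun m => ?_) this
    rw [Submodule.map₂_iSup_right]
    exact iSup_le fun n => (comp_eulerPart C hwt h m n).trans (le_iSup _ _)
  · intro p q p' q' a b c h f g hf hg
    have := Submodule.apply_mem_map₂ ((freeProp E wt').tensor h) hf hg
    rw [Submodule.map₂_iSup_left] at this
    refine SetLike.le_def.1 (iSup_le fun m => ?_) this
    rw [Submodule.map₂_iSup_right]
    exact iSup_le fun n => (tensor_eulerPart C hwt h m n).trans (le_iSup _ _)

theorem euler_partialSups {p q : ℕ} {a : ℤ × ℕ} (n : ℕ) {x : (freeProp E wt').Hom p q a}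
    (hx : x ∈ partialSups (eulerPart C wt wt' p q a) n) :
    euler wt' D C.T x ∈ partialSups (eulerPart C wt wt' p q a) n := by
  have : partialSups (eulerPart C wt wt' p q a) n ≤
      (partialSups (eulerPart C wt wt' p q a) n).comap (euler wt' D C.T) := by
    refine partialSups_le _ _ _ fun m hm y hy => ?_
    rw [Submodule.mem_comap, euler_eulerPart C wt wt' hy]
    exact Submodule.smul_mem _ _ (SetLike.le_def.1 (le_partialSups_of_le _ hm) hy)
  exact this hx

/-- Induction on the largest eigenvalue allowed. Subtracting a multiple of `euler` f removes the top
part of f, and for a cocycle f this correction is a coboundary. -/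
theorem exists_inducedPart_of_mem_partialSups [CharZero K] {p q : ℕ} {a b c : ℤ × ℕ}
    (hb : b + (1, 0) = a) (hc : a + (1, 0) = c) (n : ℕ) :
    ∀ f ∈ partialSups (eulerPart C wt wt' p q a) n, freeDiff wt' D hc f = 0 →
      ∃ x ∈ inducedPart C wt wt' p q a, ∃ g, f = x + freeDiff wt' D hb g := by
  have hb' : a + (-1, 0) = b := by rw [← hb, raise_lower]
  have hc' : c + (-1, 0) = a := by rw [← hc, raise_lower]
  induction n with
  | zero =>
    intro f hf _
    rw [partialSups_zero] at hf
    exact ⟨f, hf, 0, by simp⟩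
  | succ n ih =>
    intro f hf hd
    have hn : (n : K) + 1 ≠ 0 := Nat.cast_add_one_ne_zero n
    -- For a cocycle only one half of the commutator survives.
    have he : euler wt' D C.T f = freeDiff wt' D hb (freeHtpy wt' C.T hb' f) := by
      rw [euler_apply D C.T hb' hb hc hc', hd, map_zero, add_zero]
    -- The operator 1 - (n + 1)⁻¹ `euler` is zero on the part of eigenvalue n + 1 and preserves the
    -- sum of the lower ones.
    have hmem : f - ((n : K) + 1)⁻¹ • euler wt' D C.T f ∈
        partialSups (eulerPart C wt wt' p q a) n := by
      have : partialSups (eulerPart C wt wt' p q a) (n + 1) =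
          partialSups (eulerPart C wt wt' p q a) n ⊔ eulerPart C wt wt' p q a (n + 1) :=
        partialSups_add_one _ _
      rw [this] at hf
      obtain ⟨y, hy, z, hz, rfl⟩ := Submodule.mem_sup.1 hf
      have hz' := euler_eulerPart C wt wt' hz
      push_cast at hz'
      rw [map_add, hz', smul_add, smul_smul, inv_mul_cancel₀ hn, one_smul,
        add_sub_add_right_eq_sub]
      exact sub_mem hy (Submodule.smul_mem _ _ (euler_partialSups C n hy))
    have hd' : freeDiff wt' D hc (f - ((n : K) + 1)⁻¹ • euler wt' D C.T f) = 0 := by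
      have := (freeDifferential wt' D).d_d hb hc (freeHtpy wt' C.T hb' f)
      change freeDiff wt' D hc (freeDiff wt' D hb _) = 0 at this
      rw [map_sub, map_smul, he, hd, this, smul_zero, sub_zero]
    obtain ⟨x, hx, g, hg⟩ := ih _ hmem hd'
    refine ⟨x, hx, g + ((n : K) + 1)⁻¹ • freeHtpy wt' C.T hb' f, ?_⟩
    rw [map_add, map_smul, ← he, ← add_assoc, ← hg, sub_add_cancel]

theorem exists_inducedPart (hwt : WeightShift L wt wt') [CharZero K] {p q : ℕ} {a b c : ℤ × ℕ}
    (hb : b + (1, 0) = a) (hc : a + (1, 0) = c) (f : (freeProp E wt').Hom p q a)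
    (hf : freeDiff wt' D hc f = 0) :
    ∃ x ∈ inducedPart C wt wt' p q a, ∃ g, f = x + freeDiff wt' D hb g := by
  have h := mem_iSup_eulerPart C hwt f
  rw [← iSup_partialSups_eq, Submodule.mem_iSup_of_directed _
    (partialSups (eulerPart C wt wt' p q a)).monotone.directed_le] at h
  obtain ⟨n, hn⟩ := h
  exact exists_inducedPart_of_mem_partialSups C hb hc n f hn hf

/-! ### The isomorphism -/

variable (wt wt') in
/-- The extension of `freeMap` to infinite sums. -/
def complMap {p q : ℕ} {k : ℤ} :
    ComplHom (freeProp L wt) p q k →ₗ[K] ComplHom (freeProp E wt') p q k where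
  -- In degree k, weight w on the side of E matches weight w + k on the side of L. The guard makes
  -- the truncation exact and gives zero where no such weight exists.
  toFun y w := if 0 ≤ (w : ℤ) + k then freeMap wt wt' C.i (y ((w : ℤ) + k).toNat) w else 0
  map_add' x y := by
    funext w
    rcases lt_or_ge ((w : ℤ) + k) 0 with h | h
    · simp [not_le.2 h]
    · simp [h]
  map_smul' c y := by
    funext w
    rw [Pi.smul_apply, Pi.smul_apply, map_smul, Pi.smul_apply]
    split_ifs
    · rfl
    · exact (smul_zero c).symm

theorem complMap_apply {p q : ℕ} {k : ℤ} (y : ComplHom (freeProp L wt) p q k) {v w : ℕ}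
    (h : (w : ℤ) + k = v) : complMap C wt wt' y w = freeMap wt wt' C.i (y v) w := by
  change ite _ _ _ = _
  rw [if_pos (by omega)]
  obtain rfl : ((w : ℤ) + k).toNat = v := by omega
  rfl

theorem complMap_of_neg {p q : ℕ} {k : ℤ} (y : ComplHom (freeProp L wt) p q k) {w : ℕ}
    (h : (w : ℤ) + k < 0) : complMap C wt wt' y w = 0 := by
  change ite _ _ _ = _
  rw [if_neg (by omega)]

theorem complMap_perm {p q : ℕ} (σ : Fin q ≃ Fin p) :
    complMap C wt wt' (complPerm _ σ) = complPerm _ σ := by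
  funext w
  rw [complMap_apply C _ (add_zero _)]
  rcases eq_or_ne w 0 with rfl | hw
  · rw [complPerm_zero, freeMap_perm]
  · rw [complPerm_of_ne _ _ hw, complPerm_of_ne _ _ hw, map_zero, Pi.zero_apply]

theorem complMap_comp (hwt : WeightShift L wt wt') {p r q : ℕ} {a b c : ℤ} (h : a + b = c)
    (f : ComplHom (freeProp L wt) p r a) (g : ComplHom (freeProp L wt) r q b) :
    complMap C wt wt' (complComp _ h f g) =
      complComp _ h (complMap C wt wt' f) (complMap C wt wt' g) := by
  funext w
  rcases lt_or_ge ((w : ℤ) + c) 0 with hw | hw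
  · rw [complMap_of_neg C _ hw, complComp_apply]
    refine (Finset.sum_eq_zero fun x _ => ?_).symm
    have hx := HasAntidiagonal.mem_antidiagonal.1 x.2
    by_cases ha : (x.1.1 : ℤ) + a < 0
    · simp [complMap_of_neg C f ha]
    · rw [complMap_of_neg C g (by omega), map_zero]
  · obtain ⟨v, hv⟩ := Int.eq_ofNat_of_zero_le hw
    rw [complMap_apply C _ hv, complComp_apply, complComp_apply, map_sum, Finset.sum_apply]
    simp only [freeMap_comp, complComp_apply]
    -- For each splitting of the weight on the side of E, at most one splitting on the side of L
    -- contributes, namely the one shifted by the degrees a and b.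
    rw [Finset.sum_comm]
    refine Fintype.sum_congr _ _ fun x => ?_
    have hx := HasAntidiagonal.mem_antidiagonal.1 x.2
    -- With a negative shifted weight no splitting on the side of L matches, and both sides vanish.
    by_cases ha : (x.1.1 : ℤ) + a < 0
    · rw [complMap_of_neg C f ha, map_zero, LinearMap.zero_apply]
      refine Finset.sum_eq_zero fun y _ => ?_
      rw [freeMap_i_support C hwt _ _ (by omega), map_zero, LinearMap.zero_apply]
    by_cases hb : (x.1.2 : ℤ) + b < 0
    · rw [complMap_of_neg C g hb, map_zero]
      refine Finset.sum_eq_zero fun y _ => ?_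
      rw [freeMap_i_support C hwt (g _) _ (by omega), map_zero]
    obtain ⟨s, hs⟩ := Int.eq_ofNat_of_zero_le (a := (x.1.1 : ℤ) + a) (by omega)
    obtain ⟨t, ht⟩ := Int.eq_ofNat_of_zero_le (a := (x.1.2 : ℤ) + b) (by omega)
    rw [Fintype.sum_eq_single ⟨(s, t), by simp; omega⟩, complMap_apply C f hs,
      complMap_apply C g ht]
    rintro ⟨⟨s', t'⟩, hy⟩ hne
    have hy' := HasAntidiagonal.mem_antidiagonal.1 hy
    simp only at hy'
    rw [freeMap_i_support C hwt (f s') _ ?_, map_zero, LinearMap.zero_apply]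
    intro hs'
    obtain rfl : s' = s := by omega
    obtain rfl : t' = t := by omega
    exact hne rfl

theorem complMap_tensor (hwt : WeightShift L wt wt') {p q p' q' : ℕ} {a b c : ℤ} (h : a + b = c)
    (f : ComplHom (freeProp L wt) p q a) (g : ComplHom (freeProp L wt) p' q' b) :
    complMap C wt wt' (complTensor _ h f g) =
      complTensor _ h (complMap C wt wt' f) (complMap C wt wt' g) := by
  funext w
  rcases lt_or_ge ((w : ℤ) + c) 0 with hw | hw
  · rw [complMap_of_neg C _ hw, complTensor_apply]
    refine (Finset.sum_eq_zero fun x _ => ?_).symm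
    have hx := HasAntidiagonal.mem_antidiagonal.1 x.2
    by_cases ha : (x.1.1 : ℤ) + a < 0
    · simp [complMap_of_neg C f ha]
    · rw [complMap_of_neg C g (by omega), map_zero]
  · obtain ⟨v, hv⟩ := Int.eq_ofNat_of_zero_le hw
    rw [complMap_apply C _ hv, complTensor_apply, complTensor_apply, map_sum, Finset.sum_apply]
    simp only [freeMap_tensor, complTensor_apply]
    rw [Finset.sum_comm]
    refine Fintype.sum_congr _ _ fun x => ?_
    have hx := HasAntidiagonal.mem_antidiagonal.1 x.2
    by_cases ha : (x.1.1 : ℤ) + a < 0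
    · rw [complMap_of_neg C f ha, map_zero, LinearMap.zero_apply]
      refine Finset.sum_eq_zero fun y _ => ?_
      rw [freeMap_i_support C hwt _ _ (by omega), map_zero, LinearMap.zero_apply]
    by_cases hb : (x.1.2 : ℤ) + b < 0
    · rw [complMap_of_neg C g hb, map_zero]
      refine Finset.sum_eq_zero fun y _ => ?_
      rw [freeMap_i_support C hwt (g _) _ (by omega), map_zero]
    obtain ⟨s, hs⟩ := Int.eq_ofNat_of_zero_le (a := (x.1.1 : ℤ) + a) (by omega)
    obtain ⟨t, ht⟩ := Int.eq_ofNat_of_zero_le (a := (x.1.2 : ℤ) + b) (by omega)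
    rw [Fintype.sum_eq_single ⟨(s, t), by simp; omega⟩, complMap_apply C f hs,
      complMap_apply C g ht]
    rintro ⟨⟨s', t'⟩, hy⟩ hne
    have hy' := HasAntidiagonal.mem_antidiagonal.1 hy
    simp only at hy'
    rw [freeMap_i_support C hwt (f s') _ ?_, map_zero, LinearMap.zero_apply]
    intro hs'
    obtain rfl : s' = s := by omega
    obtain rfl : t' = t := by omega
    exact hne rfl

theorem complD_complMap {p q : ℕ} {k l : ℤ} (h : k + 1 = l)
    (y : ComplHom (freeProp L wt) p q k) :
    complD (freeDifferential wt' D) h (complMap C wt wt' y) = 0 := by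
  funext w
  rw [complD_apply]
  rcases lt_or_ge ((w : ℤ) + k) 0 with hw | hw
  · rw [complMap_of_neg C _ hw, map_zero, Pi.zero_apply]
  · obtain ⟨v, hv⟩ := Int.eq_ofNat_of_zero_le hw
    rw [complMap_apply C y hv]
    exact congrFun (complD_freeMap C wt wt' (y v) h) w

theorem exists_complMap_of_mem_inducedPart (hwt : WeightShift L wt wt') {p q : ℕ} {k : ℤ} {w : ℕ}
    {x : (freeProp E wt').Hom p q (k, w)} (hx : x ∈ inducedPart C wt wt' p q (k, w)) :
    ∃ y : ComplHom (freeProp L wt) p q k, complMap C wt wt' y w = x := by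
  have : inducedPart C wt wt' p q (k, w) ≤ LinearMap.range
      (LinearMap.proj w ∘ₗ complMap (p := p) (q := q) (k := k) C wt wt') := by
    refine Submodule.span_le.2 ?_
    rintro _ ⟨v, y, rfl⟩
    by_cases hv : (w : ℤ) + k = v
    · refine ⟨Pi.single v y, ?_⟩
      exact (complMap_apply C _ hv).trans (by rw [Pi.single_eq_same])
    · rw [freeMap_i_support C hwt y w hv]
      exact zero_mem _
  exact this hx

/-- The map induced by r kills the coboundary and returns the component y v from weight v - k. For v
< k the component lies in a zero space. -/
theorem eq_zero_of_complMap_eq_complD (hwt : WeightShift L wt wt')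
    {p q : ℕ} {k l : ℤ} (h : l + 1 = k)
    (y : ComplHom (freeProp L wt) p q k) (g : ComplHom (freeProp E wt') p q l)
    (hy : complMap C wt wt' y = complD (freeDifferential wt' D) h g) : y = 0 := by
  funext v
  rcases lt_or_ge (v : ℤ) k with hv | hv
  · exact (freeMap_r_i C hwt (y v)).1 hv
  · obtain ⟨w, hw⟩ := Int.eq_ofNat_of_zero_le (a := (v : ℤ) - k) (by omega)
    rw [← (freeMap_r_i C hwt (y v)).2 w (by simp only; omega)]
    dsimp only
    rw [← complMap_apply C y (by omega), hy, complD_apply]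
    exact congrFun (freeMap_freeDiff C wt wt' (g w) _) v

/-- The differential preserves the weight, so `exists_inducedPart` can be applied in each weight
separately and the solutions collected into infinite sums. -/
theorem exists_complMap_add_complD (hwt : WeightShift L wt wt')
    [CharZero K] {p q : ℕ} {k l m : ℤ} (h : l + 1 = k)
    (h' : k + 1 = m) (f : ComplHom (freeProp E wt') p q k)
    (hf : complD (freeDifferential wt' D) h' f = 0) :
    ∃ y g, f = complMap C wt wt' y + complD (freeDifferential wt' D) h g := by
  have key : ∀ w, ∃ (y : ComplHom (freeProp L wt) p q k) (g : (freeProp E wt').Hom p q (l, w)),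
      f w = complMap C wt wt' y w +
        freeDiff wt' D (Prod.ext h rfl : (l, w) + (1, 0) = (k, w)) g := by
    intro w
    obtain ⟨x, hx, g, hg⟩ := exists_inducedPart C hwt (a := (k, w)) (b := (l, w)) (c := (m, w))
      (Prod.ext h rfl) (Prod.ext h' rfl) (f w) (congrFun hf w)
    obtain ⟨y, rfl⟩ := exists_complMap_of_mem_inducedPart C hwt hx
    exact ⟨y, g, hg⟩
  choose y g hyg using key
  -- Component v is taken from the solution chosen in weight v - k. The values for v < k, where the
  -- subtraction is truncated, are never read by `complMap`.
  refine ⟨fun v => y ((v : ℤ) - k).toNat v, g, funext fun w => (hyg w).trans ?_⟩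
  rw [Pi.add_apply]
  congr 1
  rcases lt_or_ge ((w : ℤ) + k) 0 with hw | hw
  · rw [complMap_of_neg C _ hw, complMap_of_neg C _ hw]
  · obtain ⟨v, hv⟩ := Int.eq_ofNat_of_zero_le hw
    rw [complMap_apply C _ hv, complMap_apply C _ hv]
    have : ((v : ℤ) - k).toNat = w := by omega
    rw [this]

variable (wt wt') in
/-- The map from the completed free prop on `L` to the cohomology of the one on `E`. -/
def toCohomology {p q : ℕ} {k : ℤ} : (completion (freeProp L wt)).Hom p q k →ₗ[K]
    (cohomology (completionDifferential (freeDifferential wt' D))).Hom p q k :=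
  (coboundaries (completionDifferential (freeDifferential wt' D)) p q k).mkQ ∘ₗ
    (complMap C wt wt').codRestrict
      (cocycles (completionDifferential (freeDifferential wt' D)) p q k)
      fun y => complD_complMap C rfl y

theorem toCohomology_bijective (hwt : WeightShift L wt wt') [CharZero K] {p q : ℕ} {k : ℤ} :
    Function.Bijective (toCohomology (p := p) (q := q) (k := k) C wt wt') := by
  constructor
  · rw [injective_iff_map_eq_zero]
    intro y hy
    obtain ⟨g, hg⟩ := (mem_coboundaries _ (sub_add_cancel k 1) _).1
      ((Submodule.Quotient.mk_eq_zero _).1 hy)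
    exact eq_zero_of_complMap_eq_complD C hwt (sub_add_cancel k 1) y g hg.symm
  · intro x
    induction x using Submodule.Quotient.induction_on with | _ f
    obtain ⟨y, g, hyg⟩ := exists_complMap_add_complD C hwt (sub_add_cancel k 1) rfl f.1 f.2
    refine ⟨y, ?_⟩
    refine (Submodule.Quotient.eq _).2 ((mem_coboundaries _ (sub_add_cancel k 1) _).2 ⟨-g, ?_⟩)
    refine (map_neg (complD (freeDifferential wt' D) (sub_add_cancel k 1)) g).trans ?_
    refine neg_eq_iff_eq_neg.2 ?_
    have key : ∀ a b c : ComplHom (freeProp E wt') p q k, a = b + c → c = -(b - a) := by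
      rintro _ b c rfl
      abel
    exact key _ _ _ hyg

/-- The cohomology of the completed free prop on a dg `S`-bimodule which contracts to `L` is the
completed free prop on `L`. -/
def cohomologyIso (hwt : WeightShift L wt wt') [CharZero K] : GradedProp.Iso
    (cohomology (completionDifferential (freeDifferential wt' D)))
    (completion (freeProp L wt)) where
  equiv p q k := (LinearEquiv.ofBijective _ (toCohomology_bijective C hwt)).symm
  map_perm σ := by
    rw [LinearEquiv.symm_apply_eq]
    refine congrArg Submodule.Quotient.mk (Subtype.ext ?_)
    exact (complMap_perm C σ).symm
  map_comp {p r q a b c} h f g := by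
    obtain ⟨f, rfl⟩ := (toCohomology_bijective C hwt).2 f
    obtain ⟨g, rfl⟩ := (toCohomology_bijective C hwt).2 g
    rw [LinearEquiv.symm_apply_eq]
    erw [LinearEquiv.ofBijective_symm_apply_apply, LinearEquiv.ofBijective_symm_apply_apply]
    refine congrArg Submodule.Quotient.mk (Subtype.ext ?_)
    exact (complMap_comp C hwt h f g).symm
  map_tensor h f g := by
    obtain ⟨f, rfl⟩ := (toCohomology_bijective C hwt).2 f
    obtain ⟨g, rfl⟩ := (toCohomology_bijective C hwt).2 g
    rw [LinearEquiv.symm_apply_eq]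
    erw [LinearEquiv.ofBijective_symm_apply_apply, LinearEquiv.ofBijective_symm_apply_apply]
    refine congrArg Submodule.Quotient.mk (Subtype.ext ?_)
    exact (complMap_tensor C hwt h f g).symm

end Eigen

/-! ### The complex of ordered partitions -/

/-- An ordered partition of `p` labels into `m` bunches, as a function to the natural numbers whose
image consists of the numbers less than `m`. -/
@[ext] structure OPart (p : ℕ) where
  m : ℕ
  f : Fin p → ℕ
  lt_iff : ∀ i, i < m ↔ ∃ x, f x = i

namespace OPart

variable {p : ℕ}

theorem f_lt (c : OPart p) (x : Fin p) : c.f x < c.m := (c.lt_iff _).2 ⟨x, rfl⟩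

/-- Merge the bunches `i` and `i + 1`. -/
def merge (c : OPart p) (i : ℕ) (h : i + 1 < c.m) : OPart p where
  m := c.m - 1
  f x := if i < c.f x then c.f x - 1 else c.f x
  lt_iff j := by
    constructor
    · intro hj
      rcases le_or_gt j i with hi | hi
      · obtain ⟨x, hx⟩ := (c.lt_iff j).1 (by omega)
        exact ⟨x, by rw [if_neg (by omega), hx]⟩
      · obtain ⟨x, hx⟩ := (c.lt_iff (j + 1)).1 (by omega)
        exact ⟨x, by rw [if_pos (by omega), hx, Nat.add_sub_cancel]⟩
    · rintro ⟨x, rfl⟩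
      have := c.f_lt x
      split_ifs <;> omega

/-- Add a new label to the bunch `j`. -/
def addTo (c : OPart p) (j : ℕ) (h : j < c.m) : OPart (p + 1) where
  m := c.m
  f := Fin.cons j c.f
  lt_iff i := by
    rw [c.lt_iff, Fin.exists_fin_succ]
    simp only [Fin.cons_zero, Fin.cons_succ]
    constructor
    · exact Or.inr
    · rintro (rfl | h')
      · exact (c.lt_iff _).1 h
      · exact h'

/-- Add a new bunch with a new label before the bunch `j`. -/
def addBefore (c : OPart p) (j : ℕ) (h : j ≤ c.m) : OPart (p + 1) where
  m := c.m + 1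
  f := Fin.cons j fun x => if c.f x < j then c.f x else c.f x + 1
  lt_iff i := by
    rw [Fin.exists_fin_succ]
    simp only [Fin.cons_zero, Fin.cons_succ]
    constructor
    · intro hi
      rcases lt_trichotomy i j with h' | h' | h'
      · obtain ⟨x, hx⟩ := (c.lt_iff i).1 (by omega)
        exact Or.inr ⟨x, by rw [if_pos (by omega), hx]⟩
      · exact Or.inl h'.symm
      · obtain ⟨x, hx⟩ := (c.lt_iff (i - 1)).1 (by omega)
        exact Or.inr ⟨x, by rw [if_neg (by omega), hx]; omega⟩
    · rintro (rfl | ⟨x, rfl⟩)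
      · omega
      · have := c.f_lt x
        split_ifs <;> omega

/-- The dichotomy is whether label 0 shares its bunch with another label or is alone in it; in the
second case its bunch is deleted and the later bunches are renumbered. -/
theorem addTo_or_addBefore (c : OPart (p + 1)) :
    (∃ a j, ∃ h, c = addTo a j h) ∨ ∃ a j, ∃ h, c = addBefore a j h := by
  have hc : ∀ i, i < c.m ↔ c.f 0 = i ∨ ∃ x : Fin p, c.f x.succ = i := fun i => by
    rw [c.lt_iff, Fin.exists_fin_succ]
  have h0 := c.f_lt 0
  by_cases h : ∃ x : Fin p, c.f x.succ = c.f 0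
  · left
    refine ⟨⟨c.m, fun x => c.f x.succ, fun i => ?_⟩, c.f 0, h0, ?_⟩
    · rw [hc]
      constructor
      · rintro (rfl | h')
        · exact h
        · exact h'
      · exact Or.inr
    · ext x
      · rfl
      · refine Fin.cases ?_ (fun x => ?_) x <;> rfl
  · right
    have h' : ∀ x : Fin p, c.f x.succ ≠ c.f 0 := fun x hx => h ⟨x, hx⟩
    refine ⟨⟨c.m - 1, fun x => if c.f x.succ < c.f 0 then c.f x.succ else c.f x.succ - 1,
      fun i => ?_⟩, c.f 0, by change _ ≤ c.m - 1; omega, ?_⟩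
    · constructor
      · intro hi
        rcases lt_or_ge i (c.f 0) with hi' | hi'
        · obtain h'' | ⟨x, hx⟩ := (hc i).1 (by omega)
          · omega
          · exact ⟨x, by rw [if_pos (by omega), hx]⟩
        · obtain h'' | ⟨x, hx⟩ := (hc (i + 1)).1 (by omega)
          · omega
          · exact ⟨x, by rw [if_neg (by omega), hx]; rfl⟩
      · rintro ⟨x, rfl⟩
        have := c.f_lt x.succ
        have := h' x
        split_ifs <;> omega
    · ext x
      · change c.m = c.m - 1 + 1
        omega
      · refine Fin.cases rfl (fun x => ?_) x
        have := h' x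
        simp only [addBefore, Fin.cons_succ]
        split_ifs <;> omega

end OPart

/-! ### Merging bunches and inserting a new label. -/

section PartComplex

variable (K : Type u) [Field K] {p : ℕ}

/-- The vector space on the ordered partitions. -/
abbrev PartSpace (p : ℕ) : Type u := OPart p →₀ K

/-- The basis vector of an ordered partition. -/
def OPart.vec (c : OPart p) : PartSpace K p := Finsupp.single c 1

/-- A linear map with given values on the ordered partitions. -/
def partLift {M : Type*} [AddCommGroup M] [Module K M] (F : OPart p → M) : PartSpace K p →ₗ[K] M :=
  Finsupp.linearCombination K F

variable {K}

@[simp] theorem partLift_vec {M : Type*} [AddCommGroup M] [Module K M] (F : OPart p → M)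
    (c : OPart p) : partLift K F (c.vec K) = F c := by
  simp [partLift, OPart.vec]

theorem part_ext {M : Type*} [AddCommGroup M] [Module K M] {f g : PartSpace K p →ₗ[K] M}
    (h : ∀ c : OPart p, f (c.vec K) = g (c.vec K)) : f = g :=
  Finsupp.lhom_ext' fun c => LinearMap.ext_ring (h c)

variable (K) in
/-- Merge the bunches `i` and `i + 1`, if they exist. -/
def mergeAt (i : ℕ) : PartSpace K p →ₗ[K] PartSpace K p :=
  partLift K fun c => if h : i + 1 < c.m then (c.merge i h).vec K else 0

variable (K) in
/-- Add a new label to the bunch `j`, if it exists. -/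
def insE (j : ℕ) : PartSpace K p →ₗ[K] PartSpace K (p + 1) :=
  partLift K fun c => if h : j < c.m then (c.addTo j h).vec K else 0

variable (K) in
/-- Add a new bunch with a new label before the bunch `j`, if possible. -/
def insV (j : ℕ) : PartSpace K p →ₗ[K] PartSpace K (p + 1) :=
  partLift K fun c => if h : j ≤ c.m then (c.addBefore j h).vec K else 0

theorem mergeAt_vec (c : OPart p) {i : ℕ} (h : i + 1 < c.m) :
    mergeAt K i (c.vec K) = (c.merge i h).vec K := by
  simp [mergeAt, h]

theorem mergeAt_vec_of_le (c : OPart p) {i : ℕ} (h : c.m ≤ i + 1) :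
    mergeAt K i (c.vec K) = 0 := by
  simp [mergeAt, h]

theorem insE_vec (c : OPart p) {j : ℕ} (h : j < c.m) :
    insE K j (c.vec K) = (c.addTo j h).vec K := by
  simp [insE, h]

theorem insE_vec_of_le (c : OPart p) {j : ℕ} (h : c.m ≤ j) : insE K j (c.vec K) = 0 := by
  simp [insE, h]

theorem insV_vec (c : OPart p) {j : ℕ} (h : j ≤ c.m) :
    insV K j (c.vec K) = (c.addBefore j h).vec K := by
  simp [insV, h]

theorem insV_vec_of_lt (c : OPart p) {j : ℕ} (h : c.m < j) : insV K j (c.vec K) = 0 := by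
  simp [insV, h]

/-- A merge before bunch j, or of j with its predecessor, lowers the number of the bunch containing
the new label by one. -/
theorem mergeAt_insE_of_lt (c : OPart p) {i j : ℕ} (h : i < j) :
    mergeAt K i (insE K j (c.vec K)) = insE K (j - 1) (mergeAt K i (c.vec K)) := by
  rcases lt_or_ge j c.m with hj | hj
  · rw [insE_vec c hj, mergeAt_vec _ (show i + 1 < (c.addTo j hj).m from by change _ < c.m; omega),
      mergeAt_vec c (by omega), insE_vec _ (by change _ < c.m - 1; omega)]
    congr 1
    ext x
    · rfl
    · refine Fin.cases ?_ (fun x => ?_) x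
      · simp [OPart.merge, OPart.addTo, h]
      · rfl
  · rw [insE_vec_of_le c hj, map_zero]
    rcases lt_or_ge (i + 1) c.m with hi | hi
    · rw [mergeAt_vec c hi, insE_vec_of_le _ (by change c.m - 1 ≤ _; omega)]
    · rw [mergeAt_vec_of_le c hi, map_zero]

theorem mergeAt_insE_of_le (c : OPart p) {i j : ℕ} (h : j ≤ i) :
    mergeAt K i (insE K j (c.vec K)) = insE K j (mergeAt K i (c.vec K)) := by
  rcases lt_or_ge (i + 1) c.m with hi | hi
  · rw [insE_vec c (by omega), mergeAt_vec _ (show i + 1 < (c.addTo j _).m from hi),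
      mergeAt_vec c hi, insE_vec _ (by change _ < c.m - 1; omega)]
    congr 1
    ext x
    · rfl
    · refine Fin.cases ?_ (fun x => ?_) x
      · simp [OPart.merge, OPart.addTo, h]
      · rfl
  · rw [mergeAt_vec_of_le c hi, map_zero]
    rcases lt_or_ge j c.m with hj | hj
    · rw [insE_vec c hj, mergeAt_vec_of_le (c.addTo j hj) hi]
    · rw [insE_vec_of_le c hj, map_zero]

theorem mergeAt_insV_of_lt (c : OPart p) {i j : ℕ} (h : i + 1 < j) :
    mergeAt K i (insV K j (c.vec K)) = insV K (j - 1) (mergeAt K i (c.vec K)) := by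
  rcases le_or_gt j c.m with hj | hj
  · rw [insV_vec c hj, mergeAt_vec _
      (show i + 1 < (c.addBefore j hj).m from by change _ < c.m + 1; omega),
      mergeAt_vec c (by omega), insV_vec _ (by change _ ≤ c.m - 1; omega)]
    congr 1
    ext x
    · change c.m + 1 - 1 = c.m - 1 + 1
      omega
    · refine Fin.cases ?_ (fun x => ?_) x
      · simp only [OPart.merge, OPart.addBefore, Fin.cons_zero]
        rw [if_pos (by omega)]
      · simp only [OPart.merge, OPart.addBefore, Fin.cons_succ]
        split_ifs <;> omega
  · rw [insV_vec_of_lt c hj, map_zero]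
    rcases lt_or_ge (i + 1) c.m with hi | hi
    · rw [mergeAt_vec c hi, insV_vec_of_lt _ (by change c.m - 1 < _; omega)]
    · rw [mergeAt_vec_of_le c hi, map_zero]

/-- The new singleton is absorbed by its left neighbour. Together with `mergeAt_insV_self`, for the
right neighbour, this is the incidence of vertices (`insV`) and edges (`insE`) in the interval of
places of the new label. -/
theorem mergeAt_insV_succ (c : OPart p) (i : ℕ) :
    mergeAt K i (insV K (i + 1) (c.vec K)) = insE K i (c.vec K) := by
  rcases lt_or_ge i c.m with hi | hi
  · rw [insV_vec c (by omega), mergeAt_vec _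
      (show i + 1 < (c.addBefore (i + 1) _).m from by change _ < c.m + 1; omega), insE_vec c hi]
    congr 1
    ext x
    · rfl
    · refine Fin.cases ?_ (fun x => ?_) x
      · simp [OPart.merge, OPart.addBefore, OPart.addTo]
      · simp only [OPart.merge, OPart.addBefore, OPart.addTo, Fin.cons_succ]
        split_ifs <;> omega
  · rw [insV_vec_of_lt c (by omega), map_zero, insE_vec_of_le c hi]

theorem mergeAt_insV_self (c : OPart p) (i : ℕ) :
    mergeAt K i (insV K i (c.vec K)) = insE K i (c.vec K) := by
  rcases lt_or_ge i c.m with hi | hi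
  · rw [insV_vec c hi.le, mergeAt_vec _
      (show i + 1 < (c.addBefore i _).m from by change _ < c.m + 1; omega), insE_vec c hi]
    congr 1
    ext x
    · rfl
    · refine Fin.cases ?_ (fun x => ?_) x
      · simp [OPart.merge, OPart.addBefore, OPart.addTo]
      · simp only [OPart.merge, OPart.addBefore, OPart.addTo, Fin.cons_succ]
        split_ifs <;> omega
  · rw [insE_vec_of_le c hi]
    rcases le_or_gt i c.m with hi' | hi'
    · rw [insV_vec c hi', mergeAt_vec_of_le _ (by change c.m + 1 ≤ _; omega)]
    · rw [insV_vec_of_lt c hi', map_zero]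

theorem mergeAt_insV_of_gt (c : OPart p) {i j : ℕ} (h : j ≤ i) :
    mergeAt K (i + 1) (insV K j (c.vec K)) = insV K j (mergeAt K i (c.vec K)) := by
  rcases lt_or_ge (i + 1) c.m with hi | hi
  · rw [insV_vec c (by omega), mergeAt_vec _
      (show i + 1 + 1 < (c.addBefore j _).m from by change _ < c.m + 1; omega),
      mergeAt_vec c hi, insV_vec _ (by change _ ≤ c.m - 1; omega)]
    congr 1
    ext x
    · change c.m + 1 - 1 = c.m - 1 + 1
      omega
    · refine Fin.cases ?_ (fun x => ?_) x
      · simp only [OPart.merge, OPart.addBefore, Fin.cons_zero]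
        rw [if_neg (by omega)]
      · simp only [OPart.merge, OPart.addBefore, Fin.cons_succ]
        split_ifs <;> omega
  · rw [mergeAt_vec_of_le c hi, map_zero]
    rcases le_or_gt j c.m with hj | hj
    · rw [insV_vec c hj, mergeAt_vec_of_le _ (by change c.m + 1 ≤ _; omega)]
    · rw [insV_vec_of_lt c hj, map_zero]

variable (K) in
/-- The differential of the complex of ordered partitions. -/
def partD : PartSpace K p →ₗ[K] PartSpace K p :=
  partLift K fun c => ∑ i ∈ range c.m, sg K ((i : ℤ) + 1) • mergeAt K i (c.vec K)

/-- There are m - 1 possible merges and the remaining ones are zero by convention, so any bound from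
m - 1 on may be used for the sum. -/
theorem partD_vec (c : OPart p) {n : ℕ} (h : c.m ≤ n + 1) :
    partD K (c.vec K) = ∑ i ∈ range n, sg K ((i : ℤ) + 1) • mergeAt K i (c.vec K) := by
  have key : ∀ n, c.m ≤ n + 1 → ∑ i ∈ range (n + 1), sg K ((i : ℤ) + 1) • mergeAt K i (c.vec K) =
      ∑ i ∈ range n, sg K ((i : ℤ) + 1) • mergeAt K i (c.vec K) := by
    intro n hn
    rw [sum_range_succ, mergeAt_vec_of_le c hn, smul_zero, add_zero]
  have key' : ∀ n, c.m ≤ n → ∑ i ∈ range n, sg K ((i : ℤ) + 1) • mergeAt K i (c.vec K) =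
      ∑ i ∈ range c.m, sg K ((i : ℤ) + 1) • mergeAt K i (c.vec K) := by
    intro n hn
    induction n, hn using Nat.le_induction with
    | base => rfl
    | succ n hn ih => rw [key n (by omega), ih]
  rw [← key n h, key' _ h, partD, partLift_vec]

end PartComplex

/-! ### The contraction along the places of the first label. -/

section PartHomotopy

variable {K : Type u} [Field K] {p : ℕ}

/-- The terms of the homotopy: the new label is moved to all places before the bunch `j`. -/
def shiftSum (j : ℕ) (x : PartSpace K p) : PartSpace K (p + 1) :=
  ∑ l ∈ range j, sg K l • insV K l x

theorem shiftSum_succ (j : ℕ) (x : PartSpace K p) :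
    shiftSum (j + 1) x = shiftSum j x + sg K j • insV K j x :=
  sum_range_succ _ _

@[simp] theorem shiftSum_map_zero (j : ℕ) : shiftSum j (0 : PartSpace K p) = 0 := by
  simp [shiftSum]

/-- Merges to the left of the new singleton keep their index, merges to its right shift by one and
change sign, and the two merges that involve it give edges. The last term is the boundary term of
that shift of index, kept so that induction on n is possible. -/
theorem sum_mergeAt_insV (c : OPart p) (l n : ℕ) :
    ∑ i ∈ range n, sg K ((i : ℤ) + 1) • mergeAt K i (insV K l (c.vec K)) =
      ∑ i ∈ range n, sg K ((i : ℤ) + 1) •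
        ((if i + 1 < l then insV K (l - 1) (mergeAt K i (c.vec K)) else 0) -
          if l ≤ i then insV K l (mergeAt K i (c.vec K)) else 0) +
      sg K l • ((if 1 ≤ l ∧ l ≤ n then insE K (l - 1) (c.vec K) else 0) -
        if l < n then insE K l (c.vec K) else 0) +
      if l < n then sg K n • insV K l (mergeAt K (n - 1) (c.vec K)) else 0 := by
  induction n with
  | zero =>
    rw [if_neg (show ¬ (1 ≤ l ∧ l ≤ 0) by omega)]
    simp
  | succ n ih =>
    rw [sum_range_succ, sum_range_succ, ih, Nat.cast_succ, Nat.add_sub_cancel]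
    rcases lt_or_ge (n + 1) l with h | h
    · rw [mergeAt_insV_of_lt c h]
      simp [h, show ¬ l ≤ n by omega, show ¬ l ≤ n + 1 by omega, show ¬ l < n by omega,
        show ¬ l < n + 1 by omega]
    rcases h.eq_or_lt with rfl | h
    · rw [mergeAt_insV_succ]
      simp [show ¬ n + 1 < n by omega]
    rcases (Nat.lt_succ_iff.1 h).eq_or_lt with rfl | h
    · rw [mergeAt_insV_self]
      simp only [show ¬ l + 1 < l by omega, lt_irrefl, le_refl, if_true, if_false, and_true,
        Nat.lt_succ_self, show l ≤ l + 1 by omega, sg_succ]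
      module
    · obtain ⟨n, rfl⟩ : ∃ k, n = k + 1 := ⟨n - 1, by omega⟩
      rw [mergeAt_insV_of_gt c (by omega)]
      simp only [show ¬ n + 1 + 1 < l by omega, show l ≤ n + 1 by omega, show l < n + 1 by omega,
        if_true, if_false, and_true, show l ≤ n + 1 + 1 by omega, show l < n + 1 + 1 by omega,
        Nat.add_sub_cancel, sg_succ]
      push_cast
      rw [sg_succ]
      module

/-- The differential of a partition with a new singleton bunch. -/
theorem partD_insV (c : OPart p) {l : ℕ} (hl : l ≤ c.m) :
    partD K (insV K l (c.vec K)) =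
      ∑ i ∈ range c.m, sg K ((i : ℤ) + 1) •
        ((if i + 1 < l then insV K (l - 1) (mergeAt K i (c.vec K)) else 0) -
          if l ≤ i then insV K l (mergeAt K i (c.vec K)) else 0) +
      sg K l • ((if 1 ≤ l then insE K (l - 1) (c.vec K) else 0) - insE K l (c.vec K)) := by
  have h₁ : (if 1 ≤ l ∧ l ≤ c.m then insE K (l - 1) (c.vec K) else 0) =
      if 1 ≤ l then insE K (l - 1) (c.vec K) else 0 := by
    simp [hl]
  have h₂ : (if l < c.m then insE K l (c.vec K) else 0) = insE K l (c.vec K) := by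
    split_ifs with h
    · rfl
    · rw [insE_vec_of_le c (by omega)]
  -- The boundary term vanishes because the last bunch has no successor to merge with.
  have h₃ : (if l < c.m then sg K c.m • insV K l (mergeAt K (c.m - 1) (c.vec K)) else 0) = 0 := by
    split_ifs with h
    · rw [mergeAt_vec_of_le c (by omega), map_zero, smul_zero]
    · rfl
  have := sum_mergeAt_insV (K := K) c l c.m
  rw [h₁, h₂, h₃, add_zero] at this
  rw [← this, insV_vec c hl, partD_vec _ (n := c.m) le_rfl]

/-- The places after the merge at i move down by one and close up with those before it, leaving one
place fewer when the merge lies below j. -/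
theorem sum_shift_aux (W : ℕ → PartSpace K (p + 1)) (i j : ℕ) :
    ∑ l ∈ range (j + 1), ((if i + 1 < l then -W (l - 1) else 0) - if l ≤ i then W l else 0) =
      -∑ l ∈ range (if i < j then j else j + 1), W l := by
  induction j with
  | zero => simp
  | succ j ih =>
    rw [sum_range_succ, ih]
    rcases lt_trichotomy i j with h | rfl | h
    · simp only [h, show i + 1 < j + 1 by omega, show ¬ j + 1 ≤ i by omega,
        show i < j + 1 by omega, if_true, if_false, Nat.add_sub_cancel]
      rw [sum_range_succ _ j]
      abel
    · simp
    · simp only [show ¬ i < j by omega, show ¬ i + 1 < j + 1 by omega, show j + 1 ≤ i by omega,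
        show ¬ i < j + 1 by omega, if_true, if_false]
      rw [sum_range_succ _ (j + 1)]
      abel

/-- With alternating signs the edges telescope along the vertices 0, …, j, and only the edge j
remains. The other terms are the same sums over the merged partitions. -/
theorem partD_shiftSum (c : OPart p) {j : ℕ} (hj : j ≤ c.m) :
    partD K (shiftSum (j + 1) (c.vec K)) = -insE K j (c.vec K) -
      ∑ i ∈ range c.m, sg K ((i : ℤ) + 1) •
        shiftSum (if i < j then j else j + 1) (mergeAt K i (c.vec K)) := by
  have tele : ∀ n, ∑ l ∈ range (n + 1), ((if 1 ≤ l then insE K (l - 1) (c.vec K) else 0) -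
      insE K l (c.vec K)) = -insE K n (c.vec K) := by
    intro n
    induction n with
    | zero => simp
    | succ n ih =>
      rw [sum_range_succ, ih, if_pos (by omega), Nat.add_sub_cancel]
      abel
  have h : ∀ l ∈ range (j + 1), sg K l • partD K (insV K l (c.vec K)) =
      ∑ i ∈ range c.m, sg K ((i : ℤ) + 1) •
        ((if i + 1 < l then -(sg K (l - 1 : ℕ) • insV K (l - 1) (mergeAt K i (c.vec K))) else 0) -
          if l ≤ i then sg K l • insV K l (mergeAt K i (c.vec K)) else 0) +
      ((if 1 ≤ l then insE K (l - 1) (c.vec K) else 0) - insE K l (c.vec K)) := by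
    intro l hl
    rw [partD_insV c (by simp at hl; omega), smul_add, smul_smul, sg_mul_self, one_smul, smul_sum]
    congr 1
    refine Finset.sum_congr rfl fun i _ => ?_
    rw [smul_comm, smul_sub]
    congr 2
    · split_ifs with h
      · obtain ⟨l, rfl⟩ : ∃ k, l = k + 1 := ⟨l - 1, by omega⟩
        rw [Nat.cast_succ, sg_succ, Nat.add_sub_cancel, neg_smul]
      · simp
    · split_ifs <;> simp
  rw [shiftSum, map_sum]
  simp only [map_smul]
  rw [sum_congr rfl h, sum_add_distrib, tele, sum_comm]
  simp only [← smul_sum]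
  have h' := fun i => sum_shift_aux (fun l => sg K l • insV K l (mergeAt K i (c.vec K))) i j
  simp only [h', smul_neg, sum_neg_distrib, shiftSum]
  abel

open Classical in
/-- The contracting homotopy in the direction of the first label. -/
def partH : PartSpace K (p + 1) →ₗ[K] PartSpace K (p + 1) :=
  partLift K fun c => if h : ∃ a : OPart p, ∃ j, ∃ h, c = a.addTo j h
    then -shiftSum (h.choose_spec.choose + 1) (h.choose.vec K) else 0

open Classical in
/-- The projection to the partitions in which the first label is the last bunch. -/
def partRho : PartSpace K (p + 1) →ₗ[K] PartSpace K p :=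
  partLift K fun c => if h : ∃ a : OPart p, c = a.addBefore a.m le_rfl then h.choose.vec K else 0

/-- The section of `partRho`. -/
def partIota : PartSpace K p →ₗ[K] PartSpace K (p + 1) :=
  partLift K fun c => sg K c.m • shiftSum (c.m + 1) (c.vec K)

theorem addTo_injective {a b : OPart p} {i j : ℕ} {hi : i < a.m} {hj : j < b.m}
    (h : a.addTo i hi = b.addTo j hj) : a = b ∧ i = j := by
  have h₁ := congrArg OPart.m h
  have h₂ := congrArg OPart.f h
  exact ⟨OPart.ext h₁ (funext fun x => congrFun h₂ x.succ), congrFun h₂ 0⟩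

theorem addBefore_injective {a b : OPart p} {i j : ℕ} {hi : i ≤ a.m} {hj : j ≤ b.m}
    (h : a.addBefore i hi = b.addBefore j hj) : a = b ∧ i = j := by
  have h₁ := congrArg OPart.m h
  have h₂ := congrArg OPart.f h
  obtain rfl : i = j := congrFun h₂ 0
  refine ⟨OPart.ext (Nat.succ_injective h₁) (funext fun x => ?_), rfl⟩
  have := congrFun h₂ x.succ
  simp only [OPart.addBefore, Fin.cons_succ] at this
  split_ifs at this <;> omega

theorem addTo_ne_addBefore {a b : OPart p} {i j : ℕ} {hi : i < a.m} {hj : j ≤ b.m} :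
    a.addTo i hi ≠ b.addBefore j hj := by
  intro h
  have h' := congrArg OPart.f h
  obtain rfl : i = j := congrFun h' 0
  obtain ⟨x, hx⟩ := (a.lt_iff i).1 hi
  have := congrFun h' x.succ
  simp only [OPart.addTo, OPart.addBefore, Fin.cons_succ, hx] at this
  split_ifs at this <;> omega

theorem partH_insE (c : OPart p) {j : ℕ} (hj : j < c.m) :
    partH (insE K j (c.vec K)) = -shiftSum (j + 1) (c.vec K) := by
  have h : ∃ a : OPart p, ∃ i, ∃ h, c.addTo j hj = a.addTo i h := ⟨c, j, hj, rfl⟩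
  have key : ∀ (a : OPart p) (i : ℕ) (hi : i < a.m), c.addTo j hj = a.addTo i hi →
      -shiftSum (i + 1) (a.vec K) = -shiftSum (j + 1) (c.vec K) := by
    intro a i hi h
    obtain ⟨rfl, rfl⟩ := addTo_injective h
    rfl
  rw [insE_vec c hj, partH, partLift_vec, dif_pos h]
  exact key _ _ _ h.choose_spec.choose_spec.choose_spec

theorem partH_insV (x : PartSpace K p) (j : ℕ) : partH (insV K j x) = 0 := by
  suffices partH ∘ₗ insV K j = (0 : PartSpace K p →ₗ[K] PartSpace K (p + 1)) from
    LinearMap.congr_fun this x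
  refine part_ext fun c => ?_
  rw [LinearMap.comp_apply, LinearMap.zero_apply]
  rcases le_or_gt j c.m with hj | hj
  · rw [insV_vec c hj, partH, partLift_vec, dif_neg]
    rintro ⟨a, i, hi, h⟩
    exact addTo_ne_addBefore h.symm
  · rw [insV_vec_of_lt c hj, map_zero]

theorem partRho_insE (x : PartSpace K p) (j : ℕ) : partRho (insE K j x) = 0 := by
  suffices partRho ∘ₗ insE K j = (0 : PartSpace K p →ₗ[K] PartSpace K p) from
    LinearMap.congr_fun this x
  refine part_ext fun c => ?_
  rw [LinearMap.comp_apply, LinearMap.zero_apply]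
  rcases lt_or_ge j c.m with hj | hj
  · rw [insE_vec c hj, partRho, partLift_vec, dif_neg]
    rintro ⟨a, h⟩
    exact addTo_ne_addBefore h
  · rw [insE_vec_of_le c hj, map_zero]

theorem partRho_insV (c : OPart p) (j : ℕ) :
    partRho (insV K j (c.vec K)) = if j = c.m then c.vec K else 0 := by
  rcases le_or_gt j c.m with hj | hj
  · rw [insV_vec c hj, partRho, partLift_vec]
    by_cases hm : j = c.m
    · subst hm
      have h : ∃ a : OPart p, c.addBefore c.m hj = a.addBefore a.m le_rfl := ⟨c, rfl⟩
      rw [dif_pos h, if_pos rfl, ← (addBefore_injective h.choose_spec).1]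
    · rw [dif_neg, if_neg hm]
      rintro ⟨a, h⟩
      obtain ⟨rfl, h⟩ := addBefore_injective h
      exact hm h
  · rw [insV_vec_of_lt c hj, map_zero, if_neg (by omega)]

/-- A merged partition has m - 1 bunches, which explains the bound on j; if the merge is impossible,
both sides are zero. -/
theorem partH_insE_mergeAt (c : OPart p) {i j : ℕ} (h : i + 1 < c.m → j + 1 < c.m) :
    partH (insE K j (mergeAt K i (c.vec K))) = -shiftSum (j + 1) (mergeAt K i (c.vec K)) := by
  rcases lt_or_ge (i + 1) c.m with hi | hi
  · rw [mergeAt_vec c hi, partH_insE _ (by change j < c.m - 1; have := h hi; omega)]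
  · rw [mergeAt_vec_of_le c hi]
    simp

theorem partRho_insV_mergeAt (c : OPart p) {i l : ℕ} :
    partRho (insV K l (mergeAt K i (c.vec K))) =
      if l + 1 = c.m then mergeAt K i (c.vec K) else 0 := by
  rcases lt_or_ge (i + 1) c.m with hi | hi
  · rw [mergeAt_vec c hi, partRho_insV]
    refine if_congr ?_ rfl rfl
    change l = c.m - 1 ↔ _
    omega
  · rw [mergeAt_vec_of_le c hi]
    simp

/-- The sum over all vertices has no edge left over at the end of the interval, so it anticommutes
with merging. The factor (-1)^m in `partIota`, which changes sign under a merge, turns this into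
commutation. -/
theorem partD_partIota (x : PartSpace K p) : partD K (partIota x) = partIota (partD K x) := by
  suffices partD K ∘ₗ partIota = (partIota ∘ₗ partD K : PartSpace K p →ₗ[K] _) from
    LinearMap.congr_fun this x
  refine part_ext fun c => ?_
  rw [LinearMap.comp_apply, LinearMap.comp_apply, partIota, partLift_vec, map_smul,
    partD_shiftSum c le_rfl, insE_vec_of_le c le_rfl, partD_vec c (n := c.m) (by omega), map_sum,
    neg_zero, zero_sub, smul_neg, smul_sum, ← sum_neg_distrib]
  refine Finset.sum_congr rfl fun i hi => ?_
  rw [if_pos (mem_range.1 hi), map_smul, smul_comm, ← smul_neg]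
  congr 1
  rcases lt_or_ge (i + 1) c.m with hi' | hi'
  · rw [mergeAt_vec c hi', partLift_vec]
    have h : (c.merge i hi').m + 1 = c.m := by change c.m - 1 + 1 = c.m; omega
    rw [h, ← neg_smul]
    congr 1
    rw [← h]
    push_cast
    rw [sg_succ, neg_neg]
  · rw [mergeAt_vec_of_le c hi']
    simp

theorem partRho_partD (x : PartSpace K (p + 1)) : partRho (partD K x) = partD K (partRho x) := by
  suffices partRho ∘ₗ partD K = (partD K ∘ₗ partRho : PartSpace K (p + 1) →ₗ[K] _) from
    LinearMap.congr_fun this x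
  refine part_ext fun c => ?_
  rw [LinearMap.comp_apply, LinearMap.comp_apply]
  obtain ⟨a, j, hj, rfl⟩ | ⟨a, j, hj, rfl⟩ := c.addTo_or_addBefore
  · rw [partD_vec (a.addTo j hj) (n := a.m) (Nat.le_succ _), ← insE_vec a hj, partRho_insE,
      map_zero, map_sum]
    refine Finset.sum_eq_zero fun i _ => ?_
    rcases lt_or_ge i j with h | h
    · rw [mergeAt_insE_of_lt a h, map_smul, partRho_insE, smul_zero]
    · rw [mergeAt_insE_of_le a h, map_smul, partRho_insE, smul_zero]
  · rw [← insV_vec a hj, partD_insV a hj, partRho_insV, map_add, map_smul, map_sub,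
      partRho_insE, map_sum, apply_ite partRho, partRho_insE, map_zero, ite_self, sub_zero,
      smul_zero, add_zero]
    have h : ∀ i ∈ range a.m, partRho (sg K ((i : ℤ) + 1) •
        ((if i + 1 < j then insV K (j - 1) (mergeAt K i (a.vec K)) else 0) -
          if j ≤ i then insV K j (mergeAt K i (a.vec K)) else 0)) =
        if j = a.m then sg K ((i : ℤ) + 1) • mergeAt K i (a.vec K) else 0 := by
      intro i hi
      rw [map_smul, map_sub, apply_ite partRho, apply_ite partRho, partRho_insV_mergeAt,
        partRho_insV_mergeAt, map_zero]
      rw [mem_range] at hi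
      -- Both conditions together force i ≥ m - 1, where there is nothing to merge.
      have h₁ : (if j ≤ i then (if j + 1 = a.m then mergeAt K i (a.vec K) else 0) else 0) = 0 := by
        split_ifs with h h'
        · rw [mergeAt_vec_of_le a (by omega)]
        · rfl
        · rfl
      rw [h₁, sub_zero]
      split_ifs with h₂ h₃ h₄ h₅ h₆
      · rfl
      · omega
      · omega
      · rw [smul_zero]
      · rw [mergeAt_vec_of_le a (by omega)]
      · rw [smul_zero]
    rw [sum_congr rfl h]
    split_ifs with hm
    · rw [partD_vec a (n := a.m) (by omega)]
    · simp

/-- This is the contraction of the cochains of an interval onto the constants: `partH` integrates an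
edge over the vertices before it, `partRho` evaluates at the last vertex, and `partIota` is the
constant, up to signs. The merges of the other labels cancel. -/
theorem partD_partH (x : PartSpace K (p + 1)) :
    partD K (partH x) + partH (partD K x) = x - partIota (partRho x) := by
  suffices partD K ∘ₗ partH + partH ∘ₗ partD K =
      (LinearMap.id - partIota ∘ₗ partRho : PartSpace K (p + 1) →ₗ[K] _) from
    LinearMap.congr_fun this x
  refine part_ext fun c => ?_
  simp only [LinearMap.comp_apply, LinearMap.add_apply, LinearMap.sub_apply, LinearMap.id_apply]
  obtain ⟨a, j, hj, rfl⟩ | ⟨a, j, hj, rfl⟩ := c.addTo_or_addBefore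
  · rw [partD_vec (a.addTo j hj) (n := a.m) (Nat.le_succ _), ← insE_vec a hj, partRho_insE,
      map_zero, sub_zero, partH_insE a hj, map_neg, partD_shiftSum a hj.le, map_sum, neg_sub,
      sub_neg_eq_add, add_comm _ (insE K j _), add_assoc, ← sum_add_distrib]
    refine add_eq_left.2 (Finset.sum_eq_zero fun i hi => ?_)
    rw [map_smul, ← smul_add]
    refine smul_eq_zero_of_right _ ?_
    rcases lt_or_ge i j with h | h
    · rw [if_pos h, mergeAt_insE_of_lt a h, partH_insE_mergeAt a (by omega),
        Nat.sub_add_cancel (by omega), add_neg_cancel]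
    · rw [if_neg (by omega), mergeAt_insE_of_le a h, partH_insE_mergeAt a (by omega),
        add_neg_cancel]
  · have h₀ : partH (∑ i ∈ range a.m, sg K ((i : ℤ) + 1) •
        ((if i + 1 < j then insV K (j - 1) (mergeAt K i (a.vec K)) else 0) -
          if j ≤ i then insV K j (mergeAt K i (a.vec K)) else 0)) = 0 := by
      rw [map_sum]
      refine Finset.sum_eq_zero fun i _ => ?_
      rw [map_smul, map_sub, apply_ite partH, apply_ite partH, partH_insV, partH_insV]
      simp
    have h₁ : partH (if 1 ≤ j then insE K (j - 1) (a.vec K) else 0) =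
        -shiftSum j (a.vec K) := by
      split_ifs with h
      · rw [partH_insE a (by omega), Nat.sub_add_cancel h]
      · obtain rfl : j = 0 := by omega
        simp [shiftSum]
    rw [← insV_vec a hj, partH_insV, map_zero, zero_add, partD_insV a hj, map_add, h₀, zero_add,
      map_smul, map_sub, h₁, partRho_insV]
    -- At the last place no edge follows and the projection contributes. At every other place two
    -- consecutive partial sums differ by the vertex j itself.
    rcases hj.eq_or_lt with rfl | hj'
    · rw [insE_vec_of_le a le_rfl, map_zero, sub_zero, if_pos rfl, partIota, partLift_vec,
        shiftSum_succ, smul_add, smul_smul, sg_mul_self, one_smul, smul_neg]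
      abel
    · rw [partH_insE a hj', if_neg hj'.ne, map_zero, sub_zero, shiftSum_succ]
      rw [show -shiftSum j (a.vec K) - -(shiftSum j (a.vec K) + sg K j • insV K j (a.vec K)) =
        sg K j • insV K j (a.vec K) by abel, smul_smul, sg_mul_self, one_smul]

end PartHomotopy

/-! ### Contraction of the partition complex onto the sign representation. -/

section PartContraction

variable {K : Type u} [Field K]

/-- Labels are removed one at a time and the contractions composed, starting from the single
partition of the empty set. The class w and the functional φ obtained depend on the order of the
labels and have no symmetry. -/
theorem exists_part_contraction (p : ℕ) :
    ∃ (s : PartSpace K p →ₗ[K] PartSpace K p) (w : PartSpace K p) (φ : PartSpace K p →ₗ[K] K),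
      partD K w = 0 ∧ (∀ x, φ (partD K x) = 0) ∧
        ∀ x, partD K (s x) + s (partD K x) = x - φ x • w := by
  induction p with
  | zero =>
    let c₀ : OPart 0 := ⟨0, Fin.elim0, fun i => by simp⟩
    have hc : ∀ c : OPart 0, c = c₀ := by
      intro c
      have hm : c.m = 0 := by
        by_contra h
        obtain ⟨x, _⟩ := (c.lt_iff 0).1 (by omega)
        exact x.elim0
      exact OPart.ext hm (funext fun x => x.elim0)
    have hD : (partD K : PartSpace K 0 →ₗ[K] PartSpace K 0) = 0 := by
      refine part_ext fun c => ?_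
      obtain rfl := hc c
      rw [partD_vec c₀ (n := 0) (by simp [c₀])]
      simp
    refine ⟨0, c₀.vec K, partLift K fun _ => 1, by simp [hD], by simp [hD], ?_⟩
    suffices (0 : PartSpace K 0 →ₗ[K] PartSpace K 0) =
        LinearMap.id - (partLift K fun _ => (1 : K)).smulRight (c₀.vec K) by
      intro x
      simpa [hD] using LinearMap.congr_fun this x
    refine part_ext fun c => ?_
    obtain rfl := hc c
    simp
  | succ p ih =>
    obtain ⟨s, w, φ, hw, hφ, hs⟩ := ih
    refine ⟨partH + partIota ∘ₗ s ∘ₗ partRho, partIota w, φ ∘ₗ partRho, ?_, ?_, ?_⟩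
    · rw [partD_partIota, hw, map_zero]
    · intro x
      rw [LinearMap.comp_apply, partRho_partD, hφ]
    · intro x
      have h₁ := partD_partH x
      have h₂ := congrArg partIota (hs (partRho x))
      simp only [map_add, map_sub, map_smul] at h₂
      simp only [LinearMap.add_apply, LinearMap.comp_apply, map_add, partD_partIota,
        partRho_partD]
      rw [add_add_add_comm, h₁, h₂]
      abel

/-- The partition into singletons given by a permutation. -/
def OPart.ofPerm {p : ℕ} (σ : Equiv.Perm (Fin p)) : OPart p where
  m := p
  f x := σ x
  lt_iff i := by
    constructor
    · intro hi
      exact ⟨σ.symm ⟨i, hi⟩, by simp⟩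
    · rintro ⟨x, rfl⟩
      exact (σ x).2

theorem OPart.ofPerm_injective {p : ℕ} : Function.Injective (OPart.ofPerm (p := p)) := by
  intro σ τ h
  refine Equiv.ext fun x => Fin.ext ?_
  exact congrFun (congrArg OPart.f h) x

theorem OPart.m_le {p : ℕ} (c : OPart p) : c.m ≤ p := by
  choose g hg using fun i : Fin c.m => (c.lt_iff i).1 i.2
  have : Function.Injective g := fun i j h => Fin.ext (by rw [← hg i, ← hg j, h])
  simpa using Fintype.card_le_of_injective g this

variable (K) in
/-- The sign of a permutation, as a scalar. -/
def permSign {p : ℕ} (σ : Equiv.Perm (Fin p)) : K := ((Equiv.Perm.sign σ : ℤ) : K)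

theorem permSign_mul {p : ℕ} (σ τ : Equiv.Perm (Fin p)) :
    permSign K (σ * τ) = permSign K σ * permSign K τ := by
  simp [permSign]

theorem permSign_inv {p : ℕ} (σ : Equiv.Perm (Fin p)) : permSign K σ⁻¹ = permSign K σ := by
  simp [permSign]

theorem permSign_mul_self {p : ℕ} (σ : Equiv.Perm (Fin p)) :
    permSign K σ * permSign K σ = 1 := by
  rw [permSign, ← Int.cast_mul, ← Units.val_mul, Int.units_mul_self]
  simp

variable (K) in
/-- The alternating sum of the partitions into singletons. -/
def signVec (p : ℕ) : PartSpace K p :=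
  ∑ σ : Equiv.Perm (Fin p), permSign K σ • (OPart.ofPerm σ).vec K

/-- Merging the bunches i and i + 1 does not distinguish σ from its product with the transposition
of i and i + 1, and these have opposite signs. -/
theorem partD_signVec (p : ℕ) : partD K (signVec K p) = 0 := by
  simp only [signVec, map_sum, map_smul]
  have h : ∀ σ : Equiv.Perm (Fin p), partD K ((OPart.ofPerm σ).vec K) =
      ∑ i ∈ range p, sg K ((i : ℤ) + 1) • mergeAt K i ((OPart.ofPerm σ).vec K) := fun σ =>
    partD_vec _ (by change p ≤ _; omega)
  simp only [h, smul_sum]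
  rw [sum_comm]
  refine Finset.sum_eq_zero fun i _ => ?_
  rcases lt_or_ge (i + 1) p with hi | hi
  · have hne : (⟨i, by omega⟩ : Fin p) ≠ ⟨i + 1, hi⟩ := by simp
    refine Finset.sum_involution
      (fun σ _ => Equiv.swap (⟨i, by omega⟩ : Fin p) ⟨i + 1, hi⟩ * σ) ?_ ?_ (by simp) ?_
    · intro σ _
      have : mergeAt K i
          ((OPart.ofPerm (Equiv.swap (⟨i, by omega⟩ : Fin p) ⟨i + 1, hi⟩ * σ)).vec K) =
          mergeAt K i ((OPart.ofPerm σ).vec K) := by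
        rw [mergeAt_vec (OPart.ofPerm (Equiv.swap (⟨i, by omega⟩ : Fin p) ⟨i + 1, hi⟩ * σ)) hi,
          mergeAt_vec (OPart.ofPerm σ) hi]
        congr 1
        refine OPart.ext rfl (funext fun x => ?_)
        change (if i < (Equiv.swap (⟨i, by omega⟩ : Fin p) ⟨i + 1, hi⟩ (σ x) : ℕ)
          then (Equiv.swap (⟨i, by omega⟩ : Fin p) ⟨i + 1, hi⟩ (σ x) : ℕ) - 1
          else Equiv.swap (⟨i, by omega⟩ : Fin p) ⟨i + 1, hi⟩ (σ x)) =
          if i < (σ x : ℕ) then (σ x : ℕ) - 1 else σ x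
        rcases eq_or_ne (σ x) ⟨i, by omega⟩ with h | h
        · rw [h, Equiv.swap_apply_left]
          simp
        rcases eq_or_ne (σ x) ⟨i + 1, hi⟩ with h' | h'
        · rw [h', Equiv.swap_apply_right]
          simp
        · rw [Equiv.swap_apply_of_ne_of_ne h h']
      rw [this, permSign_mul,
        show permSign K (Equiv.swap (⟨i, by omega⟩ : Fin p) ⟨i + 1, hi⟩) = -1 by
          rw [permSign, Equiv.Perm.sign_swap hne]; simp]
      simp
    · intro σ _ _ h
      have := mul_eq_right.1 h
      rw [Equiv.swap_eq_one_iff] at this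
      exact hne this
    · intro σ _
      simp
  · refine Finset.sum_eq_zero fun σ _ => ?_
    rw [mergeAt_vec_of_le (OPart.ofPerm σ) hi, smul_zero, smul_zero]

open Classical in
variable (K) in
/-- The coefficient of a partition in `signVec`. -/
def signCoeff {p : ℕ} (c : OPart p) : K :=
  ∑ σ : Equiv.Perm (Fin p), if OPart.ofPerm σ = c then permSign K σ else 0

theorem signCoeff_ofPerm {p : ℕ} (σ : Equiv.Perm (Fin p)) :
    signCoeff K (OPart.ofPerm σ) = permSign K σ := by
  rw [signCoeff, Fintype.sum_eq_single σ fun τ hτ =>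
    if_neg fun h => hτ (OPart.ofPerm_injective h), if_pos rfl]

theorem signCoeff_of_ne {p : ℕ} {c : OPart p} (h : c.m ≠ p) : signCoeff K c = 0 :=
  Finset.sum_eq_zero fun σ _ => if_neg fun h' => h (by rw [← h']; rfl)

variable (K) in
/-- The functional dual to `signVec`. -/
def signDual (p : ℕ) : PartSpace K p →ₗ[K] K :=
  (p.factorial : K)⁻¹ • partLift K (signCoeff K)

theorem signDual_vec {p : ℕ} (c : OPart p) :
    signDual K p (c.vec K) = (p.factorial : K)⁻¹ * signCoeff K c := by
  simp [signDual]

/-- The functional is supported on partitions into p singletons, which are never the result of a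
merge. -/
theorem signDual_partD {p : ℕ} (x : PartSpace K p) : signDual K p (partD K x) = 0 := by
  suffices signDual K p ∘ₗ partD K = 0 from LinearMap.congr_fun this x
  refine part_ext fun c => ?_
  rw [LinearMap.comp_apply, partD_vec c (n := c.m) (by omega), map_sum, LinearMap.zero_apply]
  refine Finset.sum_eq_zero fun i _ => ?_
  rw [map_smul]
  rcases lt_or_ge (i + 1) c.m with hi | hi
  · rw [mergeAt_vec c hi, signDual_vec, signCoeff_of_ne, mul_zero, smul_zero]
    have := c.m_le
    change c.m - 1 ≠ p
    omega
  · rw [mergeAt_vec_of_le c hi, map_zero, smul_zero]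

theorem signDual_signVec [CharZero K] (p : ℕ) : signDual K p (signVec K p) = 1 := by
  simp only [signVec, map_sum, map_smul, signDual_vec, signCoeff_ofPerm, smul_eq_mul]
  have : ∀ σ : Equiv.Perm (Fin p), permSign K σ * ((p.factorial : K)⁻¹ * permSign K σ) =
      (p.factorial : K)⁻¹ := fun σ => by
    rw [mul_left_comm, permSign_mul_self, mul_one]
  simp only [this, sum_const, card_univ, Fintype.card_perm, Fintype.card_fin, nsmul_eq_mul]
  exact mul_inv_cancel₀ (Nat.cast_ne_zero.2 p.factorial_ne_zero)

variable (K) in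
/-- The sign operator for the number of bunches. -/
def partSign {p : ℕ} : PartSpace K p →ₗ[K] PartSpace K p :=
  partLift K fun c => sg K c.m • c.vec K

theorem partSign_vec {p : ℕ} (c : OPart p) : partSign K (c.vec K) = sg K c.m • c.vec K :=
  partLift_vec _ c

theorem partSign_partSign {p : ℕ} (x : PartSpace K p) : partSign K (partSign K x) = x := by
  suffices partSign K ∘ₗ partSign K = (LinearMap.id : PartSpace K p →ₗ[K] _) from
    LinearMap.congr_fun this x
  refine part_ext fun c => ?_
  rw [LinearMap.comp_apply, partSign_vec, map_smul, partSign_vec, smul_smul, sg_mul_self, one_smul,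
    LinearMap.id_apply]

theorem partD_partSign {p : ℕ} (x : PartSpace K p) :
    partD K (partSign K x) = -partSign K (partD K x) := by
  suffices partD K ∘ₗ partSign K = (-(partSign K ∘ₗ partD K) : PartSpace K p →ₗ[K] _) from
    LinearMap.congr_fun this x
  refine part_ext fun c => ?_
  rw [LinearMap.comp_apply, partSign_vec, map_smul, LinearMap.neg_apply, LinearMap.comp_apply,
    partD_vec c (n := c.m) (by omega), map_sum, smul_sum, ← sum_neg_distrib]
  refine Finset.sum_congr rfl fun i _ => ?_
  rw [map_smul, smul_comm, ← smul_neg]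
  congr 1
  rcases lt_or_ge (i + 1) c.m with hi | hi
  · rw [mergeAt_vec c hi, partSign_vec, ← neg_smul]
    congr 1
    change _ = -sg K ((c.m - 1 : ℕ) : ℤ)
    rw [← sg_succ]
    congr 1
    omega
  · rw [mergeAt_vec_of_le c hi]
    simp

theorem partSign_signVec (p : ℕ) : partSign K (signVec K p) = sg K p • signVec K p := by
  simp only [signVec, map_sum, map_smul, smul_sum, partSign_vec]
  refine Finset.sum_congr rfl fun σ _ => ?_
  rw [smul_comm]
  rfl

theorem signDual_partSign {p : ℕ} (x : PartSpace K p) :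
    signDual K p (partSign K x) = sg K p * signDual K p x := by
  suffices signDual K p ∘ₗ partSign K = sg K p • signDual K p from LinearMap.congr_fun this x
  refine part_ext fun c => ?_
  rw [LinearMap.comp_apply, partSign_vec, map_smul, LinearMap.smul_apply]
  by_cases h : c.m = p
  · rw [h]
  · rw [signDual_vec, signCoeff_of_ne h]
    simp

/-- A contraction onto a line can be moved to any cocycle ω and any functional Φ that kills
coboundaries and has Φ(ω) = 1, at the cost of changing the homotopy. Oddness of the homotopy with
respect to the number of bunches is what the tensor product needs. -/
theorem exists_sign_contraction [CharZero K] (p : ℕ) :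
    ∃ s : PartSpace K p →ₗ[K] PartSpace K p,
      (∀ x, partD K (s x) + s (partD K x) = x - signDual K p x • signVec K p) ∧
        ∀ x, s (partSign K x) = -partSign K (s x) := by
  suffices h : ∃ s : PartSpace K p →ₗ[K] PartSpace K p,
      ∀ x, partD K (s x) + s (partD K x) = x - signDual K p x • signVec K p by
    obtain ⟨s, hs⟩ := h
    -- Since the differential anticommutes with the sign operator, minus the conjugate of s is again
    -- a homotopy for the same projector; the mean of the two is odd.
    refine ⟨(2 : K)⁻¹ • (s - partSign K ∘ₗ s ∘ₗ partSign K), fun x => ?_, fun x => ?_⟩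
    · have h₁ := hs x
      have h₂ := congrArg (partSign K) (hs (partSign K x))
      simp only [map_add, map_sub, map_smul, partSign_partSign, signDual_partSign,
        partSign_signVec, partD_partSign, map_neg, smul_smul] at h₂
      rw [mul_right_comm, sg_mul_self, one_mul] at h₂
      have h₃ : x - signDual K p x • signVec K p = (2 : K)⁻¹ •
          ((x - signDual K p x • signVec K p) + (x - signDual K p x • signVec K p)) := by
        rw [← two_smul K (x - _), smul_smul, inv_mul_cancel₀ two_ne_zero, one_smul]
      rw [h₃]
      nth_rewrite 1 [← h₁]
      rw [← h₂]
      simp only [LinearMap.smul_apply, LinearMap.sub_apply, LinearMap.comp_apply, map_smul,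
        map_sub, partD_partSign, ← smul_add]
      congr 1
      abel
    · simp only [LinearMap.smul_apply, LinearMap.sub_apply, LinearMap.comp_apply, map_smul,
        map_sub, partSign_partSign]
      rw [← smul_neg, neg_sub]
  obtain ⟨s, w, φ, hw, hφ, hs⟩ := exists_part_contraction (K := K) p
  set ω := signVec K p
  set Φ := signDual K p
  have hω : ω - φ ω • w = partD K (s ω) := by
    rw [← hs, partD_signVec, map_zero, add_zero]
  have hΦ : ∀ x, Φ x - φ x * Φ w = Φ (s (partD K x)) := fun x => by
    have := congrArg Φ (hs x)
    rw [map_add, signDual_partD, zero_add, map_sub, map_smul, smul_eq_mul] at this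
    exact this.symm
  -- Applying Φ to the homotopy identity at the cocycle ω compares the two normalizations.
  have hab : φ ω * Φ w = 1 := by
    have := hΦ ω
    rw [partD_signVec, map_zero, map_zero, signDual_signVec] at this
    exact (sub_eq_zero.1 this).symm
  have hΦ' : ∀ x, Φ (s (partD K (partD K x))) = 0 := fun x => by
    rw [← hΦ, signDual_partD, hφ, zero_mul, sub_zero]
  have hmain : ∀ x, Φ x • ω = φ x • w + (φ ω * Φ (s (partD K x))) • w +
      (φ x * Φ w) • partD K (s ω) + Φ (s (partD K x)) • partD K (s ω) := by
    intro x
    rw [← hΦ, ← hω]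
    have : φ x • w = (φ x * (φ ω * Φ w)) • w := by rw [hab, mul_one]
    rw [this]
    module
  -- The three corrections produce, in the homotopy identity, exactly the terms by which the
  -- projector Φ ⊗ ω exceeds φ ⊗ w in `hmain`.
  refine ⟨s - (Φ w) • φ.smulRight (s ω) - φ ω • (Φ ∘ₗ s).smulRight w -
    (Φ ∘ₗ s ∘ₗ partD K).smulRight (s ω), fun x => ?_⟩
  have h := hs x
  rw [hmain]
  simp only [LinearMap.sub_apply, LinearMap.smul_apply, LinearMap.smulRight_apply,
    LinearMap.comp_apply, map_sub, map_smul, hφ, hw, hΦ', zero_smul, smul_zero, sub_zero]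
  linear_combination (norm := module) h

end PartContraction

open scoped TensorProduct

/-! ### Contractions of tensor products -/

/-- First contract the factor M onto the line of v, then contract N over that line. The operator ε
is the Koszul sign, which acts on v by a scalar c with c² = 1. -/
theorem exists_tensor_contraction {K M N : Type*} [Field K] [AddCommGroup M] [AddCommGroup N]
    [Module K M] [Module K N] {d ε s : M →ₗ[K] M} {φ : M →ₗ[K] K} {v : M} {e t : N →ₗ[K] N}
    {ψ : N →ₗ[K] K} {w : N} {c : K} (hc : c * c = 1) (hdv : d v = 0) (hε : ∀ x, ε (ε x) = x)
    (hεv : ε v = c • v) (hφε : ∀ x, φ (ε x) = c * φ x) (hφd : ∀ x, φ (d x) = 0)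
    (hs : ∀ x, d (s x) + s (d x) = x - φ x • v) (hsε : ∀ x, s (ε x) = -ε (s x))
    (ht : ∀ y, e (t y) + t (e y) = y - ψ y • w) :
    ∃ H : M ⊗[K] N →ₗ[K] M ⊗[K] N, ∀ x,
      (TensorProduct.map d LinearMap.id + TensorProduct.map ε e : M ⊗[K] N →ₗ[K] M ⊗[K] N) (H x) +
        H ((TensorProduct.map d LinearMap.id + TensorProduct.map ε e : M ⊗[K] N →ₗ[K] M ⊗[K] N) x) =
      x - (LinearMap.mul' K K ∘ₗ TensorProduct.map φ ψ) x • (v ⊗ₜ[K] w) := by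
  -- The ε in the second summand cancels the Koszul sign that the total differential puts before e.
  refine ⟨TensorProduct.map s LinearMap.id +
    TensorProduct.map ((φ ∘ₗ ε).smulRight v) t, fun x => ?_⟩
  induction x using TensorProduct.induction_on with
  | zero => simp
  | add x y hx hy =>
    rw [map_add (LinearMap.mul' K K ∘ₗ TensorProduct.map φ ψ), add_smul, add_sub_add_comm, ← hx,
      ← hy]
    simp only [map_add]
    exact add_add_add_comm _ _ _ _
  | tmul x y =>
    have h₁ := congrArg (· ⊗ₜ[K] y) (hs x)
    have h₂ := congrArg ((φ x • v) ⊗ₜ[K] ·) (ht y)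
    simp only [TensorProduct.add_tmul, TensorProduct.sub_tmul, TensorProduct.tmul_add,
      TensorProduct.tmul_sub] at h₁ h₂
    simp only [LinearMap.add_apply, TensorProduct.map_tmul, LinearMap.id_apply, map_add,
      LinearMap.smulRight_apply, LinearMap.comp_apply, map_smul, hdv, LinearMap.mul'_apply,
      smul_zero, TensorProduct.zero_tmul, hε, hεv, hsε, hφd, hφε, zero_smul, smul_smul,
      TensorProduct.neg_tmul, mul_zero]
    rw [mul_right_comm, hc, one_mul]
    simp only [TensorProduct.smul_tmul', TensorProduct.tmul_smul, smul_smul] at h₁ h₂ ⊢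
    rw [mul_comm (ψ y)] at h₂
    linear_combination (norm := module) h₁ + h₂

/-! ### The total complex -/

section Total

variable {K : Type u} [Field K] {p q : ℕ}

variable (K) in
/-- The differential of the total complex of ordered partitions of the outputs and of the inputs. -/
def totalD (p q : ℕ) : PartSpace K p ⊗[K] PartSpace K q →ₗ[K] PartSpace K p ⊗[K] PartSpace K q :=
  TensorProduct.map (partD K) LinearMap.id + TensorProduct.map (partSign K) (partD K)

variable (K) in
/-- The generator of the cohomology of the total complex. -/
def totalVec (p q : ℕ) : PartSpace K p ⊗[K] PartSpace K q := signVec K p ⊗ₜ signVec K q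

variable (K) in
/-- The functional dual to `totalVec`. -/
def totalDual (p q : ℕ) : PartSpace K p ⊗[K] PartSpace K q →ₗ[K] K :=
  LinearMap.mul' K K ∘ₗ TensorProduct.map (signDual K p) (signDual K q)

theorem totalDual_tmul (x : PartSpace K p) (y : PartSpace K q) :
    totalDual K p q (x ⊗ₜ y) = signDual K p x * signDual K q y := by
  simp [totalDual]

theorem totalD_tmul (x : PartSpace K p) (y : PartSpace K q) :
    totalD K p q (x ⊗ₜ y) = partD K x ⊗ₜ y + partSign K x ⊗ₜ partD K y := rfl

theorem totalD_totalVec : totalD K p q (totalVec K p q) = 0 := by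
  simp [totalVec, totalD_tmul, partD_signVec]

theorem totalDual_totalVec [CharZero K] : totalDual K p q (totalVec K p q) = 1 := by
  simp [totalVec, totalDual_tmul, signDual_signVec]

theorem totalDual_totalD (x : PartSpace K p ⊗[K] PartSpace K q) :
    totalDual K p q (totalD K p q x) = 0 := by
  induction x using TensorProduct.induction_on with
  | zero => simp
  | add x y hx hy => rw [map_add, map_add, hx, hy, add_zero]
  | tmul x y => simp [totalD_tmul, totalDual_tmul, signDual_partD]

theorem exists_total_contraction [CharZero K] (p q : ℕ) :
    ∃ H : PartSpace K p ⊗[K] PartSpace K q →ₗ[K] PartSpace K p ⊗[K] PartSpace K q,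
      ∀ x, totalD K p q (H x) + H (totalD K p q x) = x - totalDual K p q x • totalVec K p q := by
  obtain ⟨s, hs, hs'⟩ := exists_sign_contraction (K := K) p
  obtain ⟨t, ht, -⟩ := exists_sign_contraction (K := K) q
  exact exists_tensor_contraction (c := sg K p) (sg_mul_self K _) (partD_signVec p)
    partSign_partSign (partSign_signVec p) signDual_partSign signDual_partD hs hs' ht

/-! ### Corollas and pairs of ordered partitions -/

/-- The ordered partition given by a bunching. -/
def Bunching.toOPart {m : ℕ} (f : Bunching p m) : OPart p where
  m := m
  f x := f.1 x
  lt_iff i := by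
    constructor
    · intro hi
      obtain ⟨x, hx⟩ := f.2 ⟨i, hi⟩
      exact ⟨x, by rw [hx]⟩
    · rintro ⟨x, rfl⟩
      exact (f.1 x).2

theorem Bunching.toOPart_injective {m : ℕ} {f g : Bunching p m} (h : f.toOPart = g.toOPart) :
    f = g :=
  Subtype.ext (funext fun x => Fin.ext (congrFun (congrArg OPart.f h) x))

theorem Bunching.toOPart_merge {m : ℕ} (f : Bunching p (m + 2)) (i : Fin (m + 1)) :
    (f.merge i).toOPart = f.toOPart.merge i (by change (i : ℕ) + 1 < m + 2; omega) := by
  refine OPart.ext rfl (funext fun x => ?_)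
  exact predAbove_val i (f.1 x)

/-- A nonempty ordered partition is given by a bunching. -/
def OPart.toBunching (c : OPart p) (hp : 1 ≤ p) : Bunching p (c.m - 1 + 1) :=
  ⟨fun x => ⟨c.f x, by have := c.f_lt x; omega⟩, fun i => by
    have : 0 < c.m := lt_of_le_of_lt (Nat.zero_le _) (c.f_lt ⟨0, hp⟩)
    obtain ⟨x, hx⟩ := (c.lt_iff i).1 (by omega)
    exact ⟨x, Fin.ext hx⟩⟩

theorem OPart.toOPart_toBunching (c : OPart p) (hp : 1 ≤ p) :
    (c.toBunching hp).toOPart = c := by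
  refine OPart.ext ?_ rfl
  have := c.f_lt ⟨0, hp⟩
  change c.m - 1 + 1 = c.m
  omega

variable {k l : ℤ}

/-- The ordered partitions of the outputs and of the inputs of a corolla. -/
def Corolla.toPair (c : Corolla p q k) : OPart p × OPart q := (c.out.toOPart, c.inp.toOPart)

theorem Corolla.toPair_injective :
    Function.Injective (Corolla.toPair (p := p) (q := q) (k := k)) := by
  rintro ⟨m, n, o, i, h⟩ ⟨m', n', o', i', h'⟩ e
  obtain rfl : m = m' := Nat.succ_injective (congrArg (fun x => x.1.m) e)
  obtain rfl : n = n' := Nat.succ_injective (congrArg (fun x => x.2.m) e)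
  obtain rfl := Bunching.toOPart_injective (congrArg Prod.fst e)
  obtain rfl := Bunching.toOPart_injective (congrArg Prod.snd e)
  rfl

theorem Corolla.deg_toPair (c : Corolla p q k) :
    k = 3 - (c.toPair.1.m : ℤ) - (c.toPair.2.m : ℤ) := c.deg

theorem Corolla.exists_toPair (hp : 1 ≤ p) (hq : 1 ≤ q) {x : OPart p × OPart q}
    (h : k = 3 - (x.1.m : ℤ) - (x.2.m : ℤ)) : ∃ c : Corolla p q k, c.toPair = x := by
  refine ⟨⟨_, _, x.1.toBunching hp, x.2.toBunching hq, ?_⟩,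
    Prod.ext (x.1.toOPart_toBunching hp) (x.2.toOPart_toBunching hq)⟩
  have := x.1.f_lt ⟨0, hp⟩
  have := x.2.f_lt ⟨0, hq⟩
  omega

variable (K) in
/-- The corollas of a given degree inside the total complex. -/
def corollaIncl (p q : ℕ) (k : ℤ) :
    (Corolla p q k →₀ K) →ₗ[K] PartSpace K p ⊗[K] PartSpace K q :=
  Finsupp.linearCombination K fun c => c.toPair.1.vec K ⊗ₜ c.toPair.2.vec K

open Classical in
variable (K) in
/-- The projection of the total complex to the corollas of a given degree. -/
def corollaRestr (p q : ℕ) (k : ℤ) :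
    PartSpace K p ⊗[K] PartSpace K q →ₗ[K] (Corolla p q k →₀ K) :=
  TensorProduct.lift (partLift K fun a => partLift K fun b =>
    if h : ∃ c : Corolla p q k, c.toPair = (a, b) then Finsupp.single h.choose 1 else 0)

theorem corollaIncl_single (c : Corolla p q k) :
    corollaIncl K p q k (Finsupp.single c 1) = c.toPair.1.vec K ⊗ₜ c.toPair.2.vec K := by
  simp [corollaIncl]

theorem corollaRestr_toPair (c : Corolla p q k) :
    corollaRestr K p q k (c.toPair.1.vec K ⊗ₜ c.toPair.2.vec K) = Finsupp.single c 1 := by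
  have h : ∃ c' : Corolla p q k, c'.toPair = (c.toPair.1, c.toPair.2) := ⟨c, rfl⟩
  rw [corollaRestr, TensorProduct.lift.tmul, partLift_vec, partLift_vec, dif_pos h]
  congr 1
  exact Corolla.toPair_injective h.choose_spec

theorem corollaRestr_of_ne {a : OPart p} {b : OPart q} (h : k ≠ 3 - (a.m : ℤ) - (b.m : ℤ)) :
    corollaRestr K p q k (a.vec K ⊗ₜ b.vec K) = 0 := by
  rw [corollaRestr, TensorProduct.lift.tmul, partLift_vec, partLift_vec, dif_neg]
  rintro ⟨c, hc⟩
  apply h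
  rw [c.deg_toPair, hc]

theorem corollaRestr_corollaIncl (x : Corolla p q k →₀ K) :
    corollaRestr K p q k (corollaIncl K p q k x) = x := by
  suffices corollaRestr K p q k ∘ₗ corollaIncl K p q k = LinearMap.id from
    LinearMap.congr_fun this x
  refine Finsupp.lhom_ext' fun c => LinearMap.ext_ring ?_
  simp only [LinearMap.comp_apply, Finsupp.lsingle_apply, LinearMap.id_apply]
  rw [corollaIncl_single, corollaRestr_toPair]

theorem corollaIncl_injective : Function.Injective (corollaIncl K p q k) :=
  Function.LeftInverse.injective corollaRestr_corollaIncl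

theorem part_tensor_ext {M : Type*} [AddCommGroup M] [Module K M]
    {f g : PartSpace K p ⊗[K] PartSpace K q →ₗ[K] M}
    (h : ∀ (a : OPart p) (b : OPart q), f (a.vec K ⊗ₜ b.vec K) = g (a.vec K ⊗ₜ b.vec K)) :
    f = g :=
  TensorProduct.ext (part_ext fun a => part_ext fun b => h a b)

/-- The sign (-1)^a before the merges of inputs, with a the number of output bunches, is the sign
operator on the first tensor factor. -/
theorem corollaIncl_corollasD (h : k + 1 = l) (x : Corolla p q k →₀ K) :
    corollaIncl K p q l ((corollasD K).d h x) = totalD K p q (corollaIncl K p q k x) := by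
  suffices corollaIncl K p q l ∘ₗ Finsupp.linearCombination K (corollaD K h) =
      totalD K p q ∘ₗ corollaIncl K p q k from LinearMap.congr_fun this x
  refine Finsupp.lhom_ext' fun c => LinearMap.ext_ring ?_
  simp only [LinearMap.comp_apply, Finsupp.lsingle_apply]
  rw [corollaIncl_single, totalD_tmul, Finsupp.linearCombination_single, one_smul, corollaD,
    map_add, map_smul, partSign_vec]
  congr 1
  · obtain ⟨_ | m, n, o, i, hk⟩ := c
    · rw [partD_vec (n := 0) _ (by rfl)]
      simp [mergeOut]
    · simp only [mergeOut, map_sum]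
      rw [partD_vec (n := m + 1) _ (by rfl), Finset.sum_range, TensorProduct.sum_tmul]
      refine Fintype.sum_congr _ _ fun j => ?_
      rw [← mul_one (sg K _), ← smul_eq_mul, ← Finsupp.smul_single, map_smul, corollaIncl_single,
        smul_eq_mul, mul_one, ← TensorProduct.smul_tmul',
        mergeAt_vec _ (by change (j : ℕ) + 1 < m + 2; omega)]
      simp only [Corolla.toPair]
      rw [Bunching.toOPart_merge]
  · obtain ⟨m, _ | n, o, i, hk⟩ := c
    · rw [partD_vec (n := 0) _ (by rfl)]
      simp [mergeInp]
    · simp only [mergeInp, map_sum]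
      rw [partD_vec (n := n + 1) _ (by rfl), Finset.sum_range, TensorProduct.tmul_sum, smul_sum]
      refine Fintype.sum_congr _ _ fun j => ?_
      rw [← mul_one (sg K ((j : ℤ) + 1)), ← smul_eq_mul, ← Finsupp.smul_single, map_smul,
        corollaIncl_single, smul_eq_mul, mul_one, TensorProduct.tmul_smul,
        ← TensorProduct.smul_tmul',
        mergeAt_vec _ (by change (j : ℕ) + 1 < n + 2; omega), smul_comm]
      simp only [Corolla.toPair]
      rw [Bunching.toOPart_merge]
      rfl

/-- Each merge raises the degree by one, so projection to a degree is compatible with the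
differentials. Legs on both sides are needed for every pair of partitions to come from a corolla. -/
theorem corollaRestr_totalD (hp : 1 ≤ p) (hq : 1 ≤ q) (h : k + 1 = l)
    (x : PartSpace K p ⊗[K] PartSpace K q) :
    corollaRestr K p q l (totalD K p q x) = (corollasD K).d h (corollaRestr K p q k x) := by
  suffices corollaRestr K p q l ∘ₗ totalD K p q =
      Finsupp.linearCombination K (corollaD K h) ∘ₗ corollaRestr K p q k from
    LinearMap.congr_fun this x
  refine part_tensor_ext fun a b => ?_
  simp only [LinearMap.comp_apply]
  by_cases hk : k = 3 - (a.m : ℤ) - (b.m : ℤ)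
  · obtain ⟨c, hc⟩ := Corolla.exists_toPair hp hq (x := (a, b)) hk
    have ha : c.toPair.1 = a := by rw [hc]
    have hb : c.toPair.2 = b := by rw [hc]
    rw [← ha, ← hb, corollaRestr_toPair, ← corollaIncl_single, ← corollaIncl_corollasD h]
    exact corollaRestr_corollaIncl _
  · rw [corollaRestr_of_ne hk, map_zero, totalD_tmul, partD_vec a (n := a.m) (by omega),
      partD_vec b (n := b.m) (by omega), partSign_vec, TensorProduct.sum_tmul,
      TensorProduct.tmul_sum, map_add, map_sum, map_sum]
    have h₁ : ∀ i ∈ range a.m, corollaRestr K p q l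
        ((sg K ((i : ℤ) + 1) • mergeAt K i (a.vec K)) ⊗ₜ b.vec K) = 0 := by
      intro i _
      rw [← TensorProduct.smul_tmul', map_smul]
      rcases lt_or_ge (i + 1) a.m with hi | hi
      · rw [mergeAt_vec a hi, corollaRestr_of_ne, smul_zero]
        have : ((a.merge i hi).m : ℤ) = a.m - 1 := by
          change ((a.m - 1 : ℕ) : ℤ) = _
          omega
        omega
      · rw [mergeAt_vec_of_le a hi, TensorProduct.zero_tmul, map_zero, smul_zero]
    have h₂ : ∀ i ∈ range b.m, corollaRestr K p q l
        ((sg K a.m • a.vec K) ⊗ₜ (sg K ((i : ℤ) + 1) • mergeAt K i (b.vec K))) = 0 := by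
      intro i _
      rw [← TensorProduct.smul_tmul', TensorProduct.tmul_smul, map_smul, map_smul]
      rcases lt_or_ge (i + 1) b.m with hi | hi
      · rw [mergeAt_vec b hi, corollaRestr_of_ne, smul_zero, smul_zero]
        have : ((b.merge i hi).m : ℤ) = b.m - 1 := by
          change ((b.m - 1 : ℕ) : ℤ) = _
          omega
        omega
      · rw [mergeAt_vec_of_le b hi, TensorProduct.tmul_zero, map_zero, smul_zero, smul_zero]
    rw [Finset.sum_eq_zero h₁, Finset.sum_eq_zero h₂, add_zero]

/-- The class involves only partitions into singletons, all of which sit in degree 3 - p - q. -/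
theorem corollaIncl_corollaRestr_totalVec (hp : 1 ≤ p) (hq : 1 ≤ q)
    (h : k = 3 - (p : ℤ) - (q : ℤ)) :
    corollaIncl K p q k (corollaRestr K p q k (totalVec K p q)) = totalVec K p q := by
  simp only [totalVec, signVec, TensorProduct.sum_tmul, TensorProduct.tmul_sum, map_sum,
    ← TensorProduct.smul_tmul', TensorProduct.tmul_smul, map_smul]
  refine Fintype.sum_congr _ _ fun τ => congrArg (permSign K τ • ·) ?_
  refine Fintype.sum_congr _ _ fun σ => ?_
  obtain ⟨c, hc⟩ := Corolla.exists_toPair hp hq (x := (OPart.ofPerm σ, OPart.ofPerm τ)) h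
  have ha : c.toPair.1 = OPart.ofPerm σ := by rw [hc]
  have hb : c.toPair.2 = OPart.ofPerm τ := by rw [hc]
  rw [← ha, ← hb, corollaRestr_toPair, corollaIncl_single]

theorem corollaRestr_totalVec_of_ne (h : k ≠ 3 - (p : ℤ) - (q : ℤ)) :
    corollaRestr K p q k (totalVec K p q) = 0 := by
  simp only [totalVec, signVec, TensorProduct.sum_tmul, TensorProduct.tmul_sum, map_sum,
    ← TensorProduct.smul_tmul', TensorProduct.tmul_smul, map_smul]
  refine Finset.sum_eq_zero fun τ _ => smul_eq_zero_of_right _ ?_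
  refine Finset.sum_eq_zero fun σ _ => ?_
  rw [corollaRestr_of_ne (a := OPart.ofPerm σ) (b := OPart.ofPerm τ) h, smul_zero]

/-! ### Relabelling -/

/-- Relabelling of an ordered partition. -/
def OPart.relabel (σ : Equiv.Perm (Fin p)) (c : OPart p) : OPart p where
  m := c.m
  f := c.f ∘ σ
  lt_iff i := by rw [c.lt_iff]; exact (Equiv.exists_congr_left σ.symm).trans (by simp)

variable (K) in
/-- Relabelling of ordered partitions. -/
def partAct (σ : Equiv.Perm (Fin p)) : PartSpace K p →ₗ[K] PartSpace K p :=
  partLift K fun c => (c.relabel σ).vec K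

theorem partAct_vec (σ : Equiv.Perm (Fin p)) (c : OPart p) :
    partAct K σ (c.vec K) = (c.relabel σ).vec K := partLift_vec _ c

theorem OPart.relabel_ofPerm (σ τ : Equiv.Perm (Fin p)) :
    (OPart.ofPerm τ).relabel σ = OPart.ofPerm (τ * σ) := rfl

theorem partAct_signVec (σ : Equiv.Perm (Fin p)) :
    partAct K σ (signVec K p) = permSign K σ • signVec K p := by
  simp only [signVec, map_sum, map_smul, partAct_vec, OPart.relabel_ofPerm, smul_sum, smul_smul]
  refine Fintype.sum_equiv (Equiv.mulRight σ) _ _ fun τ => ?_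
  rw [Equiv.coe_mulRight, permSign_mul, mul_left_comm, permSign_mul_self, mul_one]

theorem signCoeff_relabel (σ : Equiv.Perm (Fin p)) (c : OPart p) :
    signCoeff K (c.relabel σ) = permSign K σ * signCoeff K c := by
  classical
  rw [signCoeff, signCoeff, mul_sum]
  refine (Fintype.sum_equiv (Equiv.mulRight σ) _ _ fun τ => ?_).symm
  rw [Equiv.coe_mulRight, permSign_mul, mul_ite, mul_zero, mul_comm]
  refine if_congr ?_ rfl rfl
  rw [← OPart.relabel_ofPerm]
  refine ⟨fun h => by rw [h], fun h => OPart.ext (congrArg OPart.m h :) (funext fun x => ?_)⟩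
  have := congrFun (congrArg OPart.f h) (σ.symm x)
  simpa [OPart.relabel] using this

theorem signDual_partAct (σ : Equiv.Perm (Fin p)) (x : PartSpace K p) :
    signDual K p (partAct K σ x) = permSign K σ * signDual K p x := by
  suffices signDual K p ∘ₗ partAct K σ = permSign K σ • signDual K p from
    LinearMap.congr_fun this x
  refine part_ext fun c => ?_
  rw [LinearMap.comp_apply, partAct_vec, signDual_vec, LinearMap.smul_apply, signDual_vec,
    signCoeff_relabel, smul_eq_mul, mul_left_comm]

/-- The inverse appears because outputs are acted on from the left, while relabelling is
precomposition. -/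
theorem corollaIncl_act (σ : Equiv.Perm (Fin p)) (τ : Equiv.Perm (Fin q)) (x : Corolla p q k →₀ K) :
    corollaIncl K p q k ((corollas K).act σ τ x) =
      TensorProduct.map (partAct K σ⁻¹) (partAct K τ) (corollaIncl K p q k x) := by
  suffices corollaIncl K p q k ∘ₗ Finsupp.lmapDomain K K (Corolla.relabel σ τ) =
      TensorProduct.map (partAct K σ⁻¹) (partAct K τ) ∘ₗ corollaIncl K p q k from
    LinearMap.congr_fun this x
  refine Finsupp.lhom_ext' fun c => LinearMap.ext_ring ?_
  simp only [LinearMap.comp_apply, Finsupp.lsingle_apply, Finsupp.lmapDomain_apply,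
    Finsupp.mapDomain_single]
  rw [corollaIncl_single, corollaIncl_single, TensorProduct.map_tmul, partAct_vec, partAct_vec]
  rfl

theorem totalDual_act (σ : Equiv.Perm (Fin p)) (τ : Equiv.Perm (Fin q)) (x : Corolla p q k →₀ K) :
    totalDual K p q (corollaIncl K p q k ((corollas K).act σ τ x)) =
      permSign K σ * permSign K τ * totalDual K p q (corollaIncl K p q k x) := by
  rw [corollaIncl_act]
  generalize corollaIncl K p q k x = y
  induction y using TensorProduct.induction_on with
  | zero => simp
  | add x y hx hy => simp only [map_add, hx, hy, mul_add]
  | tmul x y =>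
    rw [TensorProduct.map_tmul, totalDual_tmul, totalDual_tmul, signDual_partAct,
      signDual_partAct, permSign_inv]
    ring

theorem act_corollaRestr_totalVec (hp : 1 ≤ p) (hq : 1 ≤ q) (h : k = 3 - (p : ℤ) - (q : ℤ))
    (σ : Equiv.Perm (Fin p)) (τ : Equiv.Perm (Fin q)) :
    (corollas K).act σ τ (corollaRestr K p q k (totalVec K p q)) =
      (permSign K σ * permSign K τ) • corollaRestr K p q k (totalVec K p q) := by
  apply corollaIncl_injective (K := K) (p := p) (q := q) (k := k)
  rw [corollaIncl_act, map_smul, corollaIncl_corollaRestr_totalVec hp hq h, totalVec,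
    TensorProduct.map_tmul, partAct_signVec, partAct_signVec, permSign_inv]
  rw [← TensorProduct.smul_tmul', TensorProduct.tmul_smul, smul_smul]

end Total

/-! ### Averaging of a homotopy -/

section Average

variable {K : Type u} [Field K] {E L : SBimodule K}

/-- The average over the permutations of the legs of a family of maps of degree `-1`. -/
def SBimodule.average (E : SBimodule K)
    (h : ∀ {p q : ℕ} {k l : ℤ}, k + -1 = l → E.V p q k →ₗ[K] E.V p q l) : E.LoweringMap where
  h {p q _ _} hk := (Fintype.card (Equiv.Perm (Fin p) × Equiv.Perm (Fin q)) : K)⁻¹ •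
    ∑ x : Equiv.Perm (Fin p) × Equiv.Perm (Fin q),
      E.act x.1 x.2 ∘ₗ h hk ∘ₗ E.act x.1⁻¹ x.2⁻¹
  h_act {p q k l} hk σ τ e := by
    simp only [LinearMap.smul_apply, LinearMap.sum_apply, LinearMap.comp_apply, map_smul, map_sum,
      E.act_act]
    congr 1
    refine (Fintype.sum_equiv ((Equiv.mulLeft σ).prodCongr (Equiv.mulRight τ)) _ _
      fun x => ?_).symm
    simp

theorem SBimodule.average_h (h : ∀ {p q : ℕ} {k l : ℤ}, k + -1 = l → E.V p q k →ₗ[K] E.V p q l)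
    {p q : ℕ} {k l : ℤ} (hk : k + -1 = l) (e : E.V p q k) :
    (E.average h).h hk e = (Fintype.card (Equiv.Perm (Fin p) × Equiv.Perm (Fin q)) : K)⁻¹ •
      ∑ x : Equiv.Perm (Fin p) × Equiv.Perm (Fin q),
        E.act x.1 x.2 (h hk (E.act x.1⁻¹ x.2⁻¹ e)) := by
  simp [SBimodule.average]

/-- The differential, i and r are equivariant, so every conjugate of the homotopy satisfies the same
identity, and so does the mean over the finite group. -/
theorem average_htpy [CharZero K] (D : E.Differential) (i : L.Morphism E) (r : E.Morphism L)
    (h : ∀ {p q : ℕ} {k l : ℤ}, k + -1 = l → E.V p q k →ₗ[K] E.V p q l)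
    (htpy : ∀ {p q : ℕ} {k l m : ℤ} (h₁ : k + -1 = l) (h₂ : l + 1 = k) (h₃ : k + 1 = m)
      (h₄ : m + -1 = k) (e : E.V p q k),
      D.d h₂ (h h₁ e) + h h₄ (D.d h₃ e) = e - i.map (r.map e))
    {p q : ℕ} {k l m : ℤ} (h₁ : k + -1 = l) (h₂ : l + 1 = k) (h₃ : k + 1 = m)
    (h₄ : m + -1 = k) (e : E.V p q k) :
    D.d h₂ ((E.average h).h h₁ e) + (E.average h).h h₄ (D.d h₃ e) = e - i.map (r.map e) := by
  rw [SBimodule.average_h, SBimodule.average_h, map_smul, map_sum, ← smul_add,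
    ← Finset.sum_add_distrib]
  have key : ∀ x : Equiv.Perm (Fin p) × Equiv.Perm (Fin q),
      D.d h₂ (E.act x.1 x.2 (h h₁ (E.act x.1⁻¹ x.2⁻¹ e))) +
        E.act x.1 x.2 (h h₄ (E.act x.1⁻¹ x.2⁻¹ (D.d h₃ e))) = e - i.map (r.map e) := by
    intro x
    rw [← D.d_act, D.d_act, ← map_add, htpy h₁ h₂ h₃ h₄, r.map_act, i.map_act, ← map_sub,
      E.act_act, mul_inv_cancel, inv_mul_cancel, E.act_one]
  rw [Fintype.sum_congr _ _ key, sum_const, ← Nat.cast_smul_eq_nsmul K, smul_smul, card_univ,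
    inv_mul_cancel₀ (Nat.cast_ne_zero.2 Fintype.card_ne_zero), one_smul]

end Average

/-! ### The contraction of the corollas -/

section Corollas

variable {K : Type u} [Field K] {p q : ℕ} {k l : ℤ}

theorem Corolla.one_le (c : Corolla p q k) : 1 ≤ p ∧ 1 ≤ q := by
  obtain ⟨x, -⟩ := c.out.2 0
  obtain ⟨y, -⟩ := c.inp.2 0
  exact ⟨x.pos, y.pos⟩

theorem corolla_eq_zero (h : ¬(1 ≤ p ∧ 1 ≤ q)) (e : (corollas K).V p q k) : e = 0 :=
  Finsupp.ext fun c => absurd c.one_le h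

theorem lieBGenerators_act (σ : Equiv.Perm (Fin p)) (τ : Equiv.Perm (Fin q))
    (e : (lieBGenerators K).V p q k) :
    (lieBGenerators K).act σ τ e = (permSign K σ * permSign K τ) • e := by
  change (((Equiv.Perm.sign σ * Equiv.Perm.sign τ : ℤˣ) : ℤ) : K) • e = _
  rw [Units.val_mul, Int.cast_mul]
  rfl

theorem lieBGenerators_eq_zero (h : ¬(1 ≤ p ∧ 1 ≤ q ∧ k = 3 - (p : ℤ) - (q : ℤ)))
    (e : (lieBGenerators K).V p q k) : e = 0 :=
  Finsupp.ext fun c => absurd c.down h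

variable (K) in
/-- The skew-symmetrized sum of the corollas with finest partitions. -/
def corollaCocycle (p q : ℕ) (k : ℤ) : (corollas K).V p q k :=
  corollaRestr K p q k (totalVec K p q)

variable (K) in
/-- The functional on corollas dual to `corollaCocycle`. -/
def corollaDual (p q : ℕ) (k : ℤ) : (corollas K).V p q k →ₗ[K] K :=
  totalDual K p q ∘ₗ corollaIncl K p q k

variable (K) in
/-- The generator of `lieBGenerators`. -/
def lieBGenerator (h : 1 ≤ p ∧ 1 ≤ q ∧ k = 3 - (p : ℤ) - (q : ℤ)) : (lieBGenerators K).V p q k :=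
  Finsupp.single ⟨h⟩ 1

variable (K) in
/-- The functional dual to `lieBGenerator`. -/
def lieBDual (p q : ℕ) (k : ℤ) : (lieBGenerators K).V p q k →ₗ[K] K :=
  Finsupp.linearCombination K fun _ => 1

theorem lieBDual_lieBGenerator (h : 1 ≤ p ∧ 1 ≤ q ∧ k = 3 - (p : ℤ) - (q : ℤ)) :
    lieBDual K p q k (lieBGenerator K h) = 1 :=
  (Finsupp.linearCombination_single _ _ _).trans (one_smul _ _)

theorem lieBDual_smul_lieBGenerator (h : 1 ≤ p ∧ 1 ≤ q ∧ k = 3 - (p : ℤ) - (q : ℤ))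
    (e : (lieBGenerators K).V p q k) : lieBDual K p q k e • lieBGenerator K h = e := by
  suffices (lieBDual K p q k).smulRight (lieBGenerator K h) = LinearMap.id from
    LinearMap.congr_fun this e
  refine Finsupp.lhom_ext' fun c => LinearMap.ext_ring ?_
  change lieBDual K p q k (lieBGenerator K h) • lieBGenerator K h = lieBGenerator K h
  rw [lieBDual_lieBGenerator, one_smul]

theorem corollasD_corollaCocycle (hp : 1 ≤ p) (hq : 1 ≤ q) (h : k + 1 = l) :
    (corollasD K).d h (corollaCocycle K p q k) = 0 := by
  refine (corollaRestr_totalD hp hq h _).symm.trans ?_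
  rw [totalD_totalVec, map_zero]
  rfl

theorem corollaDual_corollaCocycle [CharZero K]
    (h : 1 ≤ p ∧ 1 ≤ q ∧ k = 3 - (p : ℤ) - (q : ℤ)) :
    corollaDual K p q k (corollaCocycle K p q k) = 1 := by
  refine (congrArg (totalDual K p q) (corollaIncl_corollaRestr_totalVec h.1 h.2.1 h.2.2)).trans ?_
  exact totalDual_totalVec

theorem corollaDual_corollasD (h : k + 1 = l) (e : (corollas K).V p q k) :
    corollaDual K p q l ((corollasD K).d h e) = 0 :=
  (congrArg (totalDual K p q) (corollaIncl_corollasD h e)).trans (totalDual_totalD _)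

variable (K) in
/-- The inclusion of the skew-symmetric generators into the corollas. -/
def lieBIncl : (lieBGenerators K).Morphism (corollas K) where
  map {p q k} := (lieBDual K p q k).smulRight (corollaCocycle K p q k)
  map_act {p q k} σ τ e := by
    by_cases h : 1 ≤ p ∧ 1 ≤ q ∧ k = 3 - (p : ℤ) - (q : ℤ)
    · rw [lieBGenerators_act, map_smul, LinearMap.smulRight_apply, map_smul, smul_comm]
      exact congrArg _ (act_corollaRestr_totalVec h.1 h.2.1 h.2.2 σ τ).symm
    · rw [lieBGenerators_eq_zero h e, map_zero, map_zero, map_zero]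

open Classical in
variable (K) in
/-- The projection of the corollas to their skew-symmetric part. -/
def lieBProj : (corollas K).Morphism (lieBGenerators K) where
  map {p q k} := if h : 1 ≤ p ∧ 1 ≤ q ∧ k = 3 - (p : ℤ) - (q : ℤ) then
      (corollaDual K p q k).smulRight (lieBGenerator K h)
    else 0
  map_act {p q k} σ τ e := by
    split_ifs with h
    · rw [lieBGenerators_act, LinearMap.smulRight_apply, LinearMap.smulRight_apply, smul_smul]
      exact congrArg (· • lieBGenerator K h) (totalDual_act σ τ e)
    · rw [LinearMap.zero_apply, LinearMap.zero_apply, map_zero]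

theorem lieBIncl_apply (e : (lieBGenerators K).V p q k) :
    (lieBIncl K).map e = lieBDual K p q k e • corollaCocycle K p q k := rfl

theorem lieBProj_apply (h : 1 ≤ p ∧ 1 ≤ q ∧ k = 3 - (p : ℤ) - (q : ℤ))
    (e : (corollas K).V p q k) :
    (lieBProj K).map e = corollaDual K p q k e • lieBGenerator K h := by
  simp only [lieBProj]
  rw [dif_pos h, LinearMap.smulRight_apply]

/-- No condition on the degree is needed: outside degree 3 - p - q both sides vanish. -/
theorem lieBIncl_lieBProj (hp : 1 ≤ p) (hq : 1 ≤ q) (e : (corollas K).V p q k) :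
    (lieBIncl K).map ((lieBProj K).map e) = corollaDual K p q k e • corollaCocycle K p q k := by
  by_cases h : k = 3 - (p : ℤ) - (q : ℤ)
  · rw [lieBProj_apply ⟨hp, hq, h⟩, lieBIncl_apply, map_smul, lieBDual_lieBGenerator, smul_eq_mul,
      mul_one]
  · rw [lieBGenerators_eq_zero (fun h' => h h'.2.2) ((lieBProj K).map e), map_zero,
      show corollaCocycle K p q k = 0 from corollaRestr_totalVec_of_ne h, smul_zero]

theorem lieBProj_lieBIncl [CharZero K] (e : (lieBGenerators K).V p q k) :
    (lieBProj K).map ((lieBIncl K).map e) = e := by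
  by_cases h : 1 ≤ p ∧ 1 ≤ q ∧ k = 3 - (p : ℤ) - (q : ℤ)
  · rw [lieBProj_apply h, lieBIncl_apply, map_smul, corollaDual_corollaCocycle h, smul_eq_mul,
      mul_one, lieBDual_smul_lieBGenerator]
  · rw [lieBGenerators_eq_zero h e, map_zero, map_zero]

theorem corollasD_lieBIncl (h : k + 1 = l) (e : (lieBGenerators K).V p q k) :
    (corollasD K).d h ((lieBIncl K).map e) = 0 := by
  by_cases hk : 1 ≤ p ∧ 1 ≤ q ∧ k = 3 - (p : ℤ) - (q : ℤ)
  · rw [lieBIncl_apply, map_smul, corollasD_corollaCocycle hk.1 hk.2.1, smul_zero]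
  · rw [lieBGenerators_eq_zero hk e, map_zero, map_zero]

theorem lieBProj_corollasD (h : k + 1 = l) (e : (corollas K).V p q k) :
    (lieBProj K).map ((corollasD K).d h e) = 0 := by
  by_cases hl : 1 ≤ p ∧ 1 ≤ q ∧ l = 3 - (p : ℤ) - (q : ℤ)
  · rw [lieBProj_apply hl, corollaDual_corollasD, zero_smul]
  · exact lieBGenerators_eq_zero hl _

theorem exists_corollas_htpy [CharZero K] (p q : ℕ) :
    ∃ H : ∀ {k l : ℤ}, k + -1 = l → (corollas K).V p q k →ₗ[K] (corollas K).V p q l,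
      ∀ {k l m : ℤ} (h₁ : k + -1 = l) (h₂ : l + 1 = k) (h₃ : k + 1 = m) (h₄ : m + -1 = k)
        (e : (corollas K).V p q k),
        (corollasD K).d h₂ (H h₁ e) + H h₄ ((corollasD K).d h₃ e) =
          e - (lieBIncl K).map ((lieBProj K).map e) := by
  obtain ⟨H, hH⟩ := exists_total_contraction (K := K) p q
  -- H is not known to be homogeneous; only its component of degree -1 is kept. The identity
  -- survives because inclusion and projection commute with the differentials.
  refine ⟨fun {k l} _ => corollaRestr K p q l ∘ₗ H ∘ₗ corollaIncl K p q k, ?_⟩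
  intro k l m h₁ h₂ h₃ h₄ e
  by_cases h : 1 ≤ p ∧ 1 ≤ q
  · have key (x : Corolla p q k →₀ K) :=
      congrArg (corollaRestr K p q k) (hH (corollaIncl K p q k x))
    simp only [map_add, map_sub, map_smul, corollaRestr_corollaIncl,
      corollaRestr_totalD h.1 h.2 h₂, ← corollaIncl_corollasD h₃] at key
    rw [lieBIncl_lieBProj h.1 h.2]
    exact key e
  -- Without outputs or without inputs there are no corollas.
  · rw [corolla_eq_zero h (_ - _), corolla_eq_zero h (_ + _)]

variable (K) in
/-- The dg `S`-bimodule of corollas contracts to its skew-symmetric part. -/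
theorem exists_corollas_contraction [CharZero K] :
    Nonempty (SBimodule.Contraction (corollasD K) (lieBGenerators K)) := by
  choose H hH using exists_corollas_htpy (K := K)
  exact ⟨⟨lieBIncl K, lieBProj K, (corollas K).average fun {p q _ _} => H p q, lieBProj_lieBIncl,
    corollasD_lieBIncl, lieBProj_corollasD, average_htpy _ _ _ _ fun {p q _ _ _} => hH p q⟩⟩

/-- The identity is 1 = (p + q - 2) + (3 - p - q); the truncated subtraction is exact since p, q ≥
1. It is what reconciles the two completions. -/
theorem lieBGenerators_weightShift :
    WeightShift (lieBGenerators K) (fun _ _ => 1) fun p q => p + q - 2 := by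
  intro p q k e
  by_cases h : 1 ≤ p ∧ 1 ≤ q ∧ k = 3 - (p : ℤ) - (q : ℤ)
  · left
    dsimp only
    omega
  · exact Or.inr (lieBGenerators_eq_zero h e)

end Corollas

end DefQuant

end

theorem mainTheorem4 (K : Type*) [Field K] [CharZero K] :
    Nonempty (DefQuant.GradedProp.Iso (DefQuant.cohomology (DefQuant.d1 K))
      (DefQuant.LieBInfPlusHat K)) := by
  obtain ⟨C⟩ := DefQuant.exists_corollas_contraction K
  exact ⟨DefQuant.cohomologyIso C DefQuant.lieBGenerators_weightShift⟩
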